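/- **Setting.** Let $\mathcal C$ be a category with finite products. *Comprehension categories.* A comprehension category $(\mathcal C,\mathcal T)$ is a Grothendieck fibration $\mathcal T\to\mathcal C$ with a Cartesian functor over $\mathcal C$ to the target projection $\mathcal C^{\to}\to\mathcal C$, written $A\mapsto(\Gamma.A\to\Gamma)$ for $A$ over $\Gamma$; Cartesian means that Cartesian arrows are sent to pullback squares. A dependent projection is a map isomorphic (in $\mathcal C^{\to}$) to some $\Gamma.A\to\Gamma$. A display map is a map isomorphic to a finite, possibly empty, composite of such maps. $\mathcal D(\mathcal T)$ (resp. $\mathcal D_1(\mathcal T)$) is the category of display maps (resp. dependent projections) and pullback squares. $\mathcal D_{1,*}(\mathcal T)$ is the category of dependent projections with a section, and pullback squares compatible with the sections. $\mathcal T_{\cong}$ has the objects of $\mathcal T$ and the Cartesian arrows. *Parameter schemes.* A parameter scheme $\mathcal P$ over $(\mathcal C,\mathcal T)$ and its instantiation $\mathrm{Inst}(\mathcal P)\to\mathcal C$ are defined by induction. * The empty scheme has instantiation $\mathcal C$. * $\mathcal P$ may be extended by a type parameter, i.e. a functor $\alpha\colon\mathrm{Inst}(\mathcal P)\to\mathcal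 D(\mathcal T)$ over $\mathcal C$ (via the codomain). The new instantiation is the strict pullback of $\mathcal T_{\cong}\to\mathcal C$ along $\mathrm{dom}\circ\alpha$. * $\mathcal P$ may be extended by a term parameter, i.e. a functor $\alpha$ as before together with a functor $\beta\colon\mathrm{Inst}(\mathcal P)\to\mathcal D_1(\mathcal T)$ with $\mathrm{cod}\circ\beta=\mathrm{dom}\circ\alpha$. The new instantiation is the strict pullback of $\mathcal D_{1,*}(\mathcal T)\to\mathcal D_1(\mathcal T)$ along $\beta$. *FCoSwPs.* A fibred category of structures with parameters (FCoSwP) $(\mathcal C,\mathcal T,\mathcal S,\mathcal P,\mathrm{Inst}(\mathcal P))$ over $\mathcal C$ consists of a comprehension category $(\mathcal C,\mathcal T)$, a parameter scheme $\mathcal P$ over it with its instantiation, a Grothendieck fibration $\mathcal S\to\mathcal C$, and a Cartesian functor over $\mathcal C$ $$\mathcal S\to\mathrm{Inst}(\mathcal P)\times_{\mathcal C}\mathcal C^{\to}$$ which is faithful, an isofibration, and amnestic (an isomorphism mapped to an identity is an identity). *Filter quotients.* Let $\Phi$ be a filter of subterminal objects of $\mathcal C$. The filter quotient of $\mathcal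 C$ has the objects of $\mathcal C$, and its arrows $X\to Y$ are the classes of arrows $X\times U\to Y$ with $U\in\Phi$, two being identified if they agree on $X\times W$ for some $W\in\Phi$ below both domains. For $U\in\Phi$ let $\mathcal C_U\subseteq\mathcal C$ be the full subcategory of the objects that admit a map to $U$. For a Grothendieck fibration $p\colon\mathcal F\to\mathcal C$ let $\mathcal F_U=\mathcal C_U\times_{\mathcal C}\mathcal F$. For $V\le U$ in $\Phi$, restricting an object $x$ along $p(x)\times V\to p(x)$ by a Cartesian arrow gives $\mathcal F_U\to\mathcal F_V$. To make these functors strictly functorial in $V\le U$, replace $\mathcal F_U$ by the equivalent category of objects of $\mathcal F_U$ equipped with a compatible system of restrictions to all $V\le U$ in $\Phi$. Let $$\mathcal F_\Phi=\operatorname{colim}_{U\in\Phi^{op}}\mathcal F_U$$ be the resulting filtered colimit of categories. It is functorial for functors and natural transformations compatible with restriction. This defines $\mathcal C_\Phi$ (taking $p=\mathrm{id}_{\mathcal C}$), and $\mathcal T_\Phi$, $\mathcal S_\Phi$, $\mathrm{Inst}(\mathcal P)_\Phi$ over $\mathcal C_\Phi$, together with an induced functor $\mathcal T_\Phi\to(\mathcal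 C_\Phi)^{\to}$. **Proposition.** Let $(\mathcal C,\mathcal T,\mathcal S,\mathcal P,\mathrm{Inst}(\mathcal P))$ be an FCoSwP over $\mathcal C$ such that $\mathcal T$ and $\mathcal S$ have terminal objects, and let $\Phi$ be a filter of subterminal objects of $\mathcal C$. Then: 1. $\mathcal C_\Phi$ is equivalent to the filter quotient of $\mathcal C$. Up to natural isomorphism, this equivalence is compatible with the canonical functors from the $\mathcal C_U$. 2. There is a parameter scheme $\mathcal P_\Phi$ over $(\mathcal C_\Phi,\mathcal T_\Phi)$ which is induced by $\mathcal P$: it is built by the same steps, from functors $\alpha',\beta'$ which restrict to the functors induced by $\alpha,\beta$ along the canonical comparison functors $\mathrm{Inst}(\mathcal P)_\Phi\to\mathrm{Inst}(\mathcal P_\Phi)$. Its instantiation $\mathrm{Inst}(\mathcal P_\Phi)\to\mathcal C_\Phi$ is a Grothendieck fibration, and the comparison functor $\mathrm{Inst}(\mathcal P)_\Phi\to\mathrm{Inst}(\mathcal P_\Phi)$ is an isomorphism of categories over $\mathcal C_\Phi$. 3. With the induced functor $\mathcal S_\Phi\to\mathrm{Inst}(\mathcal P_\Phi)\times_{\mathcal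 C_\Phi}(\mathcal C_\Phi)^{\to}$, the data $(\mathcal C_\Phi,\mathcal T_\Phi,\mathcal S_\Phi,\mathcal P_\Phi,\mathrm{Inst}(\mathcal P_\Phi))$ form an FCoSwP over $\mathcal C_\Phi$. -/

import Mathlib

open CategoryTheory Limits

universe v u

namespace FilterQuotients

/-! ## Comprehension categories, parameter schemes and their instantiations -/

section Schemes

/-- The data of a comprehension category over `B`: a category `T` over `B` together with a functor
`T ⥤ B^→` over `B` (for the target projection `B^→ ⥤ B`).  Such a functor over `B` is the same
thing as a functor `ext : T ⥤ B`, `A ↦ Γ.A`, with a natural transformation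
`proj : Γ.A ⟶ Γ` to the projection of `T`. -/
structure CompData (B : Type (max u v)) [Category.{v} B] where
  T : BasedCategory.{v, max u v} B
  ext : T.obj ⥤ B
  proj : ext ⟶ T.p

variable {B : Type (max u v)} [Category.{v} B]

/-- `(B, T)` is a comprehension category: `T` is a Grothendieck fibration and `T ⥤ B^→` is
Cartesian, i.e. sends Cartesian arrows to pullback squares. -/
structure CompData.IsComprehensionCategory (T : CompData.{v, u} B) : Prop where
  fibered : T.T.p.IsFibered
  cartesian : ∀ ⦃a b : T.T.obj⦄ (φ : a ⟶ b), T.T.p.IsStronglyCartesian (T.T.p.map φ) φ →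
    IsPullback (T.ext.map φ) (T.proj.app a) (T.proj.app b) (T.T.p.map φ)

/-- The maps of the form `Γ.A ⟶ Γ` for a type `A` over `Γ`. -/
def CompData.projections (T : CompData.{v, u} B) : MorphismProperty B :=
  MorphismProperty.ofHoms (fun A : T.T.obj => T.proj.app A)

/-- Dependent projections: maps which are, up to isomorphism, of the form `Γ.A ⟶ Γ`. -/
def CompData.depProjections (T : CompData.{v, u} B) : MorphismProperty B :=
  T.projections.isoClosure

/-- Display maps: maps which are, up to isomorphism, finite (possibly empty) composites
`Γ.A₁.⋯.Aₙ ⟶ ⋯ ⟶ Γ` of dependent projections. -/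
def CompData.displayMaps (T : CompData.{v, u} B) : MorphismProperty B :=
  T.projections.multiplicativeClosure.isoClosure

/-- A functor over `B` from `I` to the category `D(T)` of display maps and pullback squares.
It is given by the functor `dom` of the domains of the display maps, and by the natural
transformation `π` consisting of these display maps; all its naturality squares are pullbacks. -/
structure DisplayFunctor (T : CompData.{v, u} B) (I : BasedCategory.{v, max u v} B) where
  dom : I.obj ⥤ B
  π : dom ⟶ I.p
  isDisplay : ∀ θ, T.displayMaps (π.app θ)
  equifibered : NatTrans.Equifibered π

/-- A functor from `I` to the category `D₁(T)` of dependent projections and pullback squares,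
whose codomain projection is the domain projection of `α : I ⥤ D(T)`. -/
structure DepProjFunctor {T : CompData.{v, u} B} {I : BasedCategory.{v, max u v} B}
    (α : DisplayFunctor T I) where
  dom : I.obj ⥤ B
  π : dom ⟶ α.dom
  isDepProjection : ∀ θ, T.depProjections (π.app θ)
  equifibered : NatTrans.Equifibered π

/-- The strict pullback of `T_≅ ⥤ B` (`T_≅` has the objects of `T` and the Cartesian arrows) along
`dom ∘ α : I ⥤ D(T) ⥤ B`: its objects are pairs `(θ, A)` with `A` a type over `dom (α θ)`. -/
structure TypeExt {T : CompData.{v, u} B} {I : BasedCategory.{v, max u v} B}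
    (α : DisplayFunctor T I) : Type (max u v) where
  inst : I.obj
  ty : T.T.obj
  eq : T.T.p.obj ty = α.dom.obj inst

/-- Morphisms of `TypeExt`: pairs of an arrow `u` of `I` and a Cartesian arrow of `T` lying over
`dom (α u)`. -/
@[ext]
structure TypeExt.Hom {T : CompData.{v, u} B} {I : BasedCategory.{v, max u v} B}
    {α : DisplayFunctor T I} (x y : TypeExt α) : Type v where
  inst : x.inst ⟶ y.inst
  ty : x.ty ⟶ y.ty
  cartesian : T.T.p.IsStronglyCartesian (α.dom.map inst) ty

instance {T : CompData.{v, u} B} {I : BasedCategory.{v, max u v} B}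
    (α : DisplayFunctor T I) : Category.{v} (TypeExt α) where
  Hom x y := TypeExt.Hom x y
  id x := ⟨𝟙 _, 𝟙 _, by
    have := IsHomLift.id x.eq
    rw [CategoryTheory.Functor.map_id]
    infer_instance⟩
  comp f g := ⟨f.inst ≫ g.inst, f.ty ≫ g.ty, by
    have := f.cartesian
    have := g.cartesian
    rw [CategoryTheory.Functor.map_comp]
    infer_instance⟩

/-- The projection `(θ, A) ↦ θ`. -/
def TypeExt.fst {T : CompData.{v, u} B} {I : BasedCategory.{v, max u v} B}
    (α : DisplayFunctor T I) : TypeExt α ⥤ I.obj where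
  obj x := x.inst
  map f := TypeExt.Hom.inst f

/-- The projection `(θ, A) ↦ A`. -/
def TypeExt.snd {T : CompData.{v, u} B} {I : BasedCategory.{v, max u v} B}
    (α : DisplayFunctor T I) : TypeExt α ⥤ T.T.obj where
  obj x := x.ty
  map f := TypeExt.Hom.ty f

/-- The strict pullback of `D_{1,*}(T) ⥤ D₁(T)` along `β : I ⥤ D₁(T)`, where `D_{1,*}(T)` is the
category of dependent projections with a section: its objects are pairs `(θ, s)` with `s` a section
of `β θ`. -/
structure TermExt {T : CompData.{v, u} B} {I : BasedCategory.{v, max u v} B}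
    {α : DisplayFunctor T I} (β : DepProjFunctor α) : Type (max u v) where
  inst : I.obj
  tm : α.dom.obj inst ⟶ β.dom.obj inst
  sec : tm ≫ β.π.app inst = 𝟙 _

/-- Morphisms of `TermExt`: arrows of `I` compatible with the chosen sections. -/
@[ext]
structure TermExt.Hom {T : CompData.{v, u} B} {I : BasedCategory.{v, max u v} B}
    {α : DisplayFunctor T I} {β : DepProjFunctor α} (x y : TermExt β) : Type v where
  inst : x.inst ⟶ y.inst
  comm : α.dom.map inst ≫ y.tm = x.tm ≫ β.dom.map inst

instance {T : CompData.{v, u} B} {I : BasedCategory.{v, max u v} B}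
    {α : DisplayFunctor T I} (β : DepProjFunctor α) : Category.{v} (TermExt β) where
  Hom x y := TermExt.Hom x y
  id x := ⟨𝟙 _, by simp⟩
  comp f g := ⟨f.inst ≫ g.inst, by
    rw [Functor.map_comp, Functor.map_comp, Category.assoc, g.comm, ← Category.assoc, f.comm,
      Category.assoc]⟩

/-- The projection `(θ, s) ↦ θ`. -/
def TermExt.fst {T : CompData.{v, u} B} {I : BasedCategory.{v, max u v} B}
    {α : DisplayFunctor T I} (β : DepProjFunctor α) : TermExt β ⥤ I.obj where
  obj x := x.inst
  map f := TermExt.Hom.inst f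

/-- The universal section, `(θ, s) ↦ s`. -/
def TermExt.section_ {T : CompData.{v, u} B} {I : BasedCategory.{v, max u v} B}
    {α : DisplayFunctor T I} (β : DepProjFunctor α) :
    TermExt.fst β ⋙ α.dom ⟶ TermExt.fst β ⋙ β.dom where
  app x := x.tm
  naturality _ _ f := TermExt.Hom.comm f

/-- Parameter schemes over `(B, T)`, defined together with their instantiations:
`ParamScheme T I` is the type of parameter schemes with instantiation `I ⥤ B`.
* The empty scheme has the instantiation `B`.
* A scheme `P` can be extended by a type parameter `α : Inst(P) ⥤ D(T)`; the instantiation of the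
  extension is the pullback of `T_≅ ⥤ B` along `dom ∘ α`.
* A scheme `P` can be extended by a term parameter `α : Inst(P) ⥤ D(T)`, `β : Inst(P) ⥤ D₁(T)`;
  the instantiation of the extension is the pullback of `D_{1,*}(T) ⥤ D₁(T)` along `β`. -/
inductive ParamScheme (T : CompData.{v, u} B) :
    BasedCategory.{v, max u v} B → Type (max (u + 1) (v + 1))
  | nil : ParamScheme T (BasedCategory.ofFunctor (𝟭 B))
  | type {I : BasedCategory.{v, max u v} B} (P : ParamScheme T I) (α : DisplayFunctor T I) :
      ParamScheme T (BasedCategory.ofFunctor (TypeExt.fst α ⋙ I.p))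
  | term {I : BasedCategory.{v, max u v} B} (P : ParamScheme T I) (α : DisplayFunctor T I)
      (β : DepProjFunctor α) : ParamScheme T (BasedCategory.ofFunctor (TermExt.fst β ⋙ I.p))

end Schemes

/-! ## Fibred categories of structures with parameters -/

section FCoSwP

/-- `F` is an isofibration: isomorphisms `F s ≅ b` lift, strictly, to isomorphisms out of `s`. -/
def IsIsofibration {X : Type*} {Y : Type*} [Category X] [Category Y] (F : X ⥤ Y) : Prop :=
  ∀ ⦃s : X⦄ ⦃b : Y⦄ (e : F.obj s ≅ b), ∃ (s' : X) (e' : s ≅ s'), F.IsHomLift e.hom e'.hom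

/-- `F` is amnestic: an isomorphism that is mapped to an identity is itself an identity. -/
def IsAmnestic {X : Type*} {Y : Type*} [Category X] [Category Y] (F : X ⥤ Y) : Prop :=
  ∀ ⦃s s' : X⦄ (e : s ≅ s'), F.IsHomLift (𝟙 (F.obj s)) e.hom → ∃ h : s = s', e.hom = eqToHom h

/-- The data of a fibred category of structures with parameters over `B`: a comprehension category
`T`, a parameter scheme `P` with its instantiation `I = Inst(P)`, and a category `S` over `B` with
a functor `U` to `Inst(P) ×_B B^→`.  An object of the latter is an object `θ` of `Inst(P)` over
some `Γ` with a map `X ⟶ Γ`, so that it is literally the comma category of the identity of `B` and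
of `Inst(P) ⥤ B`. -/
structure FCoSwPData (B : Type (max u v)) [Category.{v} B] where
  T : CompData.{v, u} B
  I : BasedCategory.{v, max u v} B
  P : ParamScheme T I
  S : BasedCategory.{v, max u v} B
  U : S.obj ⥤ Comma (𝟭 B) I.p

variable {B : Type (max u v)} [Category.{v} B]

/-- The data form a fibred category of structures with parameters: `T` is a comprehension category,
`S ⥤ B` is a Grothendieck fibration, and `S ⥤ Inst(P) ×_B B^→` is a functor over `B` which is
Cartesian (i.e. both components preserve Cartesian arrows; the Cartesian arrows of `B^→` are the
pullback squares), faithful, an isofibration and amnestic. -/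
structure FCoSwPData.IsFCoSwP (E : FCoSwPData.{v, u} B) : Prop where
  comprehension : E.T.IsComprehensionCategory
  fibered : E.S.p.IsFibered
  over_base : E.U ⋙ Comma.snd _ _ ⋙ E.I.p = E.S.p
  cartesian_inst : ∀ ⦃a b : E.S.obj⦄ (φ : a ⟶ b), E.S.p.IsStronglyCartesian (E.S.p.map φ) φ →
    E.I.p.IsStronglyCartesian (E.I.p.map (E.U.map φ).right) (E.U.map φ).right
  cartesian_arrow : ∀ ⦃a b : E.S.obj⦄ (φ : a ⟶ b), E.S.p.IsStronglyCartesian (E.S.p.map φ) φ →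
    IsPullback (E.U.map φ).left (E.U.obj a).hom (E.U.obj b).hom (E.I.p.map (E.U.map φ).right)
  faithful : E.U.Faithful
  isofibration : IsIsofibration E.U
  amnestic : IsAmnestic E.U

end FCoSwP

/-! ## The filter quotient of a category -/

section FilterQuotient

variable {C : Type u} [Category.{v} C] [HasFiniteProducts C]

/-- The filter quotient `C_Φ`: it has the objects of `C`, and the arrows `X ⟶ Y` are the classes of
partial maps `X × U ⟶ Y` with `U ∈ Φ`. -/
structure FilterQuotient (Φ : Order.PFilter (Subobject (⊤_ C))) : Type u where
  as : C

namespace FilterQuotient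

variable (Φ : Order.PFilter (Subobject (⊤_ C)))

/-- The map `X × V ⟶ X × U` for `V ≤ U`. -/
noncomputable def res (X : C) {V U : Subobject (⊤_ C)} (h : V ≤ U) :
    (X ⨯ (V : C)) ⟶ (X ⨯ (U : C)) :=
  prod.map (𝟙 X) (Subobject.ofLE V U h)

@[simp]
lemma res_fst (X : C) {V U : Subobject (⊤_ C)} (h : V ≤ U) :
    res X h ≫ prod.fst = prod.fst := by simp [res]

lemma hom_eq {U : Subobject (⊤_ C)} {Z : C} (f g : Z ⟶ (U : C)) : f = g := by
  rw [← cancel_mono U.arrow]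
  exact Subsingleton.elim _ _

lemma hom_ext {X Z : C} {U : Subobject (⊤_ C)} {f g : Z ⟶ X ⨯ (U : C)}
    (h : f ≫ prod.fst = g ≫ prod.fst) : f = g :=
  Limits.prod.hom_ext h (hom_eq _ _)

/-- Partial maps `X × U ⟶ Y` with `U ∈ Φ`, identified when they agree on `X × W` for some
`W ∈ Φ` below both domains. -/
def homSetoid (X Y : C) : Setoid (Σ U : {U : Subobject (⊤_ C) // U ∈ Φ}, (X ⨯ (U.1 : C) ⟶ Y)) where
  r f g := ∃ (W : Subobject (⊤_ C)) (_ : W ∈ Φ) (h₁ : W ≤ f.1.1) (h₂ : W ≤ g.1.1),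
    res X h₁ ≫ f.2 = res X h₂ ≫ g.2
  iseqv := by
    refine ⟨fun f => ⟨f.1.1, f.1.2, le_rfl, le_rfl, rfl⟩,
      fun ⟨W, hW, h₁, h₂, h⟩ => ⟨W, hW, h₂, h₁, h.symm⟩, ?_⟩
    rintro f g k ⟨W, hW, h₁, h₂, h⟩ ⟨W', hW', h₁', h₂', h'⟩
    obtain ⟨W'', hW'', a, b⟩ := Φ.directed W hW W' hW'
    change W'' ≤ W at a
    change W'' ≤ W' at b
    refine ⟨W'', hW'', a.trans h₁, b.trans h₂', ?_⟩
    have e₁ : res X (a.trans h₁) = res X a ≫ res X h₁ := hom_ext (by simp)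
    have e₂ : res X (b.trans h₂') = res X b ≫ res X h₂' := hom_ext (by simp)
    have e₃ : res X a ≫ res X h₂ = res X b ≫ res X h₁' := hom_ext (by simp)
    rw [e₁, e₂, Category.assoc, Category.assoc, h, ← h', ← Category.assoc, e₃, Category.assoc]

/-- The composite of `f : X × U ⟶ Y` and `g : Y × V ⟶ Z`, defined on `X × W` for some `W ∈ Φ`
below `U` and `V`. -/
noncomputable def compOn {X Y Z : C} {U V W : Subobject (⊤_ C)} (f : X ⨯ (U : C) ⟶ Y)
    (g : Y ⨯ (V : C) ⟶ Z) (h₁ : W ≤ U) (h₂ : W ≤ V) : X ⨯ (W : C) ⟶ Z :=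
  prod.lift (res X h₁ ≫ f) (prod.snd ≫ Subobject.ofLE W V h₂) ≫ g

lemma exists_le (U V : {U : Subobject (⊤_ C) // U ∈ Φ}) :
    ∃ W : {U : Subobject (⊤_ C) // U ∈ Φ}, W.1 ≤ U.1 ∧ W.1 ≤ V.1 := by
  obtain ⟨W, hW, a, b⟩ := Φ.directed U.1 U.2 V.1 V.2
  exact ⟨⟨W, hW⟩, a, b⟩

/-- A chosen element of the filter below two given ones. -/
noncomputable def meet (U V : {U : Subobject (⊤_ C) // U ∈ Φ}) : {U : Subobject (⊤_ C) // U ∈ Φ} :=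
  (exists_le Φ U V).choose

lemma meet_le_left (U V : {U : Subobject (⊤_ C) // U ∈ Φ}) : (meet Φ U V).1 ≤ U.1 :=
  (exists_le Φ U V).choose_spec.1

lemma meet_le_right (U V : {U : Subobject (⊤_ C) // U ∈ Φ}) : (meet Φ U V).1 ≤ V.1 :=
  (exists_le Φ U V).choose_spec.2

lemma res_compOn {X Y Z : C} {U V W W' : Subobject (⊤_ C)} (f : X ⨯ (U : C) ⟶ Y)
    (g : Y ⨯ (V : C) ⟶ Z) (h₁ : W ≤ U) (h₂ : W ≤ V) (h : W' ≤ W) :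
    res X h ≫ compOn f g h₁ h₂ = compOn f g (h.trans h₁) (h.trans h₂) := by
  unfold compOn
  rw [← Category.assoc]
  congr 1
  apply hom_ext
  simp only [Category.assoc, prod.lift_fst]
  rw [← Category.assoc]
  congr 1
  exact hom_ext (by simp)

lemma compOn_fst_left {X Z : C} {U V W : Subobject (⊤_ C)} (g : X ⨯ (V : C) ⟶ Z)
    (h₁ : W ≤ U) (h₂ : W ≤ V) :
    compOn (prod.fst : X ⨯ (U : C) ⟶ X) g h₁ h₂ = res X h₂ ≫ g := by
  unfold compOn
  congr 1
  exact hom_ext (by rw [prod.lift_fst, res_fst, res_fst])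

lemma compOn_fst_right {X Y Z : C} {U V W : Subobject (⊤_ C)} (f : X ⨯ (U : C) ⟶ Y) (g : Y ⟶ Z)
    (h₁ : W ≤ U) (h₂ : W ≤ V) :
    compOn f ((prod.fst : Y ⨯ (V : C) ⟶ Y) ≫ g) h₁ h₂ = res X h₁ ≫ f ≫ g := by
  unfold compOn
  rw [← Category.assoc, prod.lift_fst, Category.assoc]

lemma compOn_assoc {X Y Z T : C} {U V N W W₁ W₂ : Subobject (⊤_ C)} (f : X ⨯ (U : C) ⟶ Y)
    (g : Y ⨯ (V : C) ⟶ Z) (h : Z ⨯ (N : C) ⟶ T) (a : W₁ ≤ U) (b : W₁ ≤ V) (c : W ≤ W₁) (d : W ≤ N)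
    (a' : W₂ ≤ V) (b' : W₂ ≤ N) (c' : W ≤ U) (d' : W ≤ W₂) :
    compOn (compOn f g a b) h c d = compOn f (compOn g h a' b') c' d' := by
  unfold compOn
  rw [← Category.assoc _ _ h]
  congr 1
  apply hom_ext
  rw [prod.lift_fst, Category.assoc, prod.lift_fst, ← Category.assoc, ← Category.assoc]
  congr 1
  apply hom_ext
  rw [Category.assoc, Category.assoc, prod.lift_fst, res_fst, prod.lift_fst, ← Category.assoc]
  congr 1
  exact hom_ext (by rw [Category.assoc, res_fst, res_fst, res_fst])

lemma compOn_congr {X Y Z : C} {U U' V V' A B W : Subobject (⊤_ C)}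
    {f : X ⨯ (U : C) ⟶ Y} {f' : X ⨯ (U' : C) ⟶ Y}
    {g : Y ⨯ (V : C) ⟶ Z} {g' : Y ⨯ (V' : C) ⟶ Z}
    (a : A ≤ U) (a' : A ≤ U') (b : B ≤ V) (b' : B ≤ V')
    (hf : res X a ≫ f = res X a' ≫ f') (hg : res Y b ≫ g = res Y b' ≫ g')
    (c : W ≤ A) (d : W ≤ B) :
    compOn f g (c.trans a) (d.trans b) = compOn f' g' (c.trans a') (d.trans b') := by
  have key : ∀ {U V : Subobject (⊤_ C)} (f : X ⨯ (U : C) ⟶ Y) (g : Y ⨯ (V : C) ⟶ Z)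
      (a : A ≤ U) (b : B ≤ V), compOn f g (c.trans a) (d.trans b) =
        prod.lift (res X c ≫ res X a ≫ f) (prod.snd ≫ Subobject.ofLE W B d) ≫ res Y b ≫ g := by
    intro U V f g a b
    unfold compOn
    rw [← Category.assoc _ (res Y b) g]
    congr 1
    apply hom_ext
    simp only [prod.lift_fst, Category.assoc, res_fst]
    rw [← Category.assoc]
    congr 1
    exact hom_ext (by simp)
  rw [key f g a b, key f' g' a' b', hf, hg]

noncomputable instance : Category.{max u v} (FilterQuotient Φ) where
  Hom X Y := Quotient (homSetoid Φ X.as Y.as)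
  id X := Quotient.mk _ ⟨⟨⊤, Order.PFilter.top_mem⟩, prod.fst⟩
  comp {X Y Z} := Quotient.lift₂
    (fun f g => Quotient.mk (homSetoid Φ X.as Z.as)
      ⟨meet Φ f.1 g.1, compOn f.2 g.2 (meet_le_left Φ _ _) (meet_le_right Φ _ _)⟩) (by
    rintro ⟨U, f⟩ ⟨V, g⟩ ⟨U', f'⟩ ⟨V', g'⟩ ⟨A, hA, a, a', hf⟩ ⟨B, hB, b, b', hg⟩
    apply Quotient.sound
    let W₁ := meet Φ ⟨A, hA⟩ ⟨B, hB⟩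
    let W₂ := meet Φ (meet Φ U V) (meet Φ U' V')
    let W := meet Φ W₁ W₂
    have hWA : W.1 ≤ A := (meet_le_left Φ _ _).trans (meet_le_left Φ _ _)
    have hWB : W.1 ≤ B := (meet_le_left Φ _ _).trans (meet_le_right Φ _ _)
    refine ⟨W.1, W.2, (meet_le_right Φ _ _).trans (meet_le_left Φ _ _),
      (meet_le_right Φ _ _).trans (meet_le_right Φ _ _), ?_⟩
    dsimp only
    rw [res_compOn, res_compOn]
    exact compOn_congr a a' b b' hf hg hWA hWB)
  id_comp {X Y} f := by
    induction f using Quotient.inductionOn with | _ f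
    apply Quotient.sound
    refine ⟨_, (meet Φ _ _).2, le_rfl, meet_le_right Φ _ _, ?_⟩
    dsimp only
    rw [res_compOn]
    exact compOn_fst_left _ _ _
  comp_id {X Y} f := by
    induction f using Quotient.inductionOn with | _ f
    apply Quotient.sound
    refine ⟨_, (meet Φ _ _).2, le_rfl, meet_le_left Φ _ _, ?_⟩
    dsimp only
    rw [res_compOn]
    have := compOn_fst_right f.2 (𝟙 Y.as) (meet_le_left Φ f.1 ⟨⊤, Order.PFilter.top_mem⟩)
      (meet_le_right Φ f.1 ⟨⊤, Order.PFilter.top_mem⟩)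
    rw [Category.comp_id, Category.comp_id] at this
    exact this
  assoc {X Y Z T} f g h := by
    induction f using Quotient.inductionOn with | _ f
    induction g using Quotient.inductionOn with | _ g
    induction h using Quotient.inductionOn with | _ h
    apply Quotient.sound
    refine ⟨_, (meet Φ (meet Φ (meet Φ f.1 g.1) h.1) (meet Φ f.1 (meet Φ g.1 h.1))).2,
      meet_le_left Φ _ _, meet_le_right Φ _ _, ?_⟩
    dsimp only
    rw [res_compOn, res_compOn]
    exact compOn_assoc _ _ _ _ _ _ _ _ _ _ _

/-- The projection functor `P_Φ : C ⥤ C_Φ`. -/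
noncomputable def proj : C ⥤ FilterQuotient Φ where
  obj X := ⟨X⟩
  map f := Quotient.mk _ ⟨⟨⊤, Order.PFilter.top_mem⟩, prod.fst ≫ f⟩
  map_id X := by
    apply Quotient.sound
    exact ⟨⊤, Order.PFilter.top_mem, le_rfl, le_rfl, by simp⟩
  map_comp f g := by
    apply Quotient.sound
    refine ⟨_, (meet Φ _ _).2, meet_le_left Φ _ _, le_rfl, ?_⟩
    dsimp only
    rw [res_compOn]
    rw [compOn_fst_right, Category.assoc]

end FilterQuotient

end FilterQuotient

/-! ## The filtered colimit of the restrictions to the elements of a filter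

Let `p : F ⥤ C` be a Grothendieck fibration and `F_U` the full subcategory of `F` on the objects
whose image in `C` admits a map to `U`.  The restriction `F_U ⥤ F_V` for `V ≤ U` (pull back along
`X × V ⟶ X`) is functorial in `V ≤ U` only up to coherent isomorphism.  In order to form the
filtered colimit strictly, `F_U` is replaced by the equivalent category `Fam Φ p U` of its objects
together with all their restrictions to the elements `V ≤ U` of `Φ`.
-/

section FilteredColimit

lemma hasColimit_cat {J : Type u} [SmallCategory J] (D : J ⥤ Cat.{u, u}) : HasColimit D :=
  inferInstance

/-- `φ : y ⟶ x` exhibits `y` as a restriction of `x` to `W`: it is a Cartesian arrow over a product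
projection `X × W ⟶ X`. -/
def IsRestriction {F C : Type*} [Category F] [Category C] [HasTerminal C] (p : F ⥤ C)
    (W : Subobject (⊤_ C)) {y x : F} (φ : y ⟶ x) : Prop :=
  p.IsStronglyCartesian (p.map φ) φ ∧
    ∃ q : p.obj y ⟶ (W : C), Nonempty (IsLimit (BinaryFan.mk (p.map φ) q))

variable {C : Type (max u v)} [Category.{v} C] [HasFiniteProducts C]
variable (Φ : Order.PFilter (Subobject (⊤_ C)))

/-- The elements of the filter, with the order of subobjects of the terminal object. -/
abbrev Idx : Type (max u v) := {U : Subobject (⊤_ C) // U ∈ Φ}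

/-- A family of objects of `F` indexed by the elements of `Φ` below `U`, all of whose transition
maps exhibit restrictions. -/
def IsFam {F : Type (max u v)} [Category.{v} F] (p : F ⥤ C) (U : Idx Φ) :
    ObjectProperty (Set.Iic U ⥤ F) :=
  fun x => ∀ ⦃W V : Set.Iic U⦄ (h : W ⟶ V), IsRestriction p W.1.1 (x.map h)

/-- The category of objects of `F_U` together with their restrictions to all `V ≤ U` in `Φ`. -/
abbrev Fam {F : Type (max u v)} [Category.{v} F] (p : F ⥤ C) (U : Idx Φ) : Type (max u v) :=
  (IsFam Φ p U).FullSubcategory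

/-- The inclusion of `{W ∈ Φ | W ≤ V}` in `{W ∈ Φ | W ≤ U}`. -/
noncomputable def incl {U V : Idx Φ} (h : V ≤ U) : Set.Iic V ⥤ Set.Iic U :=
  Monotone.functor (f := fun W => ⟨W.1, W.2.trans h⟩) (fun _ _ k => k)

/-- The restriction functor `Fam Φ p U ⥤ Fam Φ p V` for `V ≤ U`. -/
noncomputable def famRestrict {F : Type (max u v)} [Category.{v} F] (p : F ⥤ C) {U V : Idx Φ} (h : V ≤ U) :
    Fam Φ p U ⥤ Fam Φ p V :=
  ObjectProperty.lift _ ((IsFam Φ p U).ι ⋙ (Functor.whiskeringLeft _ _ _).obj (incl Φ h))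
    (fun x _ _ k => x.property ((incl Φ h).map k))

/-- The diagram `Φᵒᵖ ⥤ Cat`, `U ↦ Fam Φ p U`. -/
noncomputable def famDiagram {F : Type (max u v)} [Category.{v} F] (p : F ⥤ C) :
    (Idx Φ)ᵒᵖ ⥤ Cat.{max u v, max u v} where
  obj U := Cat.of (Fam Φ p U.unop)
  map h := (famRestrict Φ p h.unop.le).toCatHom
  map_id _ := rfl
  map_comp _ _ := rfl

instance {F : Type (max u v)} [Category.{v} F] (p : F ⥤ C) : HasColimit (famDiagram.{v, u} Φ p) :=
  hasColimit_cat.{max u v} _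

/-- `F_Φ`, the filtered colimit of the categories `F_U`, `U ∈ Φ`. -/
noncomputable def FCat {F : Type (max u v)} [Category.{v} F] (p : F ⥤ C) : Type (max u v) :=
  (colimit (famDiagram Φ p) : Cat.{max u v, max u v})

noncomputable instance {F : Type (max u v)} [Category.{v} F] (p : F ⥤ C) :
    Category.{max u v} (FCat Φ p) :=
  inferInstanceAs (Category.{max u v} (colimit (famDiagram Φ p) : Cat.{max u v, max u v}))

/-- `C_Φ`, as the filtered colimit of the categories `C_U`. -/
abbrev BaseCat : Type (max u v) := FCat Φ (𝟭 C)

/-! ### Functoriality of the filtered colimit -/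

/-- `G` maps restrictions to restrictions. -/
def PreservesRestrictions {F F' : Type (max u v)} [Category.{v} F] [Category.{v} F'] (p : F ⥤ C)
    (p' : F' ⥤ C) (G : F ⥤ F') : Prop :=
  ∀ (W : Subobject (⊤_ C)) ⦃y x : F⦄ (φ : y ⟶ x), IsRestriction p W φ →
    IsRestriction p' W (G.map φ)

section

variable {F F' : Type (max u v)} [Category.{v} F] [Category.{v} F'] {p : F ⥤ C} {p' : F' ⥤ C}

/-- The legs `F_U ⥤ F_Φ` of the filtered colimit. -/
noncomputable def FCat.ι (p : F ⥤ C) (U : Idx Φ) : Fam Φ p U ⥤ FCat Φ p :=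
  (colimit.ι (famDiagram.{v, u} Φ p) (Opposite.op U)).toFunctor

lemma FCat.restrict_ι (p : F ⥤ C) {U V : Idx Φ} (h : V ≤ U) :
    famRestrict Φ p h ⋙ FCat.ι Φ p V = FCat.ι Φ p U :=
  congrArg Cat.Hom.toFunctor (colimit.w (famDiagram.{v, u} Φ p) (homOfLE h).op)

/-- The functor out of `F_Φ` given by compatible functors out of the `F_U`. -/
noncomputable def FCat.desc {E : Type (max u v)} [Category.{max u v} E]
    (H : ∀ U : Idx Φ, Fam Φ p U ⥤ E)
    (hH : ∀ (U V : Idx Φ) (h : V ≤ U), famRestrict Φ p h ⋙ H V = H U) : FCat Φ p ⥤ E :=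
  (colimit.desc (famDiagram.{v, u} Φ p)
    { pt := Cat.of E
      ι := { app := fun U => (H U.unop).toCatHom
             naturality := fun U V h => Cat.ext (hH U.unop V.unop h.unop.le) } }).toFunctor

lemma FCat.ι_desc {E : Type (max u v)} [Category.{max u v} E]
    (H : ∀ U : Idx Φ, Fam Φ p U ⥤ E)
    (hH : ∀ (U V : Idx Φ) (h : V ≤ U), famRestrict Φ p h ⋙ H V = H U) (U : Idx Φ) :
    FCat.ι Φ p U ⋙ FCat.desc Φ H hH = H U :=
  congrArg Cat.Hom.toFunctor (colimit.ι_desc (F := famDiagram.{v, u} Φ p) _ (Opposite.op U))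

lemma FCat.functor_ext {E : Type (max u v)} [Category.{max u v} E] {G G' : FCat Φ p ⥤ E}
    (h : ∀ U, FCat.ι Φ p U ⋙ G = FCat.ι Φ p U ⋙ G') : G = G' :=
  congrArg Cat.Hom.toFunctor (colimit.hom_ext (F := famDiagram.{v, u} Φ p)
    (f := Functor.toCatHom G) (f' := Functor.toCatHom G') fun U => Cat.ext (h U.unop))

/-- The functor `F_U ⥤ F'_U` induced by `G : F ⥤ F'`. -/
noncomputable def famMap {G : F ⥤ F'} (hG : PreservesRestrictions p p' G) (U : Idx Φ) :
    Fam Φ p U ⥤ Fam Φ p' U :=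
  ObjectProperty.lift _ ((IsFam Φ p U).ι ⋙ (Functor.whiskeringRight _ _ _).obj G)
    (fun x _ _ k => hG _ _ (x.property k))

/-- The functor `G_Φ : F_Φ ⥤ F'_Φ` induced by `G : F ⥤ F'`. -/
noncomputable def FCat.map {G : F ⥤ F'} (hG : PreservesRestrictions p p' G) :
    FCat Φ p ⥤ FCat Φ p' :=
  FCat.desc Φ (fun U => famMap Φ hG U ⋙ FCat.ι Φ p' U)
    (fun _ _ h => congrArg (famMap Φ hG _ ⋙ ·) (FCat.restrict_ι Φ p' h))

lemma FCat.ι_map {G : F ⥤ F'} (hG : PreservesRestrictions p p' G) (U : Idx Φ) :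
    FCat.ι Φ p U ⋙ FCat.map Φ hG = famMap Φ hG U ⋙ FCat.ι Φ p' U :=
  FCat.ι_desc Φ _ _ U

/-- The natural transformation between functors `F_U ⥤ F'_U` induced by one between functors
`F ⥤ F'`. -/
noncomputable def famNat {G H : F ⥤ F'} (hG : PreservesRestrictions p p' G)
    (hH : PreservesRestrictions p p' H) (τ : G ⟶ H) (U : Idx Φ) : famMap Φ hG U ⟶ famMap Φ hH U where
  app x := ObjectProperty.homMk (Functor.whiskerLeft x.obj τ)
  naturality x y f := by
    ext
    exact τ.naturality _

/-- A natural transformation, as a functor to the arrow category. -/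
def arrowFunctor {X Y : Type*} [Category X] [Category Y] {G H : X ⥤ Y} (τ : G ⟶ H) :
    X ⥤ Arrow Y where
  obj x := Arrow.mk (τ.app x)
  map f := Arrow.homMk (G.map f) (H.map f) (by simp)

lemma arrow_mk_eqToHom {X : Type*} [Category X] (a : Arrow X) {Y Z : X} (h : Y = a.left)
    (k : a.right = Z) : Arrow.mk (eqToHom h ≫ a.hom ≫ eqToHom k) = a := by
  subst h k
  simp

/-- A natural transformation `τ : G ⟶ H` induces a functor from `F_Φ` to the arrows of `F'_Φ`. -/
noncomputable def FCat.natArrow {G H : F ⥤ F'} (hG : PreservesRestrictions p p' G)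
    (hH : PreservesRestrictions p p' H) (τ : G ⟶ H) : FCat Φ p ⥤ Arrow (FCat Φ p') :=
  FCat.desc Φ (fun U => arrowFunctor (famNat Φ hG hH τ U) ⋙ (FCat.ι Φ p' U).mapArrow)
    (fun _ _ h => congrArg (fun K => arrowFunctor (famNat Φ hG hH τ _) ⋙ Functor.mapArrow K)
      (FCat.restrict_ι Φ p' h))

lemma FCat.ι_natArrow {G H : F ⥤ F'} (hG : PreservesRestrictions p p' G)
    (hH : PreservesRestrictions p p' H) (τ : G ⟶ H) (U : Idx Φ) :
    FCat.ι Φ p U ⋙ FCat.natArrow Φ hG hH τ =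
      arrowFunctor (famNat Φ hG hH τ U) ⋙ (FCat.ι Φ p' U).mapArrow :=
  FCat.ι_desc Φ _ _ U

lemma FCat.natArrow_left {G H : F ⥤ F'} (hG : PreservesRestrictions p p' G)
    (hH : PreservesRestrictions p p' H) (τ : G ⟶ H) :
    FCat.natArrow Φ hG hH τ ⋙ Arrow.leftFunc = FCat.map Φ hG :=
  FCat.functor_ext Φ fun U => by
    rw [← Functor.assoc, FCat.ι_natArrow, FCat.ι_map]
    rfl

lemma FCat.natArrow_right {G H : F ⥤ F'} (hG : PreservesRestrictions p p' G)
    (hH : PreservesRestrictions p p' H) (τ : G ⟶ H) :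
    FCat.natArrow Φ hG hH τ ⋙ Arrow.rightFunc = FCat.map Φ hH :=
  FCat.functor_ext Φ fun U => by
    rw [← Functor.assoc, FCat.ι_natArrow, FCat.ι_map]
    rfl

/-- The natural transformation `G_Φ ⟶ H_Φ` induced by `τ : G ⟶ H`: at the class of a family `x`
it is the class of the family of arrows `τ_x`. -/
noncomputable def FCat.natTrans {G H : F ⥤ F'} (hG : PreservesRestrictions p p' G)
    (hH : PreservesRestrictions p p' H) (τ : G ⟶ H) : FCat.map Φ hG ⟶ FCat.map Φ hH :=
  eqToHom (FCat.natArrow_left Φ hG hH τ).symm ≫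
    Functor.whiskerLeft (FCat.natArrow Φ hG hH τ) Arrow.leftToRight ≫
      eqToHom (FCat.natArrow_right Φ hG hH τ)

lemma FCat.natTrans_ι {G H : F ⥤ F'} (hG : PreservesRestrictions p p' G)
    (hH : PreservesRestrictions p p' H) (τ : G ⟶ H) (U : Idx Φ) (x : Fam Φ p U) :
    Arrow.mk ((FCat.natTrans Φ hG hH τ).app ((FCat.ι Φ p U).obj x)) =
      Arrow.mk ((FCat.ι Φ p' U).map ((famNat Φ hG hH τ U).app x)) := by
  have h : (FCat.natArrow Φ hG hH τ).obj ((FCat.ι Φ p U).obj x) =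
      Arrow.mk ((FCat.ι Φ p' U).map ((famNat Φ hG hH τ U).app x)) :=
    congrArg (fun K => K.obj x) (FCat.ι_natArrow Φ hG hH τ U)
  rw [← h]
  simp only [FCat.natTrans, NatTrans.comp_app, eqToHom_app, Functor.whiskerLeft_app,
    Arrow.leftToRight_app]
  exact arrow_mk_eqToHom _ _ _

end

/-! ### Functors which preserve restrictions -/

section

variable {F : Type (max u v)} [Category.{v} F] {p : F ⥤ C}

lemma isStronglyCartesian_id {B : Type*} [Category B] {X Y : B} (f : X ⟶ Y) :
    (𝟭 B).IsStronglyCartesian ((𝟭 B).map f) f where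
  universal_property' {a'} g φ' h := by
    have e : g ≫ f = φ' := by
      have := IsHomLift.fac' (𝟭 B) (g ≫ (𝟭 B).map f) φ'
      simpa using this.symm
    refine ⟨g, ⟨?_, e⟩, fun y hy => ?_⟩
    · exact IsHomLift.map (p := 𝟭 B) g
    · have := hy.1
      have := IsHomLift.fac' (𝟭 B) g y
      simpa using this

/-- The projection to the base preserves restrictions. -/
lemma preservesRestrictions_base (p : F ⥤ C) : PreservesRestrictions p (𝟭 C) p :=
  fun _ _ _ φ h => ⟨isStronglyCartesian_id (p.map φ), h.2⟩

/-- A functor with a natural transformation to the projection, which is Cartesian as a functor to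
`C^→`, preserves restrictions. -/
lemma preservesRestrictions_of_isPullback {G : F ⥤ C} (π : G ⟶ p)
    (h : ∀ ⦃a b : F⦄ (φ : a ⟶ b), p.IsStronglyCartesian (p.map φ) φ →
      IsPullback (G.map φ) (π.app a) (π.app b) (p.map φ)) :
    PreservesRestrictions p (𝟭 C) G := by
  rintro W y x φ ⟨hφ, q, ⟨hq⟩⟩
  have hp := h φ hφ
  refine ⟨isStronglyCartesian_id (G.map φ), π.app y ≫ q, ⟨?_⟩⟩
  have key : ∀ {Z : C} (f : Z ⟶ G.obj x) (g : Z ⟶ (W : C)),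
      ∃ l : Z ⟶ G.obj y, l ≫ G.map φ = f := fun f g => by
    obtain ⟨l, hl, -⟩ := BinaryFan.IsLimit.lift' hq (f ≫ π.app x) g
    exact ⟨hp.lift f l hl.symm, hp.lift_fst _ _ _⟩
  refine BinaryFan.isLimitMk (fun s => (key s.fst s.snd).choose)
    (fun s => (key s.fst s.snd).choose_spec) (fun s => FilterQuotient.hom_eq _ _)
    (fun s m h₁ _ => ?_)
  refine hp.hom_ext (h₁.trans (key s.fst s.snd).choose_spec.symm) ?_
  refine BinaryFan.IsLimit.hom_ext hq ?_ (FilterQuotient.hom_eq _ _)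
  change (_ ≫ π.app y) ≫ p.map φ = (_ ≫ π.app y) ≫ p.map φ
  rw [Category.assoc, Category.assoc, ← hp.w, ← Category.assoc, ← Category.assoc]
  exact congrArg (· ≫ π.app x) (h₁.trans (key s.fst s.snd).choose_spec.symm)

/-- A functor over the base which preserves Cartesian arrows preserves restrictions. -/
lemma preservesRestrictions_of_over {F' : Type (max u v)} [Category.{v} F'] {p' : F' ⥤ C}
    {G : F ⥤ F'} (w : G ⋙ p' = p)
    (h : ∀ ⦃a b : F⦄ (φ : a ⟶ b), p.IsStronglyCartesian (p.map φ) φ →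
      p'.IsStronglyCartesian (p'.map (G.map φ)) (G.map φ)) :
    PreservesRestrictions p p' G := by
  subst w
  exact fun W y x φ hφ => ⟨h φ hφ.1, hφ.2⟩

end

lemma PreservesRestrictions.comp {F F' F'' : Type (max u v)} [Category.{v} F] [Category.{v} F']
    [Category.{v} F''] {p : F ⥤ C} {p' : F' ⥤ C} {p'' : F'' ⥤ C} {G : F ⥤ F'} {H : F' ⥤ F''}
    (hG : PreservesRestrictions p p' G) (hH : PreservesRestrictions p' p'' H) :
    PreservesRestrictions p p'' (G ⋙ H) :=
  fun W _ _ φ h => hH W (G.map φ) (hG W φ h)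

lemma FCat.map_comp {F F' F'' : Type (max u v)} [Category.{v} F] [Category.{v} F']
    [Category.{v} F''] {p : F ⥤ C} {p' : F' ⥤ C} {p'' : F'' ⥤ C} {G : F ⥤ F'} {H : F' ⥤ F''}
    (hG : PreservesRestrictions p p' G) (hH : PreservesRestrictions p' p'' H) :
    FCat.map Φ (hG.comp hH) = FCat.map Φ hG ⋙ FCat.map Φ hH :=
  FCat.functor_ext Φ fun U => by
    rw [FCat.ι_map, ← Functor.assoc, FCat.ι_map, Functor.assoc, FCat.ι_map]
    rfl

/-- The projection `F_Φ ⥤ C_Φ`. -/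
noncomputable def FCat.base {F : Type (max u v)} [Category.{v} F] (p : F ⥤ C) :
    FCat Φ p ⥤ BaseCat Φ :=
  FCat.map Φ (preservesRestrictions_base p)

end FilteredColimit

/-! ## The filter quotient of a fibred category of structures with parameters -/

section

variable {B : Type (max u v)} [Category.{v} B]

lemma isStronglyCartesian_of {F X : Type*} [Category F] [Category X] {p : F ⥤ X} {a b : F}
    {φ : a ⟶ b} (h : ∀ {z : F} (g : p.obj z ⟶ p.obj a) (k : z ⟶ b), p.map k = g ≫ p.map φ →
      ∃! l : z ⟶ a, p.map l = g ∧ l ≫ φ = k) : p.IsStronglyCartesian (p.map φ) φ where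
  universal_property' {z} g k hk := by
    obtain ⟨l, ⟨h₁, h₂⟩, h₃⟩ := h g k (IsHomLift.eq_of_isHomLift p _ k).symm
    refine ⟨l, ⟨?_, h₂⟩, fun m hm => h₃ m ⟨?_, hm.2⟩⟩
    · subst h₁
      infer_instance
    · have := hm.1
      exact (IsHomLift.eq_of_isHomLift p g m).symm

lemma exists_lift {F X : Type*} [Category F] [Category X] {p : F ⥤ X} {a b : F}
    {φ : a ⟶ b} (h : p.IsStronglyCartesian (p.map φ) φ) {z : F} (g : p.obj z ⟶ p.obj a)
    (k : z ⟶ b) (w : p.map k = g ≫ p.map φ) : ∃! l : z ⟶ a, p.map l = g ∧ l ≫ φ = k := by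
  have : p.IsHomLift (g ≫ p.map φ) k := w ▸ inferInstance
  obtain ⟨l, ⟨h₁, h₂⟩, h₃⟩ := h.universal_property' g k
  refine ⟨l, ⟨(IsHomLift.eq_of_isHomLift p g l).symm, h₂⟩, fun m hm => h₃ m ⟨?_, hm.2⟩⟩
  rw [← hm.1]
  infer_instance

lemma TypeExt.isStronglyCartesian {T : CompData.{v, u} B} {I : BasedCategory.{v, max u v} B}
    (α : DisplayFunctor T I)
    (ih : ∀ {a b : I.obj} (φ : a ⟶ b), I.p.IsStronglyCartesian (I.p.map φ) φ)
    {a b : TypeExt α} (φ : TypeExt.Hom a b) :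
    (TypeExt.fst α ⋙ I.p).IsStronglyCartesian (a := a) (b := b)
      ((TypeExt.fst α ⋙ I.p).map (X := a) (Y := b) φ) φ := by
  refine isStronglyCartesian_of fun {z} g (k : TypeExt.Hom z b) w => ?_
  obtain ⟨l, ⟨h₁, h₂⟩, h₃⟩ := exists_lift (ih φ.inst) (z := z.inst) g k.inst w
  have hφ := φ.cartesian
  have hk := k.cartesian
  have e : α.dom.map k.inst = α.dom.map l ≫ α.dom.map φ.inst := by
    rw [← Functor.map_comp, h₂]
  obtain ⟨m, ⟨hm₁, hm₂⟩, hm₃⟩ := Functor.IsStronglyCartesian.universal_property T.T.p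
    (α.dom.map φ.inst) φ.ty (α.dom.map l) _ e k.ty
  have hm : T.T.p.IsStronglyCartesian (α.dom.map l) m := by
    have : T.T.p.IsStronglyCartesian (α.dom.map l ≫ α.dom.map φ.inst) (m ≫ φ.ty) := by
      rw [hm₂, ← e]
      exact hk
    exact Functor.IsStronglyCartesian.of_comp T.T.p (g := α.dom.map φ.inst) (ψ := φ.ty)
  refine ⟨(⟨l, m, hm⟩ : TypeExt.Hom z a), ⟨h₁, TypeExt.Hom.ext h₂ hm₂⟩, fun n hn => ?_⟩
  have e₁ : TypeExt.Hom.inst n = l := h₃ _ ⟨hn.1, congrArg TypeExt.Hom.inst hn.2⟩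
  refine TypeExt.Hom.ext e₁ (hm₃ _ ⟨?_, congrArg TypeExt.Hom.ty hn.2⟩)
  have := (TypeExt.Hom.cartesian n).toIsHomLift
  rw [e₁] at this
  exact this

lemma TermExt.isStronglyCartesian {T : CompData.{v, u} B} {I : BasedCategory.{v, max u v} B}
    {α : DisplayFunctor T I} (β : DepProjFunctor α)
    (ih : ∀ {a b : I.obj} (φ : a ⟶ b), I.p.IsStronglyCartesian (I.p.map φ) φ)
    {a b : TermExt β} (φ : TermExt.Hom a b) :
    (TermExt.fst β ⋙ I.p).IsStronglyCartesian (a := a) (b := b)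
      ((TermExt.fst β ⋙ I.p).map (X := a) (Y := b) φ) φ := by
  refine isStronglyCartesian_of fun {z} g (k : TermExt.Hom z b) w => ?_
  obtain ⟨l, ⟨h₁, h₂⟩, h₃⟩ := exists_lift (ih φ.inst) (z := z.inst) g k.inst w
  have hl : α.dom.map l ≫ a.tm = z.tm ≫ β.dom.map l := by
    refine (β.equifibered φ.inst).hom_ext ?_ ?_
    · rw [Category.assoc, Category.assoc, ← φ.comm, ← Functor.map_comp, h₂, ← k.comm,
        ← Category.assoc, ← Functor.map_comp, h₂]
    · rw [Category.assoc, Category.assoc, a.sec, β.π.naturality, ← Category.assoc, z.sec,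
        Category.comp_id, Category.id_comp]
  exact ⟨(⟨l, hl⟩ : TermExt.Hom z a), ⟨h₁, TermExt.Hom.ext h₂⟩, fun n hn =>
    TermExt.Hom.ext (h₃ _ ⟨hn.1, congrArg TermExt.Hom.inst hn.2⟩)⟩

/-- All arrows of the instantiation of a parameter scheme are Cartesian. -/
lemma ParamScheme.isStronglyCartesian {T : CompData.{v, u} B} {I : BasedCategory.{v, max u v} B}
    (P : ParamScheme T I) {a b : I.obj} (φ : a ⟶ b) :
    I.p.IsStronglyCartesian (I.p.map φ) φ := by
  induction P with
  | nil => exact isStronglyCartesian_of fun g k w => ⟨g, ⟨rfl, w.symm⟩, fun m hm => hm.1⟩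
  | type P α ih => exact TypeExt.isStronglyCartesian α ih φ
  | term P α β ih => exact TermExt.isStronglyCartesian β ih φ

end

/-- The functor to the strict pullback of `q : A ⥤ B` and of the target projection of `B^→`. -/
def commaLift {X A B : Type*} [Category X] [Category A] [Category B] (G : X ⥤ B) (H : X ⥤ A)
    (q : A ⥤ B) (τ : G ⟶ H ⋙ q) : X ⥤ Comma (𝟭 B) q where
  obj x := { left := G.obj x, right := H.obj x, hom := τ.app x }
  map f := { left := G.map f, right := H.map f, w := τ.naturality f }

section Quotient

variable {C : Type (max u v)} [Category.{v} C] [HasFiniteProducts C]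
variable (Φ : Order.PFilter (Subobject (⊤_ C)))

/-! ### `Fam Φ p U` is equivalent to `F_U` -/

section

variable {F : Type (max u v)} [Category.{v} F]

/-- `F_U = C_U ×_C F`: the full subcategory of the objects of `F` whose image in `C` admits a map
to `U`. -/
abbrev Slice (p : F ⥤ C) (U : Subobject (⊤_ C)) : Type (max u v) :=
  ObjectProperty.FullSubcategory (fun x : F => Nonempty (p.obj x ⟶ (U : C)))

/-- `U` as an element of `{V ∈ Φ | V ≤ U}`. -/
def Idx.self (U : Idx Φ) : Set.Iic U := ⟨U, le_refl U⟩

/-- The functor `Fam Φ p U ⥤ F_U`, `x ↦ x_U`. -/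
noncomputable def famEval (p : F ⥤ C) (U : Idx Φ) : Fam Φ p U ⥤ Slice p U.1 :=
  ObjectProperty.lift _ ((IsFam Φ p U).ι ⋙ (evaluation _ _).obj (Idx.self Φ U))
    (fun x => ⟨(x.property (𝟙 (Idx.self Φ U))).2.choose⟩)

lemma IsRestriction.existsUnique {p : F ⥤ C} {W : Subobject (⊤_ C)} {y x : F} {r : y ⟶ x}
    (h : IsRestriction p W r) {z : F} (t : p.obj z ⟶ (W : C)) (k : z ⟶ x) :
    ∃! l : z ⟶ y, l ≫ r = k := by
  obtain ⟨h₁, q, ⟨hq⟩⟩ := h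
  obtain ⟨g, hg, -⟩ := BinaryFan.IsLimit.lift' hq (p.map k) t
  obtain ⟨l, ⟨hl₁, hl₂⟩, hl₃⟩ := exists_lift h₁ g k hg.symm
  refine ⟨l, hl₂, fun m hm => hl₃ m ⟨?_, hm⟩⟩
  refine BinaryFan.IsLimit.hom_ext hq ?_ (FilterQuotient.hom_eq _ _)
  change p.map m ≫ p.map r = g ≫ p.map r
  rw [← p.map_comp, hm]
  exact hg.symm

lemma IsRestriction.of_comp {p : F ⥤ C} {V W : Subobject (⊤_ C)} {z y x : F} {s : z ⟶ y}
    {r : y ⟶ x} (hr : IsRestriction p V r) (hs : IsRestriction p W (s ≫ r)) :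
    IsRestriction p W s := by
  obtain ⟨h₁, q, ⟨hq⟩⟩ := hr
  obtain ⟨h₂, q', ⟨hq'⟩⟩ := hs
  have h₃ : p.IsStronglyCartesian (p.map s ≫ p.map r) (s ≫ r) := by
    rw [← p.map_comp]
    exact h₂
  refine ⟨Functor.IsStronglyCartesian.of_comp p (g := p.map r) (ψ := r), q', ⟨?_⟩⟩
  have mono : ∀ {Z : C} (f g : Z ⟶ p.obj y), f ≫ p.map r = g ≫ p.map r → f = g := fun f g e =>
    BinaryFan.IsLimit.hom_ext hq e (FilterQuotient.hom_eq _ _)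
  have key : ∀ {Z : C} (f : Z ⟶ p.obj y) (g : Z ⟶ (W : C)),
      ∃ l : Z ⟶ p.obj z, l ≫ p.map s = f := fun f g => by
    obtain ⟨l, hl, -⟩ := BinaryFan.IsLimit.lift' hq' (f ≫ p.map r) g
    refine ⟨l, mono _ _ ?_⟩
    rw [Category.assoc, ← p.map_comp]
    exact hl
  refine BinaryFan.isLimitMk (fun c => (key c.fst c.snd).choose)
    (fun c => (key c.fst c.snd).choose_spec) (fun c => FilterQuotient.hom_eq _ _)
    (fun c m e _ => ?_)
  refine BinaryFan.IsLimit.hom_ext hq' ?_ (FilterQuotient.hom_eq _ _)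
  change m ≫ p.map (s ≫ r) = _ ≫ p.map (s ≫ r)
  rw [p.map_comp, ← Category.assoc, ← Category.assoc]
  exact congrArg (· ≫ p.map r) (e.trans (key c.fst c.snd).choose_spec.symm)

lemma exists_restriction (p : F ⥤ C) [p.IsFibered] (x : F) (W : Subobject (⊤_ C)) :
    ∃ (y : F) (r : y ⟶ x), IsRestriction p W r := by
  obtain ⟨y, r, hr⟩ := IsPreFibered.exists_isCartesian p (a := x) rfl
    (prod.fst : p.obj x ⨯ (W : C) ⟶ p.obj x)
  have key : ∀ {R S : C} (f : R ⟶ S) (q : R ⟶ (W : C)) (_ : IsLimit (BinaryFan.mk f q))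
      {a b : F} (ψ : a ⟶ b), p.IsStronglyCartesian f ψ → IsRestriction p W ψ := by
    intro R S f q hq a b ψ hψ
    have := hψ.toIsHomLift
    subst_hom_lift p f ψ
    exact ⟨hψ, q, ⟨hq⟩⟩
  exact ⟨y, r, key _ prod.snd (prodIsProd (p.obj x) (W : C)) r inferInstance⟩

/-- For a Grothendieck fibration, evaluation is an equivalence from `Fam Φ p U` to `F_U`. -/
lemma famEval_isEquivalence (p : F ⥤ C) [p.IsFibered] (U : Idx Φ) :
    (famEval Φ p U).IsEquivalence where
  faithful := ⟨fun {x y f g} e => by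
    have e₀ : f.hom.app (Idx.self Φ U) = g.hom.app (Idx.self Φ U) := congrArg (fun k => k.hom) e
    ext V
    have hV := y.property (homOfLE (show V ≤ (Idx.self Φ U) from V.2))
    refine (hV.existsUnique (x.property (𝟙 V)).2.choose _).unique rfl ?_
    rw [← NatTrans.naturality, ← NatTrans.naturality, e₀]⟩
  full := ⟨fun {x y} f => by
    have hy := fun V : Set.Iic U => y.property (homOfLE (show V ≤ (Idx.self Φ U) from V.2))
    have hl := fun V : Set.Iic U => (hy V).existsUnique (x.property (𝟙 V)).2.choose
      (x.obj.map (homOfLE (show V ≤ (Idx.self Φ U) from V.2)) ≫ f.hom)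
    refine ⟨ObjectProperty.homMk
      { app := fun V => (hl V).choose
        naturality := fun W V h => ?_ }, ?_⟩
    · refine ((hy V).existsUnique ((x.property (𝟙 W)).2.choose ≫
        Subobject.ofLE W.1.1 V.1.1 h.le) _).unique rfl ?_
      rw [Category.assoc, Category.assoc, (hl V).choose_spec.1, ← Functor.map_comp]
      refine ((hl W).choose_spec.1).trans ?_
      refine Eq.trans ?_ (Category.assoc _ _ _)
      exact congrArg (· ≫ f.hom) (x.obj.map_comp h (homOfLE (show V ≤ Idx.self Φ U from V.2)))
    · ext
      have h := (hl (Idx.self Φ U)).choose_spec.1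
      have e : (homOfLE (show ((Idx.self Φ U) : Set.Iic U) ≤ (Idx.self Φ U) from le_rfl)) = 𝟙 _ := rfl
      refine Eq.trans ?_ (h.trans ?_)
      · exact (Category.comp_id _).symm.trans
          (congrArg ((hl (Idx.self Φ U)).choose ≫ ·) (y.obj.map_id _).symm)
      · exact (congrArg (· ≫ f.hom) (x.obj.map_id _)).trans (Category.id_comp _)⟩
  essSurj := ⟨fun x => by
    choose y r hr using fun V : Set.Iic U => exists_restriction p x.obj V.1.1
    have t : ∀ {W V : Set.Iic U} (_ : W ⟶ V), Nonempty (p.obj (y W) ⟶ (V.1.1 : C)) :=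
      fun {W V} h => ⟨(hr W).2.choose ≫ Subobject.ofLE W.1.1 V.1.1 h.le⟩
    have hl := fun {W V : Set.Iic U} (h : W ⟶ V) => (hr V).existsUnique (t h).some (r W)
    let Y : Set.Iic U ⥤ F :=
      { obj := y
        map := fun h => (hl h).choose
        map_id := fun V => (hl (𝟙 V)).unique (hl (𝟙 V)).choose_spec.1 (Category.id_comp _)
        map_comp := fun h k => (hl (h ≫ k)).unique (hl (h ≫ k)).choose_spec.1 (by
          rw [Category.assoc, (hl k).choose_spec.1, (hl h).choose_spec.1]) }
    have hY : IsFam Φ p U Y := fun W V h => IsRestriction.of_comp (hr V) (by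
      have := (hl h).choose_spec.1
      rw [this]
      exact hr W)
    obtain ⟨l, hl₁, -⟩ := (hr (Idx.self Φ U)).existsUnique x.property.some (𝟙 x.obj)
    have hl₂ : r (Idx.self Φ U) ≫ l = 𝟙 _ :=
      ((hr (Idx.self Φ U)).existsUnique (hr (Idx.self Φ U)).2.choose (r (Idx.self Φ U))).unique
        (by rw [Category.assoc, hl₁, Category.comp_id]) (Category.id_comp _)
    exact ⟨⟨Y, hY⟩, ⟨⟨ObjectProperty.homMk (r (Idx.self Φ U)), ObjectProperty.homMk l,
      by ext; exact hl₂, by ext; exact hl₁⟩⟩⟩⟩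

end

section

variable {T : CompData.{v, u} C} {I : BasedCategory.{v, max u v} C}

lemma CompData.IsComprehensionCategory.preserves (hT : T.IsComprehensionCategory) :
    PreservesRestrictions T.T.p (𝟭 C) T.ext :=
  preservesRestrictions_of_isPullback T.proj hT.cartesian

lemma DisplayFunctor.preserves (α : DisplayFunctor T I) :
    PreservesRestrictions I.p (𝟭 C) α.dom :=
  preservesRestrictions_of_isPullback α.π fun _ _ φ _ => α.equifibered φ

lemma DepProjFunctor.preserves {α : DisplayFunctor T I} (β : DepProjFunctor α) :
    PreservesRestrictions I.p (𝟭 C) β.dom :=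
  preservesRestrictions_of_isPullback (β.π ≫ α.π) fun _ _ φ _ =>
    (β.equifibered.comp α.equifibered) φ

lemma ParamScheme.preserves (P : ParamScheme T I) {F : Type (max u v)} [Category.{v} F]
    {p : F ⥤ C} {G : F ⥤ I.obj} (w : G ⋙ I.p = p) : PreservesRestrictions p I.p G :=
  preservesRestrictions_of_over w fun _ _ φ _ => P.isStronglyCartesian (G.map φ)

lemma TypeExt.snd_preserves (P : ParamScheme T I) (α : DisplayFunctor T I) :
    PreservesRestrictions (TypeExt.fst α ⋙ I.p) T.T.p (TypeExt.snd α) := by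
  intro W y x φ h
  have key : ∀ {R S : C} (f : R ⟶ S) (q : R ⟶ (W : C)) (_ : IsLimit (BinaryFan.mk f q))
      {a b : T.T.obj} (ψ : a ⟶ b), T.T.p.IsStronglyCartesian f ψ → IsRestriction T.T.p W ψ := by
    intro R S f q hq a b ψ hψ
    have := hψ.toIsHomLift
    subst_hom_lift T.T.p f ψ
    exact ⟨hψ, q, ⟨hq⟩⟩
  obtain ⟨-, q, ⟨hq⟩⟩ := ((P.preserves rfl).comp α.preserves) W φ h
  exact key _ q hq _ (TypeExt.Hom.cartesian φ)

end

/-- The comprehension category `(C_Φ, T_Φ)`: the filtered colimit of `(C_U, T_U)`, `U ∈ Φ`. -/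
noncomputable def CompData.filterQuotient (T : CompData.{v, u} C)
    (hT : T.IsComprehensionCategory) : CompData.{max u v, max u v} (BaseCat Φ) where
  T := BasedCategory.ofFunctor (FCat.base Φ T.T.p)
  ext := FCat.map Φ hT.preserves
  proj := FCat.natTrans Φ hT.preserves (preservesRestrictions_base T.T.p) T.proj

/-- `Q` is the parameter scheme over `(C_Φ, T_Φ)` induced by the parameter scheme `P` over `(C, T)`,
and `K : Inst(P)_Φ ⥤ Inst(Q)` is the canonical comparison functor.  Both schemes are built by the
same steps; in each step the functors `α'`, `β'` which extend `Q` restrict along `K` to the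
functors on `Inst(P)_Φ` induced by the functors `α`, `β` which extend `P`, and the comparison
functor for the extensions sends the class of a family `(θ, A)` to the pair of the classes of `θ`
and `A`, respectively the class of a family `(θ, s)` to the class of `θ` with the class of `s`. -/
inductive ParamScheme.Induces {T : CompData.{v, u} C} (hT : T.IsComprehensionCategory) :
    ∀ {I : BasedCategory.{v, max u v} C} (_ : ParamScheme T I)
      {J : BasedCategory.{max u v, max u v} (BaseCat Φ)}
      (_ : ParamScheme (T.filterQuotient Φ hT) J) (_ : FCat Φ I.p ⥤ J.obj), Prop
  | nil : Induces hT ParamScheme.nil ParamScheme.nil (𝟭 (BaseCat Φ))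
  | type {I : BasedCategory.{v, max u v} C} (P : ParamScheme T I)
      {J : BasedCategory.{max u v, max u v} (BaseCat Φ)}
      (Q : ParamScheme (T.filterQuotient Φ hT) J) (K : FCat Φ I.p ⥤ J.obj)
      (h : Induces hT P Q K)
      (α : DisplayFunctor T I) (α' : DisplayFunctor (T.filterQuotient Φ hT) J)
      (α_dom : K ⋙ α'.dom = FCat.map Φ α.preserves)
      (α_π : ∀ θ : FCat Φ I.p, Arrow.mk (α'.π.app (K.obj θ)) = Arrow.mk
        ((FCat.natTrans Φ α.preserves (preservesRestrictions_base I.p) α.π).app θ))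
      (K' : FCat Φ (TypeExt.fst α ⋙ I.p) ⥤ TypeExt α')
      (fst : K' ⋙ TypeExt.fst α' = FCat.map Φ (P.preserves rfl) ⋙ K)
      (snd : K' ⋙ TypeExt.snd α' = FCat.map Φ (TypeExt.snd_preserves P α)) :
      Induces hT (P.type α) (Q.type α') K'
  | term {I : BasedCategory.{v, max u v} C} (P : ParamScheme T I)
      {J : BasedCategory.{max u v, max u v} (BaseCat Φ)}
      (Q : ParamScheme (T.filterQuotient Φ hT) J) (K : FCat Φ I.p ⥤ J.obj)
      (h : Induces hT P Q K)
      (α : DisplayFunctor T I) (α' : DisplayFunctor (T.filterQuotient Φ hT) J)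
      (α_dom : K ⋙ α'.dom = FCat.map Φ α.preserves)
      (α_π : ∀ θ : FCat Φ I.p, Arrow.mk (α'.π.app (K.obj θ)) = Arrow.mk
        ((FCat.natTrans Φ α.preserves (preservesRestrictions_base I.p) α.π).app θ))
      (β : DepProjFunctor α) (β' : DepProjFunctor α')
      (β_dom : K ⋙ β'.dom = FCat.map Φ β.preserves)
      (β_π : ∀ θ : FCat Φ I.p, Arrow.mk (β'.π.app (K.obj θ)) = Arrow.mk
        ((FCat.natTrans Φ β.preserves α.preserves β.π).app θ))
      (K' : FCat Φ (TermExt.fst β ⋙ I.p) ⥤ TermExt β')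
      (fst : K' ⋙ TermExt.fst β' = FCat.map Φ (P.preserves rfl) ⋙ K)
      (tm : ∀ x : FCat Φ (TermExt.fst β ⋙ I.p), Arrow.mk (K'.obj x).tm = Arrow.mk
        ((FCat.natTrans Φ (p := TermExt.fst β ⋙ I.p) (p' := 𝟭 C)
          ((P.preserves rfl).comp α.preserves) ((P.preserves rfl).comp β.preserves)
          (TermExt.section_ β)).app x)) :
      Induces hT (P.term α β) (Q.term α' β') K'

namespace FCoSwPData

/-- The component `S ⥤ Inst(P)` of `U`. -/
abbrev toInst (E : FCoSwPData.{v, u} C) : E.S.obj ⥤ E.I.obj := E.U ⋙ Comma.snd _ _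

/-- The functor sending an object of `S`, lying over `X ⟶ Γ`, to `X`. -/
abbrev carrier (E : FCoSwPData.{v, u} C) : E.S.obj ⥤ C := E.U ⋙ Comma.fst _ _

/-- The natural map `X ⟶ Γ`. -/
abbrev structureMap (E : FCoSwPData.{v, u} C) : E.carrier ⟶ E.toInst ⋙ E.I.p :=
  Functor.whiskerLeft E.U (Comma.natTrans _ _)

lemma IsFCoSwP.toInst_preserves {E : FCoSwPData.{v, u} C} (hE : E.IsFCoSwP) :
    PreservesRestrictions E.S.p E.I.p E.toInst :=
  E.P.preserves hE.over_base

lemma IsFCoSwP.carrier_preserves {E : FCoSwPData.{v, u} C} (hE : E.IsFCoSwP) :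
    PreservesRestrictions E.S.p (𝟭 C) E.carrier := by
  have key : ∀ {p : E.S.obj ⥤ C} (_ : E.toInst ⋙ E.I.p = p),
      (∀ ⦃a b : E.S.obj⦄ (φ : a ⟶ b), p.IsStronglyCartesian (p.map φ) φ →
        IsPullback (E.U.map φ).left (E.U.obj a).hom (E.U.obj b).hom
          (E.I.p.map (E.U.map φ).right)) → PreservesRestrictions p (𝟭 C) E.carrier := by
    intro p w h
    subst w
    exact preservesRestrictions_of_isPullback E.structureMap h
  exact key hE.over_base hE.cartesian_arrow

/-- The filter quotient `(C_Φ, T_Φ, S_Φ, Q, Inst(Q))` of the data `E`, for a parameter scheme `Q`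
over `(C_Φ, T_Φ)` with a functor `K : Inst(P)_Φ ⥤ Inst(Q)` over `C_Φ`.  The functor
`S_Φ ⥤ Inst(Q) ×_{C_Φ} (C_Φ)^→` is induced by `U`, i.e. it sends the class of a family of objects
of `S` lying over the family `(θ, X ⟶ Γ)` to `K[θ]` and the class of the family `X ⟶ Γ`. -/
noncomputable def filterQuotient (E : FCoSwPData.{v, u} C) (hE : E.IsFCoSwP)
    {J : BasedCategory.{max u v, max u v} (BaseCat Φ)}
    (Q : ParamScheme (E.T.filterQuotient Φ hE.comprehension) J) (K : FCat Φ E.I.p ⥤ J.obj)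
    (hK : K ⋙ J.p = FCat.base Φ E.I.p) : FCoSwPData.{max u v, max u v} (BaseCat Φ) where
  T := E.T.filterQuotient Φ hE.comprehension
  I := J
  P := Q
  S := BasedCategory.ofFunctor (FCat.base Φ E.S.p)
  U :=
    let toJ : FCat Φ E.S.p ⥤ J.obj := FCat.map Φ hE.toInst_preserves ⋙ K
    let structureMap : FCat.map Φ hE.carrier_preserves ⟶ toJ ⋙ J.p :=
      FCat.natTrans Φ hE.carrier_preserves
          (hE.toInst_preserves.comp (preservesRestrictions_base E.I.p)) E.structureMap ≫
        eqToHom (by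
          rw [FCat.map_comp, Functor.assoc, hK]
          rfl)
    commaLift (FCat.map Φ hE.carrier_preserves) toJ J.p structureMap

end FCoSwPData

/-- `K` is an isomorphism of categories. -/
def IsIsoOfCategories {X Y : Type*} [Category X] [Category Y] (K : X ⥤ Y) : Prop :=
  ∃ L : Y ⥤ X, K ⋙ L = 𝟭 X ∧ L ⋙ K = 𝟭 Y

end Quotient

end FilterQuotients

open FilterQuotients

namespace FilterQuotients

section Germs

variable {C : Type (max u v)} [Category.{v} C] [HasFiniteProducts C]
variable (Φ : Order.PFilter (Subobject (⊤_ C)))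
variable {F : Type (max u v)} [Category.{v} F] (p : F ⥤ C)

variable {Φ} in
lemma Idx.exists_le (U V : Idx Φ) : ∃ W : Idx Φ, W ≤ U ∧ W ≤ V :=
  FilterQuotient.exists_le Φ U V

variable {Φ} {p}

/-- The restriction of a family to `V ≤ U`. -/
noncomputable abbrev famRes {U V : Idx Φ} (h : V ≤ U) (x : Fam Φ p U) : Fam Φ p V :=
  (famRestrict Φ p h).obj x

/-- The restriction of an arrow between restricted families. -/
noncomputable def homRes {U V W W' : Idx Φ} {x : Fam Φ p U} {y : Fam Φ p V} {hU : W ≤ U}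
    {hV : W ≤ V} (k : W' ≤ W) (f : famRes hU x ⟶ famRes hV y) :
    famRes (k.trans hU) x ⟶ famRes (k.trans hV) y :=
  (famRestrict Φ p k).map f

lemma homRes_comp {U V N W W' : Idx Φ} {x : Fam Φ p U} {y : Fam Φ p V} {z : Fam Φ p N} {hU : W ≤ U}
    {hV : W ≤ V} {hN : W ≤ N} (k : W' ≤ W) (f : famRes hU x ⟶ famRes hV y)
    (g : famRes hV y ⟶ famRes hN z) : homRes k (f ≫ g) = homRes k f ≫ homRes k g := rfl

lemma famRes_eq_of_le {U V W W' : Idx Φ} {x : Fam Φ p U} {y : Fam Φ p V} {hU : W ≤ U}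
    {hV : W ≤ V} (k : W' ≤ W) (h : famRes hU x = famRes hV y) :
    famRes (k.trans hU) x = famRes (k.trans hV) y :=
  congrArg (famRes k) h

lemma homRes_eqToHom {U V W W' : Idx Φ} {x : Fam Φ p U} {y : Fam Φ p V} {hU : W ≤ U}
    {hV : W ≤ V} (k : W' ≤ W) (h : famRes hU x = famRes hV y) :
    homRes k (eqToHom h) = eqToHom (famRes_eq_of_le k h) :=
  eqToHom_map _ _

/-- Arrows between the restrictions of `x` and `y` to elements of `Φ`. -/
def Germ {U V : Idx Φ} (x : Fam Φ p U) (y : Fam Φ p V) : Type (max u v) :=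
  Σ W : {W : Idx Φ // W ≤ U ∧ W ≤ V}, (famRes W.2.1 x ⟶ famRes W.2.2 y)

/-- Germs are identified when they eventually agree. -/
def germSetoid {U V : Idx Φ} (x : Fam Φ p U) (y : Fam Φ p V) : Setoid (Germ x y) where
  r f g := ∃ (W : Idx Φ) (h₁ : W ≤ f.1.1) (h₂ : W ≤ g.1.1), homRes h₁ f.2 = homRes h₂ g.2
  iseqv := by
    refine ⟨fun f => ⟨_, le_rfl, le_rfl, rfl⟩, fun ⟨W, a, b, h⟩ => ⟨W, b, a, h.symm⟩, ?_⟩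
    rintro f g k ⟨W, a, b, h⟩ ⟨W', a', b', h'⟩
    obtain ⟨N, c, d⟩ := Idx.exists_le W W'
    refine ⟨N, c.trans a, d.trans b', ?_⟩
    have h₁ := congrArg (homRes c) h
    have h₂ := congrArg (homRes d) h'
    exact h₁.trans h₂

variable (Φ p) in
/-- The category of families over arbitrary elements of `Φ` and germs of arrows. -/
structure GermCat : Type (max u v) where
  idx : Idx Φ
  fam : Fam Φ p idx

/-- The class of an arrow between restrictions. -/
def germMk {U V W : Idx Φ} {x : Fam Φ p U} {y : Fam Φ p V} (hU : W ≤ U) (hV : W ≤ V)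
    (f : famRes hU x ⟶ famRes hV y) : Quotient (germSetoid x y) :=
  Quotient.mk _ ⟨⟨W, hU, hV⟩, f⟩

lemma germMk_eq_iff {U V W W' : Idx Φ} {x : Fam Φ p U} {y : Fam Φ p V} {hU : W ≤ U} {hV : W ≤ V}
    {f : famRes hU x ⟶ famRes hV y} {hU' : W' ≤ U} {hV' : W' ≤ V}
    {g : famRes hU' x ⟶ famRes hV' y} :
    germMk hU hV f = germMk hU' hV' g ↔
      ∃ (N : Idx Φ) (h₁ : N ≤ W) (h₂ : N ≤ W'), homRes h₁ f = homRes h₂ g :=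
  Quotient.eq (r := germSetoid x y)

lemma germMk_homRes {U V W W' : Idx Φ} {x : Fam Φ p U} {y : Fam Φ p V} {hU : W ≤ U} {hV : W ≤ V}
    (k : W' ≤ W) (f : famRes hU x ⟶ famRes hV y) :
    germMk (k.trans hU) (k.trans hV) (homRes k f) = germMk hU hV f :=
  germMk_eq_iff.2 ⟨W', le_rfl, k, rfl⟩

lemma exists_germMk {U V : Idx Φ} {x : Fam Φ p U} {y : Fam Φ p V} (f : Quotient (germSetoid x y)) :
    ∃ (W : Idx Φ) (hU : W ≤ U) (hV : W ≤ V) (g : famRes hU x ⟶ famRes hV y),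
      f = germMk hU hV g := by
  induction f using Quotient.inductionOn with | _ f
  exact ⟨f.1.1, f.1.2.1, f.1.2.2, f.2, rfl⟩

/-- Representatives can be chosen below any given element of the filter. -/
lemma exists_germMk_le {U V : Idx Φ} {x : Fam Φ p U} {y : Fam Φ p V}
    (f : Quotient (germSetoid x y)) (N : Idx Φ) :
    ∃ (W : Idx Φ) (hU : W ≤ U) (hV : W ≤ V) (_ : W ≤ N) (g : famRes hU x ⟶ famRes hV y),
      f = germMk hU hV g := by
  obtain ⟨W, hU, hV, g, rfl⟩ := exists_germMk f
  obtain ⟨W', a, b⟩ := Idx.exists_le W N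
  exact ⟨W', a.trans hU, a.trans hV, b, homRes a g, (germMk_homRes a g).symm⟩

/-- Composition of germs. -/
noncomputable def germComp {U V N : Idx Φ} {x : Fam Φ p U} {y : Fam Φ p V} {z : Fam Φ p N} :
    Quotient (germSetoid x y) → Quotient (germSetoid y z) → Quotient (germSetoid x z) :=
  Quotient.lift₂
    (fun f g => germMk (((Idx.exists_le f.1.1 g.1.1).choose_spec.1).trans f.1.2.1)
      (((Idx.exists_le f.1.1 g.1.1).choose_spec.2).trans g.1.2.2)
      (homRes (Idx.exists_le f.1.1 g.1.1).choose_spec.1 f.2 ≫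
        homRes (Idx.exists_le f.1.1 g.1.1).choose_spec.2 g.2)) (by
    rintro f g f' g' ⟨A, a, a', hf⟩ ⟨B, b, b', hg⟩
    apply germMk_eq_iff.2
    obtain ⟨M, m₁, m₂⟩ := Idx.exists_le (Idx.exists_le f.1.1 g.1.1).choose
      (Idx.exists_le f'.1.1 g'.1.1).choose
    obtain ⟨N, n₁, n₂⟩ := Idx.exists_le A B
    obtain ⟨L, l₁, l₂⟩ := Idx.exists_le M N
    refine ⟨L, l₁.trans m₁, l₁.trans m₂, ?_⟩
    rw [homRes_comp, homRes_comp]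
    exact congrArg₂ (· ≫ ·) (congrArg (homRes (l₂.trans n₁)) hf)
      (congrArg (homRes (l₂.trans n₂)) hg))

lemma germComp_germMk {U V N W : Idx Φ} {x : Fam Φ p U} {y : Fam Φ p V} {z : Fam Φ p N}
    (hU : W ≤ U) (hV : W ≤ V) (hN : W ≤ N) (f : famRes hU x ⟶ famRes hV y)
    (g : famRes hV y ⟶ famRes hN z) :
    germComp (germMk hU hV f) (germMk hV hN g) = germMk hU hN (f ≫ g) :=
  germMk_homRes (Idx.exists_le W W).choose_spec.1 (f ≫ g)

noncomputable instance : Category.{max u v} (GermCat Φ p) where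
  Hom X Y := Quotient (germSetoid X.fam Y.fam)
  id X := germMk le_rfl le_rfl (𝟙 X.fam)
  comp f g := germComp f g
  id_comp {X Y} f := by
    obtain ⟨W, hU, hV, f, rfl⟩ := exists_germMk f
    rw [← germMk_homRes hU (hU := le_rfl) (hV := le_rfl) (𝟙 X.fam)]
    exact (germComp_germMk hU hU hV _ f).trans (congrArg _ (Category.id_comp f))
  comp_id {X Y} f := by
    obtain ⟨W, hU, hV, f, rfl⟩ := exists_germMk f
    rw [← germMk_homRes hV (hU := le_rfl) (hV := le_rfl) (𝟙 Y.fam)]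
    exact (germComp_germMk hU hV hV f _).trans (congrArg _ (Category.comp_id f))
  assoc {X Y Z T} f g h := by
    obtain ⟨W, a₁, a₂, f, rfl⟩ := exists_germMk f
    obtain ⟨W', b₁, b₂, hb, g, rfl⟩ := exists_germMk_le g W
    obtain ⟨W'', c₁, c₂, hc, h, rfl⟩ := exists_germMk_le h W'
    rw [← germMk_homRes hc g, ← germMk_homRes (hc.trans hb) f]
    simp only [germComp_germMk, Category.assoc]

/-- Arrows of `GermCat` as classes. -/
def GermCat.homMk {X Y : GermCat Φ p} {W : Idx Φ} (hU : W ≤ X.idx) (hV : W ≤ Y.idx)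
    (f : famRes hU X.fam ⟶ famRes hV Y.fam) : X ⟶ Y := germMk hU hV f

lemma GermCat.homMk_comp {X Y Z : GermCat Φ p} {W : Idx Φ} (hU : W ≤ X.idx) (hV : W ≤ Y.idx)
    (hN : W ≤ Z.idx) (f : famRes hU X.fam ⟶ famRes hV Y.fam)
    (g : famRes hV Y.fam ⟶ famRes hN Z.fam) :
    homMk hU hV f ≫ homMk hV hN g = homMk hU hN (f ≫ g) :=
  germComp_germMk hU hV hN f g

lemma GermCat.homMk_homRes {X Y : GermCat Φ p} {W W' : Idx Φ} {hU : W ≤ X.idx} {hV : W ≤ Y.idx}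
    (k : W' ≤ W) (f : famRes hU X.fam ⟶ famRes hV Y.fam) :
    homMk (k.trans hU) (k.trans hV) (homRes k f) = homMk hU hV f :=
  germMk_homRes k f

lemma GermCat.homMk_id {X : GermCat Φ p} {W : Idx Φ} (hU : W ≤ X.idx) :
    homMk hU hU (𝟙 (famRes hU X.fam)) = 𝟙 X :=
  germMk_homRes hU (hU := le_rfl) (hV := le_rfl) (𝟙 X.fam)

/-- Families which eventually agree. -/
instance GermCat.setoid : Setoid (GermCat Φ p) where
  r X Y := ∃ (W : Idx Φ) (hU : W ≤ X.idx) (hV : W ≤ Y.idx), famRes hU X.fam = famRes hV Y.fam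
  iseqv := by
    refine ⟨fun f => ⟨_, le_rfl, le_rfl, rfl⟩, fun ⟨W, a, b, h⟩ => ⟨W, b, a, h.symm⟩, ?_⟩
    rintro X Y Z ⟨W, a, b, h⟩ ⟨W', a', b', h'⟩
    obtain ⟨N, c, d⟩ := Idx.exists_le W W'
    exact ⟨N, c.trans a, d.trans b', (famRes_eq_of_le c h).trans (famRes_eq_of_le d h')⟩

/-- The canonical arrow between families which eventually agree. -/
noncomputable def GermCat.can {X Y : GermCat Φ p} (h : X ≈ Y) : X ⟶ Y :=
  homMk h.choose_spec.choose h.choose_spec.choose_spec.choose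
    (eqToHom h.choose_spec.choose_spec.choose_spec)

lemma GermCat.can_eq {X Y : GermCat Φ p} (h : X ≈ Y) {W : Idx Φ} (hU : W ≤ X.idx)
    (hV : W ≤ Y.idx) (e : famRes hU X.fam = famRes hV Y.fam) : can h = homMk hU hV (eqToHom e) := by
  obtain ⟨N, c, d⟩ := Idx.exists_le h.choose W
  refine germMk_eq_iff.2 ⟨N, c, d, ?_⟩
  rw [homRes_eqToHom, homRes_eqToHom]

@[simp]
lemma GermCat.can_refl {X : GermCat Φ p} (h : X ≈ X) : can h = 𝟙 X := by
  rw [can_eq h le_rfl le_rfl rfl]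
  exact homMk_id _

@[simp]
lemma GermCat.can_comp {X Y Z : GermCat Φ p} (h : X ≈ Y) (k : Y ≈ Z) :
    can h ≫ can k = can (Setoid.trans h k) := by
  obtain ⟨W, a, b, e⟩ := h
  obtain ⟨W', a', b', e'⟩ := k
  obtain ⟨N, c, d⟩ := Idx.exists_le W W'
  rw [can_eq _ (c.trans a) (c.trans b) (famRes_eq_of_le c e),
    can_eq _ (d.trans a') (d.trans b') (famRes_eq_of_le d e'),
    can_eq _ (c.trans a) (d.trans b') ((famRes_eq_of_le c e).trans (famRes_eq_of_le d e')),
    homMk_comp, eqToHom_trans]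

@[simp]
lemma GermCat.can_comp_assoc {X Y Z T : GermCat Φ p} (h : X ≈ Y) (k : Y ≈ Z) (f : Z ⟶ T) :
    can h ≫ can k ≫ f = can (Setoid.trans h k) ≫ f := by
  rw [← Category.assoc, can_comp]

lemma GermCat.exists_homMk_comp {X Y Z : GermCat Φ p} (f : X ⟶ Y) (g : Y ⟶ Z) :
    ∃ (W : Idx Φ) (hU : W ≤ X.idx) (hV : W ≤ Y.idx) (hN : W ≤ Z.idx)
      (f' : famRes hU X.fam ⟶ famRes hV Y.fam) (g' : famRes hV Y.fam ⟶ famRes hN Z.fam),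
      f = homMk hU hV f' ∧ g = homMk hV hN g' := by
  obtain ⟨W, a₁, a₂, f, rfl⟩ := exists_germMk f
  obtain ⟨W', b₁, b₂, hb, g, rfl⟩ := exists_germMk_le g W
  exact ⟨W', hb.trans a₁, b₁, b₂, homRes hb f, g, (germMk_homRes hb f).symm, rfl⟩

lemma GermCat.can_homMk_can {X Y X' Y' : GermCat Φ p} (hX : X ≈ X') (hY : Y' ≈ Y) {W : Idx Φ}
    (hU : W ≤ X.idx) (hU' : W ≤ X'.idx) (hV : W ≤ Y.idx) (hV' : W ≤ Y'.idx)
    (eX : famRes hU X.fam = famRes hU' X'.fam) (eY : famRes hV' Y'.fam = famRes hV Y.fam)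
    (f : famRes hU' X'.fam ⟶ famRes hV' Y'.fam) :
    can hX ≫ homMk hU' hV' f ≫ can hY = homMk hU hV (eqToHom eX ≫ f ≫ eqToHom eY) := by
  rw [can_eq hX hU hU' eX, can_eq hY hV' hV eY, homMk_comp, homMk_comp]

lemma eqToHom_conj {D : Type*} [Category D] {X Y : D} (hX : X = X) (hY : Y = Y) (f : X ⟶ Y) :
    eqToHom hX ≫ f ≫ eqToHom hY = f := by simp

lemma eqToHom_conj_conj {D : Type*} [Category D] {X Y X' Y' X'' Y'' : D} (a : X = X') (b : X' = X'')
    (f : X'' ⟶ Y'') (c : Y'' = Y') (d : Y' = Y) :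
    eqToHom a ≫ (eqToHom b ≫ f ≫ eqToHom c) ≫ eqToHom d =
      eqToHom (a.trans b) ≫ f ≫ eqToHom (c.trans d) := by
  subst a b c d
  simp

variable (Φ p) in
/-- The quotient of `GermCat` in which families which eventually agree are equal. -/
structure GermQuot : Type (max u v) where
  cls : Quotient (GermCat.setoid (Φ := Φ) (p := p))

/-- A chosen representative. -/
noncomputable def GermQuot.out (a : GermQuot Φ p) : GermCat Φ p := a.cls.out

noncomputable instance : Category.{max u v} (GermQuot Φ p) where
  Hom a b := a.out ⟶ b.out
  id a := 𝟙 a.out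
  comp {a b c} f g := CategoryStruct.comp (obj := GermCat Φ p) f g

/-- The class of a family. -/
def GermQuot.mk' (X : GermCat Φ p) : GermQuot Φ p := ⟨Quotient.mk _ X⟩

lemma GermQuot.out_mk (X : GermCat Φ p) : (mk' X).out ≈ X := Quotient.mk_out X

lemma GermQuot.eqToHom_eq {a b : GermQuot Φ p} (h : a = b) :
    eqToHom h = (GermCat.can (h ▸ Setoid.refl _ : a.out ≈ b.out) : a.out ⟶ b.out) := by
  subst h
  exact (GermCat.can_refl _).symm

variable (Φ p) in
/-- The canonical functor to the quotient. -/
noncomputable def GermQuot.proj : GermCat Φ p ⥤ GermQuot Φ p where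
  obj X := mk' X
  map {X Y} f := (GermCat.can (out_mk X) ≫ f ≫ GermCat.can (Setoid.symm (out_mk Y)) :
    (mk' X).out ⟶ (mk' Y).out)
  map_id X := by
    rw [Category.id_comp, GermCat.can_comp, GermCat.can_refl]
    rfl
  map_comp {X Y Z} f g := by
    change _ = CategoryStruct.comp (obj := GermCat Φ p) _ _
    simp

variable (Φ p) in
/-- The inclusion of the families over `U`. -/
noncomputable def GermCat.incl (U : Idx Φ) : Fam Φ p U ⥤ GermCat Φ p where
  obj x := ⟨U, x⟩
  map {x y} f := homMk (X := ⟨U, x⟩) (Y := ⟨U, y⟩) le_rfl le_rfl f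
  map_id _ := rfl
  map_comp {x y z} f g := (homMk_comp (X := ⟨U, x⟩) (Y := ⟨U, y⟩) (Z := ⟨U, z⟩) _ _ _ f g).symm

lemma GermQuot.proj_obj_eq {X X' : GermCat Φ p} (h : X ≈ X') :
    (proj Φ p).obj X = (proj Φ p).obj X' :=
  congrArg GermQuot.mk (Quotient.sound h)

lemma GermQuot.proj_map_can {X X' : GermCat Φ p} (h : X ≈ X') :
    (proj Φ p).map (GermCat.can h) = eqToHom (proj_obj_eq h) := by
  rw [eqToHom_eq]
  change GermCat.can _ ≫ GermCat.can _ ≫ GermCat.can _ = _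
  rw [GermCat.can_comp, GermCat.can_comp]
  rfl

lemma GermCat.incl_restrict_equiv {U V : Idx Φ} (h : V ≤ U) (x : Fam Φ p U) :
    (GermCat.incl Φ p V).obj (famRes h x) ≈ (GermCat.incl Φ p U).obj x :=
  ⟨V, le_rfl, h, rfl⟩

lemma GermCat.incl_restrict_map {U V : Idx Φ} (h : V ≤ U) {x y : Fam Φ p U} (f : x ⟶ y) :
    (incl Φ p V).map ((famRestrict Φ p h).map f) = can (incl_restrict_equiv h x) ≫
      (incl Φ p U).map f ≫ can (Setoid.symm (incl_restrict_equiv h y)) := by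
  have : (incl Φ p U).map f = homMk (X := ⟨U, x⟩) (Y := ⟨U, y⟩) h h ((famRestrict Φ p h).map f) :=
    (homMk_homRes (X := ⟨U, x⟩) (Y := ⟨U, y⟩) (hU := le_rfl) (hV := le_rfl) h f).symm
  rw [this]
  refine Eq.trans ?_ (can_homMk_can (X := ⟨V, famRes h x⟩) (Y := ⟨V, famRes h y⟩)
    (X' := ⟨U, x⟩) (Y' := ⟨U, y⟩) (incl_restrict_equiv h x)
    (Setoid.symm (incl_restrict_equiv h y)) le_rfl h le_rfl h rfl rfl
    ((famRestrict Φ p h).map f)).symm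
  exact congrArg (homMk (X := ⟨V, famRes h x⟩) (Y := ⟨V, famRes h y⟩) le_rfl le_rfl)
    (eqToHom_conj _ _ ((famRestrict Φ p h).map f)).symm

variable (Φ p) in
lemma GermQuot.restrict_incl {U V : Idx Φ} (h : V ≤ U) :
    famRestrict Φ p h ⋙ GermCat.incl Φ p V ⋙ proj Φ p = GermCat.incl Φ p U ⋙ proj Φ p := by
  refine CategoryTheory.Functor.ext (fun x => proj_obj_eq (GermCat.incl_restrict_equiv h x)) ?_
  intro x y f
  refine (congrArg (proj Φ p).map (GermCat.incl_restrict_map h f)).trans ?_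
  rw [Functor.map_comp, Functor.map_comp, proj_map_can, proj_map_can]
  rfl

/-! ### Representing objects and arrows of the filtered colimit -/

lemma FCat.ι_famRes {U V : Idx Φ} (h : V ≤ U) (x : Fam Φ p U) :
    (FCat.ι Φ p V).obj (famRes h x) = (FCat.ι Φ p U).obj x :=
  congrArg (fun K => K.obj x) (FCat.restrict_ι Φ p h)

lemma FCat.ι_map_restrict {U V : Idx Φ} (h : V ≤ U) {x y : Fam Φ p U} (f : x ⟶ y) :
    (FCat.ι Φ p V).map ((famRestrict Φ p h).map f) =
      eqToHom (ι_famRes h x) ≫ (FCat.ι Φ p U).map f ≫ eqToHom (ι_famRes h y).symm :=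
  Functor.congr_hom (FCat.restrict_ι Φ p h) f

/-- The arrow of `F_Φ` represented by an arrow between restrictions. -/
noncomputable def FCat.homMk {U V W : Idx Φ} {x : Fam Φ p U} {y : Fam Φ p V} (hU : W ≤ U)
    (hV : W ≤ V) (f : famRes hU x ⟶ famRes hV y) :
    (FCat.ι Φ p U).obj x ⟶ (FCat.ι Φ p V).obj y :=
  eqToHom (ι_famRes hU x).symm ≫ (FCat.ι Φ p W).map f ≫ eqToHom (ι_famRes hV y)

lemma FCat.homMk_comp {U V N W : Idx Φ} {x : Fam Φ p U} {y : Fam Φ p V} {z : Fam Φ p N}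
    (hU : W ≤ U) (hV : W ≤ V) (hN : W ≤ N) (f : famRes hU x ⟶ famRes hV y)
    (g : famRes hV y ⟶ famRes hN z) : homMk hU hV f ≫ homMk hV hN g = homMk hU hN (f ≫ g) := by
  simp [homMk]

lemma FCat.homMk_homRes {U V W W' : Idx Φ} {x : Fam Φ p U} {y : Fam Φ p V} {hU : W ≤ U}
    {hV : W ≤ V} (k : W' ≤ W) (f : famRes hU x ⟶ famRes hV y) :
    homMk (k.trans hU) (k.trans hV) (homRes k f) = homMk hU hV f := by
  unfold homMk
  have := ι_map_restrict k f
  exact (congrArg (fun t => eqToHom (ι_famRes (k.trans hU) x).symm ≫ t ≫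
    eqToHom (ι_famRes (k.trans hV) y)) this).trans (eqToHom_conj_conj _ _ _ _ _)

lemma FCat.homMk_eqToHom {U V W : Idx Φ} {x : Fam Φ p U} {y : Fam Φ p V} (hU : W ≤ U)
    (hV : W ≤ V) (h : famRes hU x = famRes hV y) :
    homMk hU hV (eqToHom h) = eqToHom ((ι_famRes hU x).symm.trans
      ((congrArg _ h).trans (ι_famRes hV y))) := by
  unfold homMk
  rw [eqToHom_map, eqToHom_trans, eqToHom_trans]

lemma FCat.homMk_id {U W : Idx Φ} {x : Fam Φ p U} (hU : W ≤ U) :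
    homMk hU hU (𝟙 (famRes hU x)) = 𝟙 _ := by
  simp [homMk]

lemma FCat.homMk_refl {U : Idx Φ} {x y : Fam Φ p U} (f : x ⟶ y) :
    homMk (le_refl U) (le_refl U) f = (FCat.ι Φ p U).map f := by
  exact eqToHom_conj _ _ ((FCat.ι Φ p U).map f)

lemma FCat.homMk_famRestrict {U W : Idx Φ} {x y : Fam Φ p U} (h : W ≤ U) (f : x ⟶ y) :
    homMk h h ((famRestrict Φ p h).map f) = (FCat.ι Φ p U).map f :=
  (homMk_homRes h (hU := le_rfl) (hV := le_rfl) f).trans (homMk_refl f)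

/-- The arrow of `F_Φ` represented by a germ. -/
noncomputable def GermCat.toFCatMap {X Y : GermCat Φ p} (f : X ⟶ Y) :
    (FCat.ι Φ p X.idx).obj X.fam ⟶ (FCat.ι Φ p Y.idx).obj Y.fam :=
  Quotient.lift (fun f : Germ X.fam Y.fam => FCat.homMk f.1.2.1 f.1.2.2 f.2) (by
    rintro ⟨⟨W, hU, hV⟩, f⟩ ⟨⟨W', hU', hV'⟩, g⟩ ⟨N, h₁, h₂, h⟩
    rw [← FCat.homMk_homRes h₁ f, ← FCat.homMk_homRes h₂ g]
    exact congrArg _ h) f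

lemma GermCat.toFCatMap_homMk {X Y : GermCat Φ p} {W : Idx Φ} (hU : W ≤ X.idx) (hV : W ≤ Y.idx)
    (f : famRes hU X.fam ⟶ famRes hV Y.fam) :
    toFCatMap (homMk hU hV f) = FCat.homMk hU hV f := rfl

lemma GermCat.toFCatMap_comp {X Y Z : GermCat Φ p} (f : X ⟶ Y) (g : Y ⟶ Z) :
    toFCatMap (f ≫ g) = toFCatMap f ≫ toFCatMap g := by
  obtain ⟨W, a, b, c, f, g, rfl, rfl⟩ := exists_homMk_comp f g
  rw [homMk_comp, toFCatMap_homMk, toFCatMap_homMk, toFCatMap_homMk, FCat.homMk_comp]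

variable (Φ p) in
/-- The functor from germs to the filtered colimit. -/
noncomputable def GermCat.toFCat : GermCat Φ p ⥤ FCat Φ p where
  obj X := (FCat.ι Φ p X.idx).obj X.fam
  map f := toFCatMap f
  map_id X := FCat.homMk_id (x := X.fam) (le_refl X.idx)
  map_comp f g := toFCatMap_comp f g

lemma GermCat.toFCat_homMk {X Y : GermCat Φ p} {W : Idx Φ} (hU : W ≤ X.idx) (hV : W ≤ Y.idx)
    (f : famRes hU X.fam ⟶ famRes hV Y.fam) :
    (toFCat Φ p).map (homMk hU hV f) = FCat.homMk hU hV f := rfl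

lemma GermCat.toFCat_obj_eq {X Y : GermCat Φ p} (h : X ≈ Y) :
    (toFCat Φ p).obj X = (toFCat Φ p).obj Y := by
  obtain ⟨W, hU, hV, h⟩ := h
  exact (FCat.ι_famRes hU X.fam).symm.trans ((congrArg _ h).trans (FCat.ι_famRes hV Y.fam))

lemma GermCat.toFCat_can {X Y : GermCat Φ p} (h : X ≈ Y) :
    (toFCat Φ p).map (can h) = eqToHom (toFCat_obj_eq h) := by
  obtain ⟨W, hU, hV, e⟩ := h
  rw [can_eq _ hU hV e, toFCat_homMk, FCat.homMk_eqToHom]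
  rfl

variable (Φ p) in
/-- The comparison from the filtered colimit to its explicit model. -/
noncomputable def FCat.toGermQuot : FCat Φ p ⥤ GermQuot Φ p :=
  FCat.desc Φ (fun U => GermCat.incl Φ p U ⋙ GermQuot.proj Φ p)
    (fun _ _ h => GermQuot.restrict_incl Φ p h)

variable (Φ p) in
/-- The comparison from the explicit model to the filtered colimit. -/
noncomputable def GermQuot.toFCat : GermQuot Φ p ⥤ FCat Φ p where
  obj a := (GermCat.toFCat Φ p).obj a.out
  map {a b} f := (GermCat.toFCat Φ p).map (X := a.out) (Y := b.out) f
  map_id a := (GermCat.toFCat Φ p).map_id a.out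
  map_comp {a b c} f g := (GermCat.toFCat Φ p).map_comp (X := a.out) (Y := b.out) (Z := c.out) f g

lemma GermQuot.proj_toFCat_map {X Y : GermCat Φ p} (f : X ⟶ Y) :
    (toFCat Φ p).map ((proj Φ p).map f) = eqToHom (GermCat.toFCat_obj_eq (out_mk X)) ≫
      (GermCat.toFCat Φ p).map f ≫ eqToHom (GermCat.toFCat_obj_eq (out_mk Y)).symm := by
  change (GermCat.toFCat Φ p).map (GermCat.can (out_mk X) ≫ f ≫
    GermCat.can (Setoid.symm (out_mk Y))) = _
  rw [Functor.map_comp, Functor.map_comp, GermCat.toFCat_can, GermCat.toFCat_can]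

end Germs

section Germs

variable {C : Type (max u v)} [Category.{v} C] [HasFiniteProducts C]
variable {Φ : Order.PFilter (Subobject (⊤_ C))}
variable {F : Type (max u v)} [Category.{v} F] {p : F ⥤ C}

variable (Φ p) in
lemma FCat.toGermQuot_toFCat : toGermQuot Φ p ⋙ GermQuot.toFCat Φ p = 𝟭 (FCat Φ p) := by
  refine FCat.functor_ext Φ fun U => ?_
  rw [← Functor.assoc, toGermQuot, FCat.ι_desc]
  fapply CategoryTheory.Functor.ext
  · intro x
    exact GermCat.toFCat_obj_eq (GermQuot.out_mk ((GermCat.incl Φ p U).obj x))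
  intro x y f
  have h : (GermCat.toFCat Φ p).map ((GermCat.incl Φ p U).map f) = (FCat.ι Φ p U).map f :=
    FCat.homMk_refl f
  have h' := GermQuot.proj_toFCat_map ((GermCat.incl Φ p U).map f)
  rw [h] at h'
  rw [Functor.comp_map, Functor.comp_map, Functor.comp_map, Functor.id_map, h']
  rfl

lemma FCat.exists_rep (X : FCat Φ p) : ∃ (U : Idx Φ) (x : Fam Φ p U), (FCat.ι Φ p U).obj x = X :=
  ⟨_, _, Functor.congr_obj (toGermQuot_toFCat Φ p) X⟩

lemma FCat.toGermQuot_ι {U : Idx Φ} (x : Fam Φ p U) :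
    (toGermQuot Φ p).obj ((FCat.ι Φ p U).obj x) = (GermQuot.proj Φ p).obj ⟨U, x⟩ :=
  Functor.congr_obj (FCat.ι_desc (p := p) Φ _ _ U) x

lemma FCat.ι_obj_eq_iff {U V : Idx Φ} {x : Fam Φ p U} {y : Fam Φ p V} :
    (FCat.ι Φ p U).obj x = (FCat.ι Φ p V).obj y ↔
      ∃ (W : Idx Φ) (hU : W ≤ U) (hV : W ≤ V), famRes hU x = famRes hV y := by
  constructor
  · intro h
    have h' := (toGermQuot_ι x).symm.trans ((congrArg (toGermQuot Φ p).obj h).trans (toGermQuot_ι y))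
    exact Quotient.exact (congrArg GermQuot.cls h')
  · exact fun h => GermCat.toFCat_obj_eq (X := ⟨U, x⟩) (Y := ⟨V, y⟩) h

lemma FCat.toGermQuot_ι_map {U : Idx Φ} {x y : Fam Φ p U} (f : x ⟶ y) :
    (toGermQuot Φ p).map ((FCat.ι Φ p U).map f) = eqToHom (toGermQuot_ι x) ≫
      (GermQuot.proj Φ p).map (GermCat.homMk (X := ⟨U, x⟩) (Y := ⟨U, y⟩) le_rfl le_rfl f) ≫
        eqToHom (toGermQuot_ι y).symm :=
  Functor.congr_hom (FCat.ι_desc (p := p) Φ _ _ U) f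

lemma FCat.toGermQuot_homMk {U V W : Idx Φ} {x : Fam Φ p U} {y : Fam Φ p V} (hU : W ≤ U)
    (hV : W ≤ V) (f : famRes hU x ⟶ famRes hV y) :
    (toGermQuot Φ p).map (homMk hU hV f) = eqToHom (toGermQuot_ι x) ≫
      (GermQuot.proj Φ p).map (GermCat.homMk (X := ⟨U, x⟩) (Y := ⟨V, y⟩) hU hV f) ≫
        eqToHom (toGermQuot_ι y).symm := by
  have hx : (⟨U, x⟩ : GermCat Φ p) ≈ ⟨W, famRes hU x⟩ := ⟨W, hU, le_rfl, rfl⟩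
  have hy : (⟨W, famRes hV y⟩ : GermCat Φ p) ≈ ⟨V, y⟩ := ⟨W, le_rfl, hV, rfl⟩
  have key : GermCat.homMk (X := ⟨U, x⟩) (Y := ⟨V, y⟩) hU hV f =
      GermCat.can hx ≫ GermCat.homMk (X := ⟨W, famRes hU x⟩) (Y := ⟨W, famRes hV y⟩)
        le_rfl le_rfl f ≫ GermCat.can hy :=
    ((GermCat.can_homMk_can hx hy (X := ⟨U, x⟩) (Y := ⟨V, y⟩) (X' := ⟨W, famRes hU x⟩)
      (Y' := ⟨W, famRes hV y⟩) hU le_rfl hV le_rfl rfl rfl f).trans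
        (congrArg (GermCat.homMk (X := ⟨U, x⟩) (Y := ⟨V, y⟩) hU hV) (eqToHom_conj _ _ f))).symm
  rw [key, Functor.map_comp, Functor.map_comp, GermQuot.proj_map_can, GermQuot.proj_map_can]
  unfold homMk
  rw [Functor.map_comp, Functor.map_comp, eqToHom_map, eqToHom_map, toGermQuot_ι_map]
  simp only [Category.assoc, eqToHom_trans, eqToHom_trans_assoc]

lemma FCat.homMk_eq_iff {U V W W' : Idx Φ} {x : Fam Φ p U} {y : Fam Φ p V} {hU : W ≤ U}
    {hV : W ≤ V} {f : famRes hU x ⟶ famRes hV y} {hU' : W' ≤ U} {hV' : W' ≤ V}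
    {g : famRes hU' x ⟶ famRes hV' y} :
    homMk hU hV f = homMk hU' hV' g ↔
      ∃ (N : Idx Φ) (h₁ : N ≤ W) (h₂ : N ≤ W'), homRes h₁ f = homRes h₂ g := by
  constructor
  · intro h
    have h' := congrArg (toGermQuot Φ p).map h
    rw [toGermQuot_homMk, toGermQuot_homMk, cancel_epi, cancel_mono] at h'
    have h'' : GermCat.can _ ≫ _ ≫ GermCat.can _ = GermCat.can _ ≫ _ ≫ GermCat.can _ := h'
    have := congrArg (fun k => GermCat.can (Setoid.symm (GermQuot.out_mk ⟨U, x⟩)) ≫ k ≫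
      GermCat.can (GermQuot.out_mk ⟨V, y⟩)) h''
    simp only [Category.assoc, GermCat.can_comp, GermCat.can_comp_assoc, GermCat.can_refl,
      Category.comp_id, Category.id_comp] at this
    exact germMk_eq_iff.1 this
  · rintro ⟨N, h₁, h₂, h⟩
    rw [← FCat.homMk_homRes h₁ f, ← FCat.homMk_homRes h₂ g]
    exact congrArg _ h

lemma FCat.exists_homMk {U V : Idx Φ} {x : Fam Φ p U} {y : Fam Φ p V}
    (m : (FCat.ι Φ p U).obj x ⟶ (FCat.ι Φ p V).obj y) :
    ∃ (W : Idx Φ) (hU : W ≤ U) (hV : W ≤ V) (f : famRes hU x ⟶ famRes hV y), m = homMk hU hV f := by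
  have h := Functor.congr_hom (toGermQuot_toFCat Φ p).symm m
  let X := (toGermQuot Φ p).obj ((FCat.ι Φ p U).obj x)
  let Y := (toGermQuot Φ p).obj ((FCat.ι Φ p V).obj y)
  have hX : X.out ≈ ⟨U, x⟩ := by
    have : X = GermQuot.mk' ⟨U, x⟩ := toGermQuot_ι x
    rw [this]
    exact GermQuot.out_mk _
  have hY : Y.out ≈ ⟨V, y⟩ := by
    have : Y = GermQuot.mk' ⟨V, y⟩ := toGermQuot_ι y
    rw [this]
    exact GermQuot.out_mk _
  obtain ⟨W, hU, hV, f, hf⟩ := exists_germMk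
    (GermCat.can (Setoid.symm hX) ≫ (toGermQuot Φ p).map m ≫ GermCat.can hY :
      (⟨U, x⟩ : GermCat Φ p) ⟶ ⟨V, y⟩)
  refine ⟨W, hU, hV, f, ?_⟩
  have hf' := congrArg (GermCat.toFCat Φ p).map hf
  refine Eq.trans ?_ hf'
  rw [Functor.map_comp, Functor.map_comp, GermCat.toFCat_can, GermCat.toFCat_can]
  exact h

end Germs

section Interface

variable {C : Type (max u v)} [Category.{v} C] [HasFiniteProducts C]
variable {Φ : Order.PFilter (Subobject (⊤_ C))}
variable {F : Type (max u v)} [Category.{v} F] {p : F ⥤ C}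
variable {F' : Type (max u v)} [Category.{v} F'] {p' : F' ⥤ C}

lemma eq_eqToHom_of_arrow_mk_eq {D : Type*} [Category D] {X Y X' Y' : D} {f : X ⟶ Y} {g : X' ⟶ Y'}
    (h : Arrow.mk f = Arrow.mk g) (hX : X = X') (hY : Y = Y') :
    f = eqToHom hX ≫ g ≫ eqToHom hY.symm := by
  subst hX hY
  simpa using Arrow.mk_injective _ _ h

lemma arrow_mk_eqToHom_conj {D : Type*} [Category D] {X Y X' Y' : D} (hX : X = X')
    (g : X' ⟶ Y') (hY : Y' = Y) : Arrow.mk (eqToHom hX ≫ g ≫ eqToHom hY) = Arrow.mk g := by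
  subst hX hY
  simp

namespace FCat

lemma exists_homMk_le {U V : Idx Φ} {x : Fam Φ p U} {y : Fam Φ p V}
    (m : (ι Φ p U).obj x ⟶ (ι Φ p V).obj y) (N : Idx Φ) :
    ∃ (W : Idx Φ) (hU : W ≤ U) (hV : W ≤ V) (_ : W ≤ N) (f : famRes hU x ⟶ famRes hV y),
      m = homMk hU hV f := by
  obtain ⟨W, hU, hV, f, rfl⟩ := exists_homMk m
  obtain ⟨M, h, k⟩ := Idx.exists_le W N
  exact ⟨M, h.trans hU, h.trans hV, k, homRes h f, (homMk_homRes h f).symm⟩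

/-- Two arrows, possibly of different filtered colimits, are represented over a common element of
the filter. -/
lemma exists_homMk₂ {U V U' V' : Idx Φ} {x : Fam Φ p U} {y : Fam Φ p V} {x' : Fam Φ p' U'}
    {y' : Fam Φ p' V'} (m : (ι Φ p U).obj x ⟶ (ι Φ p V).obj y)
    (m' : (ι Φ p' U').obj x' ⟶ (ι Φ p' V').obj y') (N : Idx Φ) :
    ∃ (W : Idx Φ) (_ : W ≤ N) (hU : W ≤ U) (hV : W ≤ V) (hU' : W ≤ U') (hV' : W ≤ V')
      (f : famRes hU x ⟶ famRes hV y) (f' : famRes hU' x' ⟶ famRes hV' y'),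
      m = homMk hU hV f ∧ m' = homMk hU' hV' f' := by
  obtain ⟨W, hU, hV, hN, f, rfl⟩ := exists_homMk_le m N
  obtain ⟨M, hU', hV', h, f', rfl⟩ := exists_homMk_le m' W
  exact ⟨M, h.trans hN, h.trans hU, h.trans hV, hU', hV', homRes h f, f', (homMk_homRes h f).symm,
    rfl⟩

lemma homMk_inj {U V W : Idx Φ} {x : Fam Φ p U} {y : Fam Φ p V} {hU : W ≤ U}
    {hV : W ≤ V} {f g : famRes hU x ⟶ famRes hV y} (h : homMk hU hV f = homMk hU hV g) :
    ∃ (N : Idx Φ) (h : N ≤ W), homRes h f = homRes h g := by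
  obtain ⟨N, h₁, _, h⟩ := homMk_eq_iff.1 h
  exact ⟨N, h₁, h⟩

/-- Every arrow is, up to equality of objects, the class of an arrow of families. -/
lemma exists_ι_map {X Y : FCat Φ p} (m : X ⟶ Y) :
    ∃ (U : Idx Φ) (x y : Fam Φ p U) (f : x ⟶ y) (hX : (ι Φ p U).obj x = X)
      (hY : (ι Φ p U).obj y = Y), m = eqToHom hX.symm ≫ (ι Φ p U).map f ≫ eqToHom hY := by
  obtain ⟨U, x, rfl⟩ := exists_rep X
  obtain ⟨V, y, rfl⟩ := exists_rep Y
  obtain ⟨W, hU, hV, f, rfl⟩ := exists_homMk m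
  exact ⟨W, _, _, f, ι_famRes hU x, ι_famRes hV y, rfl⟩

lemma hom_ind {P : ∀ ⦃X Y : FCat Φ p⦄, (X ⟶ Y) → Prop}
    (h : ∀ (U : Idx Φ) (x y : Fam Φ p U) (f : x ⟶ y), P ((ι Φ p U).map f)) {X Y : FCat Φ p}
    (m : X ⟶ Y) : P m := by
  obtain ⟨U, x, y, f, rfl, rfl, rfl⟩ := exists_ι_map m
  simpa using h U x y f

lemma map_ι {G : F ⥤ F'} (hG : PreservesRestrictions p p' G) {U : Idx Φ} (x : Fam Φ p U) :
    (map Φ hG).obj ((ι Φ p U).obj x) = (ι Φ p' U).obj ((famMap Φ hG U).obj x) :=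
  Functor.congr_obj (ι_map Φ hG U) x

lemma map_ι_map {G : F ⥤ F'} (hG : PreservesRestrictions p p' G) {U : Idx Φ} {x y : Fam Φ p U}
    (f : x ⟶ y) : (map Φ hG).map ((ι Φ p U).map f) = eqToHom (map_ι hG x) ≫
      (ι Φ p' U).map ((famMap Φ hG U).map f) ≫ eqToHom (map_ι hG y).symm :=
  Functor.congr_hom (ι_map Φ hG U) f

/-- The image of an arrow between restrictions. -/
noncomputable def mapRes {G : F ⥤ F'} (hG : PreservesRestrictions p p' G) {U V W : Idx Φ}
    {x : Fam Φ p U} {y : Fam Φ p V} {hU : W ≤ U} {hV : W ≤ V} (f : famRes hU x ⟶ famRes hV y) :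
    famRes hU ((famMap Φ hG U).obj x) ⟶ famRes hV ((famMap Φ hG V).obj y) :=
  (famMap Φ hG W).map f

lemma eqToHom_conj_eq {D : Type*} [Category D] {X Y X₁ Y₁ X₂ Y₂ Z T : D} (a : X = X₁) (b : X₁ = Z)
    (f : Z ⟶ T) (c : T = Y₁) (d : Y₁ = Y) (a' : X = X₂) (b' : X₂ = Z) (c' : T = Y₂) (d' : Y₂ = Y) :
    eqToHom a ≫ (eqToHom b ≫ f ≫ eqToHom c) ≫ eqToHom d =
      eqToHom a' ≫ (eqToHom b' ≫ f ≫ eqToHom c') ≫ eqToHom d' := by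
  subst a b c d a' c'
  rfl

lemma map_homMk {G : F ⥤ F'} (hG : PreservesRestrictions p p' G) {U V W : Idx Φ}
    {x : Fam Φ p U} {y : Fam Φ p V} (hU : W ≤ U) (hV : W ≤ V) (f : famRes hU x ⟶ famRes hV y) :
    (map Φ hG).map (homMk hU hV f) = eqToHom (map_ι hG x) ≫ homMk hU hV (mapRes hG f) ≫
      eqToHom (map_ι hG y).symm := by
  unfold homMk
  rw [Functor.map_comp, Functor.map_comp, eqToHom_map, eqToHom_map, map_ι_map]
  exact eqToHom_conj_eq _ _ ((ι Φ p' W).map ((famMap Φ hG W).map f)) _ _ _ _ _ _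

lemma natTrans_app {G H : F ⥤ F'} (hG : PreservesRestrictions p p' G)
    (hH : PreservesRestrictions p p' H) (τ : G ⟶ H) {U : Idx Φ} (x : Fam Φ p U) :
    (natTrans Φ hG hH τ).app ((ι Φ p U).obj x) = eqToHom (map_ι hG x) ≫
      (ι Φ p' U).map ((famNat Φ hG hH τ U).app x) ≫ eqToHom (map_ι hH x).symm :=
  eq_eqToHom_of_arrow_mk_eq (natTrans_ι Φ hG hH τ U x) (map_ι hG x) (map_ι hH x)

lemma map_id (h : PreservesRestrictions p p (𝟭 F)) : map Φ h = 𝟭 _ :=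
  functor_ext Φ fun U => by
    rw [ι_map]
    rfl

lemma map_congr {G H : F ⥤ F'} (e : G = H) (hG : PreservesRestrictions p p' G)
    (hH : PreservesRestrictions p p' H) : map Φ hG = map Φ hH := by
  subst e
  rfl

end FCat

lemma isPullback_of_existsUnique {D : Type*} [Category D] {a b c d : D} {f : a ⟶ b} {g : a ⟶ c}
    {h : b ⟶ d} {k : c ⟶ d} (w : f ≫ h = g ≫ k)
    (H : ∀ ⦃z : D⦄ (s : z ⟶ b) (t : z ⟶ c), s ≫ h = t ≫ k → ∃ l : z ⟶ a, l ≫ f = s ∧ l ≫ g = t)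
    (H' : ∀ ⦃z : D⦄ (l l' : z ⟶ a), l ≫ f = l' ≫ f → l ≫ g = l' ≫ g → l = l') :
    IsPullback f g h k :=
  ⟨⟨w⟩, ⟨PullbackCone.IsLimit.mk _ (fun s => (H s.fst s.snd s.condition).choose)
    (fun s => (H s.fst s.snd s.condition).choose_spec.1)
    (fun s => (H s.fst s.snd s.condition).choose_spec.2)
    (fun s _ h₁ h₂ => H' _ _ (h₁.trans (H s.fst s.snd s.condition).choose_spec.1.symm)
      (h₂.trans (H s.fst s.snd s.condition).choose_spec.2.symm))⟩⟩

lemma fam_hom_ext {U : Idx Φ} {x y : Fam Φ p U} {f g : x ⟶ y}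
    (h : ∀ V, f.hom.app V = g.hom.app V) : f = g := by
  ext V
  exact h V

lemma fam_isPullback {U : Idx Φ} {a b c d : Fam Φ p U} {f : a ⟶ b} {g : a ⟶ c} {h : b ⟶ d}
    {k : c ⟶ d}
    (H : ∀ V, IsPullback (f.hom.app V) (g.hom.app V) (h.hom.app V) (k.hom.app V)) :
    IsPullback f g h k :=
  IsPullback.of_map_of_faithful (IsFam Φ p U).ι (IsPullback.of_forall_isPullback_app H)

lemma FCat.isPullback_ι_of_restrict {U : Idx Φ} {a b c d : Fam Φ p U} {f : a ⟶ b} {g : a ⟶ c}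
    {h : b ⟶ d} {k : c ⟶ d}
    (H : ∀ (N : Idx Φ) (hN : N ≤ U), IsPullback ((famRestrict Φ p hN).map f)
      ((famRestrict Φ p hN).map g) ((famRestrict Φ p hN).map h) ((famRestrict Φ p hN).map k)) :
    IsPullback ((ι Φ p U).map f) ((ι Φ p U).map g) ((ι Φ p U).map h) ((ι Φ p U).map k) := by
  refine isPullback_of_existsUnique ?_ (fun Z s t w => ?_) (fun Z l l' hf hg => ?_)
  · have := congrArg (ι Φ p U).map (H U le_rfl).w
    rw [← Functor.map_comp, ← Functor.map_comp]
    exact this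
  · obtain ⟨V, z, rfl⟩ := exists_rep Z
    obtain ⟨W, _, hV, hU, _, _, s', t', rfl, rfl⟩ := exists_homMk₂ s t U
    rw [← homMk_famRestrict hU h, ← homMk_famRestrict hU k, homMk_comp, homMk_comp] at w
    obtain ⟨N, hN, w⟩ := homMk_inj w
    obtain ⟨l, hl₁, hl₂⟩ := (H N (hN.trans hU)).exists_lift (homRes hN s') (homRes hN t') w
    refine ⟨homMk (hN.trans hV) (hN.trans hU) l, ?_, ?_⟩
    · rw [← homMk_famRestrict (hN.trans hU) f, homMk_comp, ← homMk_homRes hN s']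
      exact congrArg _ hl₁
    · rw [← homMk_famRestrict (hN.trans hU) g, homMk_comp, ← homMk_homRes hN t']
      exact congrArg _ hl₂
  · obtain ⟨V, z, rfl⟩ := exists_rep Z
    obtain ⟨W, _, hV, hU, _, _, m, m', rfl, rfl⟩ := exists_homMk₂ l l' U
    rw [← homMk_famRestrict hU, homMk_comp, homMk_comp] at hf hg
    obtain ⟨N, hN, hf⟩ := homMk_inj hf
    obtain ⟨N', hN', hg⟩ := homMk_inj hg
    obtain ⟨M, hM, hM'⟩ := Idx.exists_le N N'
    refine homMk_eq_iff.2 ⟨M, hM.trans hN, hM.trans hN, ?_⟩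
    refine (H M ((hM.trans hN).trans hU)).hom_ext ?_ ?_
    · exact congrArg (homRes hM) hf
    · exact congrArg (homRes hM') hg

/-- A square of families which is a pullback at each element of the filter gives a pullback. -/
lemma FCat.isPullback_ι {U : Idx Φ} {a b c d : Fam Φ p U} {f : a ⟶ b} {g : a ⟶ c} {h : b ⟶ d}
    {k : c ⟶ d}
    (H : ∀ V, IsPullback (f.hom.app V) (g.hom.app V) (h.hom.app V) (k.hom.app V)) :
    IsPullback ((ι Φ p U).map f) ((ι Φ p U).map g) ((ι Φ p U).map h) ((ι Φ p U).map k) :=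
  isPullback_ι_of_restrict fun _ hN => fam_isPullback fun V => H ((incl Φ hN).obj V)

variable (Φ p) in
/-- The projection of families to the base. -/
noncomputable abbrev famBase (U : Idx Φ) : Fam Φ p U ⥤ Fam Φ (𝟭 C) U :=
  famMap Φ (preservesRestrictions_base p) U

/-- An arrow of families whose components are Cartesian. -/
def IsCartesianFam {U : Idx Φ} {x y : Fam Φ p U} (φ : x ⟶ y) : Prop :=
  ∀ V, p.IsStronglyCartesian (p.map (φ.hom.app V)) (φ.hom.app V)

lemma IsCartesianFam.restrict {U V : Idx Φ} {x y : Fam Φ p U} {φ : x ⟶ y} (H : IsCartesianFam φ)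
    (h : V ≤ U) : IsCartesianFam ((famRestrict Φ p h).map φ) :=
  fun W => H ((incl Φ h).obj W)

lemma IsCartesianFam.existsUnique {U : Idx Φ} {x y z : Fam Φ p U} {φ : x ⟶ y}
    (H : IsCartesianFam φ) (g : (famBase Φ p U).obj z ⟶ (famBase Φ p U).obj x) (k : z ⟶ y)
    (w : (famBase Φ p U).map k = g ≫ (famBase Φ p U).map φ) :
    ∃! l : z ⟶ x, (famBase Φ p U).map l = g ∧ l ≫ φ = k := by
  obtain ⟨g', hg', ng'⟩ : ∃ g' : ∀ V, p.obj (z.obj.obj V) ⟶ p.obj (x.obj.obj V),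
      (∀ V, g' V = g.hom.app V) ∧ ∀ ⦃V W⦄ (e : V ⟶ W),
        p.map (z.obj.map e) ≫ g' W = g' V ≫ p.map (x.obj.map e) :=
    ⟨fun V => g.hom.app V, fun _ => rfl, fun _ _ e => g.hom.naturality e⟩
  have w' : ∀ V, p.map (k.hom.app V) = g' V ≫ p.map (φ.hom.app V) := fun V => by
    rw [hg']
    exact congrArg (fun e => e.hom.app V) w
  choose l hl hl' using fun V => exists_lift (H V) (g' V) (k.hom.app V) (w' V)
  have nat : ∀ ⦃V W⦄ (e : V ⟶ W), z.obj.map e ≫ l W = l V ≫ x.obj.map e := fun V W e => by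
    refine (exists_lift (H W) (p.map (z.obj.map e) ≫ g' W) (z.obj.map e ≫ k.hom.app W)
      ?_).unique ⟨?_, ?_⟩ ⟨?_, ?_⟩
    · rw [p.map_comp, Category.assoc, w']
    · rw [p.map_comp, (hl W).1]
    · rw [Category.assoc, (hl W).2]
    · rw [p.map_comp, (hl V).1, ng']
    · rw [Category.assoc, φ.hom.naturality, ← Category.assoc, (hl V).2, k.hom.naturality]
  refine ⟨ObjectProperty.homMk { app := l, naturality := nat }, ⟨?_, ?_⟩, fun m hm => ?_⟩
  · exact fam_hom_ext fun V => (hl V).1.trans (hg' V)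
  · exact fam_hom_ext fun V => (hl V).2
  · exact fam_hom_ext fun V => hl' V _ ⟨(congrArg (fun e => e.hom.app V) hm.1).trans (hg' V).symm,
      congrArg (fun e => e.hom.app V) hm.2⟩

lemma FCat.base_ι {U : Idx Φ} (x : Fam Φ p U) :
    (base Φ p).obj ((ι Φ p U).obj x) = (ι Φ (𝟭 C) U).obj ((famBase Φ p U).obj x) :=
  map_ι _ x

lemma FCat.base_homMk {U V W : Idx Φ} {x : Fam Φ p U} {y : Fam Φ p V} (hU : W ≤ U) (hV : W ≤ V)
    (f : famRes hU x ⟶ famRes hV y) :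
    (base Φ p).map (homMk hU hV f) = eqToHom (base_ι x) ≫
      homMk hU hV (mapRes (preservesRestrictions_base p) f) ≫ eqToHom (base_ι y).symm :=
  map_homMk _ hU hV f

lemma FCat.base_ι_map {U : Idx Φ} {x y : Fam Φ p U} (f : x ⟶ y) :
    (base Φ p).map ((ι Φ p U).map f) = eqToHom (base_ι x) ≫
      (ι Φ (𝟭 C) U).map ((famBase Φ p U).map f) ≫ eqToHom (base_ι y).symm :=
  map_ι_map _ f

lemma FCat.isStronglyCartesian_ι {U : Idx Φ} {x y : Fam Φ p U} {φ : x ⟶ y}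
    (H : IsCartesianFam φ) :
    (base Φ p).IsStronglyCartesian ((base Φ p).map ((ι Φ p U).map φ)) ((ι Φ p U).map φ) := by
  refine isStronglyCartesian_of fun {Z} g k w => ?_
  obtain ⟨V, z, rfl⟩ := exists_rep Z
  obtain ⟨g', rfl⟩ : ∃ g', g = eqToHom (base_ι z) ≫ g' ≫ eqToHom (base_ι x).symm :=
    ⟨eqToHom (base_ι z).symm ≫ g ≫ eqToHom (base_ι x), by simp⟩
  obtain ⟨W, _, hV, hU, _, _, g'', k', rfl, rfl⟩ := exists_homMk₂ g' k U
  rw [base_homMk, ← homMk_famRestrict hU φ, base_homMk] at w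
  simp only [Category.assoc, eqToHom_trans_assoc, eqToHom_refl, Category.id_comp, cancel_epi] at w
  rw [← Category.assoc (homMk _ _ _), homMk_comp, cancel_mono] at w
  obtain ⟨N, hN, w⟩ := homMk_inj w
  have hc := H.restrict (hN.trans hU)
  obtain ⟨l, ⟨hl₁, hl₂⟩, -⟩ := hc.existsUnique (z := famRes (hN.trans hV) z) (homRes hN g'') (homRes hN k') w
  have hl₁' : mapRes (preservesRestrictions_base p) l = homRes hN g'' := hl₁
  refine ⟨homMk (hN.trans hV) (hN.trans hU) l, ⟨?_, ?_⟩, fun m hm => ?_⟩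
  · rw [base_homMk, ← homMk_homRes hN g'']
    exact congrArg (fun t => eqToHom (base_ι z) ≫ homMk (hN.trans hV) (hN.trans hU) t ≫
      eqToHom (base_ι x).symm) hl₁
  · rw [← homMk_famRestrict (hN.trans hU) φ, homMk_comp, ← homMk_homRes hN k']
    exact congrArg _ hl₂
  · obtain ⟨M, hM₁, hM₂, hM, m, rfl⟩ := exists_homMk_le m N
    obtain ⟨hm₁, hm₂⟩ := hm
    rw [base_homMk, cancel_epi, cancel_mono] at hm₁
    rw [← homMk_famRestrict hM₂ φ, homMk_comp] at hm₂
    obtain ⟨K, a, b, hm₁⟩ := homMk_eq_iff.1 hm₁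
    obtain ⟨K', a', b', hm₂⟩ := homMk_eq_iff.1 hm₂
    obtain ⟨L, c, c'⟩ := Idx.exists_le K K'
    refine homMk_eq_iff.2 ⟨L, c.trans a, (c.trans a).trans hM, ?_⟩
    refine ((H.restrict ((c.trans a).trans hM₂)).existsUnique
      (z := famRes ((c.trans a).trans hM₁) z) (homRes (c.trans b) g'') (homRes (c'.trans b') k') ?_).unique ⟨?_, ?_⟩ ⟨?_, ?_⟩
    · exact congrArg (homRes ((c.trans a).trans hM)) w
    · exact congrArg (homRes c) hm₁
    · exact congrArg (homRes c') hm₂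
    · exact congrArg (homRes ((c.trans a).trans hM)) hl₁'
    · exact congrArg (homRes ((c.trans a).trans hM)) hl₂

end Interface

section Fibred

lemma isStronglyCartesian_of_isHomLift {F X : Type*} [Category F] [Category X] {p : F ⥤ X}
    {R S : X} {a b : F} (g : R ⟶ S) {φ : a ⟶ b} (h : p.IsStronglyCartesian (p.map φ) φ)
    (hg : p.IsHomLift g φ) : p.IsStronglyCartesian g φ := by
  subst_hom_lift p g φ
  exact h

lemma isStronglyCartesian_map {F X : Type*} [Category F] [Category X] {p : F ⥤ X}
    {R S : X} {a b : F} {g : R ⟶ S} {φ : a ⟶ b} (h : p.IsStronglyCartesian g φ) :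
    p.IsStronglyCartesian (p.map φ) φ := by
  have := h.toIsHomLift
  subst_hom_lift p g φ
  exact h

lemma isStronglyCartesian_of_iso {F X : Type*} [Category F] [Category X] {p : F ⥤ X}
    {a b : F} (φ : a ⟶ b) [IsIso φ] : p.IsStronglyCartesian (p.map φ) φ := inferInstance

lemma isStronglyCartesian_comp {F X : Type*} [Category F] [Category X] {p : F ⥤ X}
    {a b c : F} {φ : a ⟶ b} {ψ : b ⟶ c} (hφ : p.IsStronglyCartesian (p.map φ) φ)
    (hψ : p.IsStronglyCartesian (p.map ψ) ψ) : p.IsStronglyCartesian (p.map (φ ≫ ψ)) (φ ≫ ψ) := by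
  rw [p.map_comp]
  infer_instance

lemma isStronglyCartesian_of_comp {F X : Type*} [Category F] [Category X] {p : F ⥤ X}
    {a b c : F} {φ : a ⟶ b} {ψ : b ⟶ c} (h : p.IsStronglyCartesian (p.map (φ ≫ ψ)) (φ ≫ ψ))
    (hψ : p.IsStronglyCartesian (p.map ψ) ψ) : p.IsStronglyCartesian (p.map φ) φ := by
  rw [p.map_comp] at h
  exact Functor.IsStronglyCartesian.of_comp p (g := p.map ψ) (ψ := ψ)

lemma map_eqToHom_comp {D E : Type*} [Category D] [Category E] (K : D ⥤ E) {X Y Z : D} (h : X = Y)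
    (f : Y ⟶ Z) : K.map (eqToHom h ≫ f) = eqToHom (congrArg K.obj h) ≫ K.map f := by
  rw [K.map_comp, eqToHom_map]

lemma eqToHom_conj_comp {D : Type*} [Category D] {X X₁ Y Y₁ Z T : D} (a : X = X₁) (b : X₁ = Z)
    (f : Z ⟶ T) (c : T = Y₁) (d : Y₁ = Y) (a' : X = Z) (c' : T = Y) :
    eqToHom a ≫ ((eqToHom b ≫ f) ≫ eqToHom c) ≫ eqToHom d = eqToHom a' ≫ f ≫ eqToHom c' := by
  subst a b c d
  simp

variable {C : Type (max u v)} [Category.{v} C] [HasFiniteProducts C]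
variable {Φ : Order.PFilter (Subobject (⊤_ C))}
variable {F : Type (max u v)} [Category.{v} F] {p : F ⥤ C}

lemma isRestriction_of_isStronglyCartesian {W : Subobject (⊤_ C)} {R S : C} {f : R ⟶ S}
    {q : R ⟶ (W : C)} (hq : IsLimit (BinaryFan.mk f q)) {a b : F} {ψ : a ⟶ b}
    (h : p.IsStronglyCartesian f ψ) : IsRestriction p W ψ := by
  have := h.toIsHomLift
  subst_hom_lift p f ψ
  exact ⟨h, q, ⟨hq⟩⟩

lemma fam_ext {U : Idx Φ} {x y : Fam Φ p U} (h : x.obj = y.obj) : x = y := by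
  cases x
  cases y
  cases h
  rfl

lemma fam_eqToHom_app {U : Idx Φ} {x y : Fam Φ p U} (h : x = y) (V : Set.Iic U) :
    (eqToHom h).hom.app V = eqToHom (congrArg (fun z : Fam Φ p U => z.obj.obj V) h) := by
  subst h
  rfl

/-- Cartesian lifts of families. -/
lemma exists_isCartesianFam [p.IsFibered] {U : Idx Φ} (y : Fam Φ p U) (b : Fam Φ (𝟭 C) U)
    (f : b ⟶ (famBase Φ p U).obj y) :
    ∃ (x : Fam Φ p U) (φ : x ⟶ y), IsCartesianFam φ ∧ (famBase Φ p U).IsHomLift f φ := by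
  obtain ⟨f', hf', nf'⟩ : ∃ f' : ∀ V, b.obj.obj V ⟶ p.obj (y.obj.obj V),
      (∀ V, f' V = f.hom.app V) ∧ ∀ ⦃V W⦄ (e : V ⟶ W),
        b.obj.map e ≫ f' W = f' V ≫ p.map (y.obj.map e) :=
    ⟨fun V => f.hom.app V, fun _ => rfl, fun _ _ e => f.hom.naturality e⟩
  let x := fun V => Functor.IsPreFibered.pullbackObj (p := p) rfl (f' V)
  let φ : ∀ V, x V ⟶ y.obj.obj V := fun V => Functor.IsPreFibered.pullbackMap rfl (f' V)
  have hφ : ∀ V, p.IsStronglyCartesian (f' V) (φ V) := fun V => inferInstance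
  have hl : ∀ ⦃V W⦄ (e : V ⟶ W), ∃! l : x V ⟶ x W, p.IsHomLift (b.obj.map e) l ∧
      l ≫ φ W = φ V ≫ y.obj.map e := fun V W e => by
    have : p.IsHomLift (b.obj.map e ≫ f' W) (φ V ≫ y.obj.map e) := by
      rw [nf' e]
      infer_instance
    exact Functor.IsStronglyCartesian.universal_property p (f' W) (φ W) (b.obj.map e) _ rfl _
  choose l hl₁ hl₂ using hl
  let X : Set.Iic U ⥤ F :=
    { obj := x
      map := fun e => l e
      map_id := fun V => ((hl₂ (𝟙 V) (𝟙 (x V))) ⟨by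
        have := (hφ V).toIsHomLift
        rw [CategoryTheory.Functor.map_id]
        exact IsHomLift.id (IsHomLift.domain_eq p (f' V) (φ V)), by simp⟩).symm
      map_comp := fun {V W N} e e' => ((hl₂ (e ≫ e') (l e ≫ l e')) ⟨by
        have := (hl₁ e).1
        have := (hl₁ e').1
        rw [Functor.map_comp]
        infer_instance, by
          rw [Category.assoc, (hl₁ e').2, ← Category.assoc, (hl₁ e).2, Functor.map_comp,
            Category.assoc]⟩).symm }
  have hX : ∀ ⦃V W⦄ (e : V ⟶ W), p.IsStronglyCartesian (b.obj.map e) (l e) := fun V W e => by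
    have h₁ := (hl₁ e).1
    have h₂ : p.IsStronglyCartesian (p.map (φ V ≫ y.obj.map e)) (φ V ≫ y.obj.map e) :=
      isStronglyCartesian_comp (isStronglyCartesian_map (hφ V)) (y.property e).1
    rw [← (hl₁ e).2] at h₂
    exact isStronglyCartesian_of_isHomLift _
      (isStronglyCartesian_of_comp h₂ (isStronglyCartesian_map (hφ W))) h₁
  have hfam : IsFam Φ p U X := fun W V e => by
    obtain ⟨-, q, ⟨hq⟩⟩ := b.property e
    exact isRestriction_of_isStronglyCartesian hq (hX e)
  have hb : (famBase Φ p U).obj ⟨X, hfam⟩ = b := by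
    refine fam_ext ?_
    refine CategoryTheory.Functor.ext (fun V => ?_) (fun V W e => ?_)
    · exact IsHomLift.domain_eq p (f' V) (φ V)
    · have := (hl₁ e).1
      exact IsHomLift.fac' p (b.obj.map e) (l e)
  refine ⟨⟨X, hfam⟩, ObjectProperty.homMk { app := φ, naturality := fun V W e => (hl₁ e).2 },
    fun V => isStronglyCartesian_map (hφ V), ?_⟩
  refine IsHomLift.of_fac' _ _ _ hb rfl ?_
  refine fam_hom_ext fun V => ?_
  change p.map (φ V) = (eqToHom hb).hom.app V ≫ f.hom.app V ≫ 𝟙 _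
  rw [fam_eqToHom_app, Category.comp_id, ← hf' V]
  have := IsHomLift.fac' p (f' V) (φ V)
  rw [eqToHom_refl, Category.comp_id] at this
  exact this

namespace FCat

instance base_isFibered [p.IsFibered] : (base Φ p).IsFibered := by
  refine .of_exists_isStronglyCartesian fun Y R g => ?_
  obtain ⟨U, y, rfl⟩ := exists_rep Y
  obtain ⟨V, r, rfl⟩ := exists_rep R
  obtain ⟨g, rfl⟩ : ∃ g', g = g' ≫ eqToHom (base_ι y).symm := ⟨g ≫ eqToHom (base_ι y), by simp⟩
  obtain ⟨W, hV, hU, f, rfl⟩ := exists_homMk g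
  obtain ⟨x, φ, hφ, hφ'⟩ := exists_isCartesianFam (famRes hU y) (famRes hV r) f
  have e : (famBase Φ p W).obj x = famRes hV r :=
    @IsHomLift.domain_eq _ _ _ _ (famBase Φ p W) _ _ _ _ f φ hφ'
  have h : (base Φ p).IsHomLift (homMk hV hU f ≫ eqToHom (base_ι y).symm)
      ((ι Φ p W).map φ ≫ eqToHom (ι_famRes hU y)) := by
    have h' : (famBase Φ p W).map φ = eqToHom e ≫ f :=
      (@IsHomLift.fac' _ _ _ _ (famBase Φ p W) _ _ _ _ f φ hφ').trans
        (congrArg (eqToHom e ≫ ·) (Category.comp_id f))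
    have h'' : (ι Φ (𝟭 C) W).map ((famBase Φ p W).map φ) =
        eqToHom (congrArg _ e) ≫ (ι Φ (𝟭 C) W).map f :=
      (congrArg _ h').trans (map_eqToHom_comp (ι Φ (𝟭 C) W) e f)
    refine IsHomLift.of_fac' _ _ _ ((base_ι x).trans ((congrArg _ e).trans (ι_famRes hV r))) rfl ?_
    rw [Functor.map_comp, base_ι_map, h'', eqToHom_map]
    simp only [homMk, Category.assoc, eqToHom_trans, eqToHom_trans_assoc]
    exact eqToHom_conj_comp _ _ ((ι Φ (𝟭 C) W).map f) _ _ _ _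
  exact ⟨_, _, isStronglyCartesian_of_isHomLift _ (isStronglyCartesian_comp
    (isStronglyCartesian_ι hφ) (isStronglyCartesian_of_iso _)) h⟩

lemma exists_isIso_of_isIso_ι {U : Idx Φ} {x y : Fam Φ p U} (f : x ⟶ y)
    [h : IsIso ((ι Φ p U).map f)] : ∃ (V : Idx Φ) (hV : V ≤ U), IsIso ((famRestrict Φ p hV).map f) := by
  obtain ⟨V, hV, _, g, hg⟩ := exists_homMk (inv ((ι Φ p U).map f))
  have h₁ := IsIso.hom_inv_id ((ι Φ p U).map f)
  have h₂ := IsIso.inv_hom_id ((ι Φ p U).map f)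
  rw [hg, ← homMk_famRestrict hV f, homMk_comp, ← homMk_id hV] at h₁ h₂
  obtain ⟨N, hN, h₁⟩ := homMk_inj h₁
  obtain ⟨N', hN', h₂⟩ := homMk_inj h₂
  obtain ⟨M, a, b⟩ := Idx.exists_le N N'
  refine ⟨M, (a.trans hN).trans hV, homRes (a.trans hN) g, ?_, ?_⟩
  · exact congrArg (homRes a) h₁
  · exact congrArg (homRes b) h₂

/-- Cartesian arrows are represented by families of Cartesian arrows. -/
lemma exists_isCartesianFam_homMk [p.IsFibered] {U V : Idx Φ} {x : Fam Φ p U} {y : Fam Φ p V}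
    (m : (ι Φ p U).obj x ⟶ (ι Φ p V).obj y)
    (hm : (base Φ p).IsStronglyCartesian ((base Φ p).map m) m) :
    ∃ (W : Idx Φ) (hU : W ≤ U) (hV : W ≤ V) (f : famRes hU x ⟶ famRes hV y),
      IsCartesianFam f ∧ m = homMk hU hV f := by
  obtain ⟨W, hU, hV, f, rfl⟩ := exists_homMk m
  obtain ⟨x', φ, hφ, hφ'⟩ := exists_isCartesianFam (famRes hV y) _ ((famBase Φ p W).map f)
  have e := IsHomLift.domain_eq (famBase Φ p W) ((famBase Φ p W).map f) φ
  have e' := IsHomLift.fac (famBase Φ p W) ((famBase Φ p W).map f) φ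
  rw [eqToHom_refl, Category.comp_id] at e'
  obtain ⟨l, ⟨hl₁, hl₂⟩, -⟩ := hφ.existsUnique (eqToHom e.symm) f e'
  have hf : (base Φ p).IsStronglyCartesian ((base Φ p).map ((ι Φ p W).map f)) ((ι Φ p W).map f) := by
    have : (ι Φ p W).map f = eqToHom (ι_famRes hU x) ≫ homMk hU hV f ≫
        eqToHom (ι_famRes hV y).symm := by simp [homMk]
    rw [this]
    exact isStronglyCartesian_comp (isStronglyCartesian_of_iso _)
      (isStronglyCartesian_comp hm (isStronglyCartesian_of_iso _))
  rw [← hl₂, Functor.map_comp] at hf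
  have hl := isStronglyCartesian_of_comp hf (isStronglyCartesian_ι hφ)
  have : IsIso ((base Φ p).map ((ι Φ p W).map l)) := by
    rw [base_ι_map, hl₁, eqToHom_map, eqToHom_trans, eqToHom_trans]
    infer_instance
  have : IsIso ((ι Φ p W).map l) :=
    Functor.IsStronglyCartesian.isIso_of_base_isIso (base Φ p) ((base Φ p).map ((ι Φ p W).map l)) _
  obtain ⟨N, hN, h⟩ := exists_isIso_of_isIso_ι l
  refine ⟨N, hN.trans hU, hN.trans hV, homRes hN f, ?_, (homMk_homRes hN f).symm⟩
  rw [← hl₂]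
  intro M
  refine isStronglyCartesian_comp ?_ (hφ.restrict hN M)
  have : IsIso (((famRestrict Φ p hN).map l).hom.app M) :=
    inferInstanceAs (IsIso (((IsFam Φ p N).ι ⋙ (evaluation _ _).obj M).map
      ((famRestrict Φ p hN).map l)))
  exact isStronglyCartesian_of_iso (((famRestrict Φ p hN).map l).hom.app M)

lemma cartesian_ind [p.IsFibered] {P : ∀ ⦃X Y : FCat Φ p⦄, (X ⟶ Y) → Prop}
    (h : ∀ (U : Idx Φ) (x y : Fam Φ p U) (f : x ⟶ y), IsCartesianFam f → P ((ι Φ p U).map f))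
    {X Y : FCat Φ p} (m : X ⟶ Y) (hm : (base Φ p).IsStronglyCartesian ((base Φ p).map m) m) :
    P m := by
  obtain ⟨U, x, rfl⟩ := exists_rep X
  obtain ⟨V, y, rfl⟩ := exists_rep Y
  obtain ⟨W, hU, hV, f, hf, rfl⟩ := exists_isCartesianFam_homMk m hm
  have key : ∀ {X' Y'} (a : X' = (ι Φ p W).obj (famRes hU x))
      (b : (ι Φ p W).obj (famRes hV y) = Y'), P (eqToHom a ≫ (ι Φ p W).map f ≫ eqToHom b) := by
    intro X' Y' a b
    subst a b
    simpa using h W _ _ f hf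
  exact key _ _

end FCat

end Fibred

section Equivalence

variable {C : Type (max u v)} [Category.{v} C] [HasFiniteProducts C]
variable (Φ : Order.PFilter (Subobject (⊤_ C)))

/-- The largest element of the filter. -/
noncomputable def Idx.top : Idx Φ := ⟨⊤, Order.PFilter.top_mem⟩

variable {Φ} in
lemma Idx.le_top (U : Idx Φ) : U ≤ Idx.top Φ := _root_.le_top (a := (U : Subobject (⊤_ C)))

variable {Φ} in
lemma Idx.coe_le {U : Idx Φ} (W : Set.Iic U) : W.1.1 ≤ U.1 := W.2

variable {Φ} in
lemma Idx.coe_le_coe {U : Idx Φ} {W V : Set.Iic U} (h : W ⟶ V) : W.1.1 ≤ V.1.1 := h.le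

namespace FilterQuotient

lemma res_comp (X : C) {W V U : Subobject (⊤_ C)} (h : W ≤ V) (k : V ≤ U) :
    res X h ≫ res X k = res X (h.trans k) := hom_ext (by simp)

lemma res_comp_assoc (X : C) {Z : C} {W V U : Subobject (⊤_ C)} (h : W ≤ V) (k : V ≤ U)
    (f : X ⨯ (U : C) ⟶ Z) : res X h ≫ res X k ≫ f = res X (h.trans k) ≫ f := by
  rw [← Category.assoc, res_comp]

lemma res_refl (X : C) {U : Subobject (⊤_ C)} (h : U ≤ U) : res X h = 𝟙 _ := hom_ext (by simp)

/-- The product projection `X × W ⟶ X × V` is a product projection for `W`. -/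
noncomputable def resIsLimit (X : C) {W V : Subobject (⊤_ C)} (h : W ≤ V) :
    IsLimit (BinaryFan.mk (res X h) (prod.snd : X ⨯ (W : C) ⟶ (W : C))) :=
  BinaryFan.IsLimit.mk _ (fun s t => prod.lift (s ≫ prod.fst) t)
    (fun s t => hom_ext (by
      refine (Category.assoc _ _ _).trans ?_
      exact (congrArg _ (res_fst X h)).trans (prod.lift_fst _ _)))
    (fun s t => hom_eq _ _)
    (fun s t m h₁ _ => hom_ext (U := W) (X := X) (by
      refine Eq.trans ?_ (prod.lift_fst _ _).symm
      rw [← h₁]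
      exact ((Category.assoc _ _ _).trans (congrArg _ (res_fst X h))).symm))

/-- The arrow `X × W ⟶ Y × W` given by an arrow `X × U ⟶ Y`, for `W ≤ U`. -/
noncomputable def prodHom {X Y : C} {W U : Subobject (⊤_ C)} (h : W ≤ U) (f : X ⨯ (U : C) ⟶ Y) :
    X ⨯ (W : C) ⟶ Y ⨯ (W : C) :=
  prod.lift (res X h ≫ f) prod.snd

@[simp]
lemma prodHom_fst {X Y : C} {W U : Subobject (⊤_ C)} (h : W ≤ U) (f : X ⨯ (U : C) ⟶ Y) :
    prodHom h f ≫ prod.fst = res X h ≫ f := prod.lift_fst _ _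

lemma res_prodHom {X Y : C} {V W U : Subobject (⊤_ C)} (k : V ≤ W) (h : W ≤ U)
    (f : X ⨯ (U : C) ⟶ Y) : res X k ≫ prodHom h f = prodHom (k.trans h) f ≫ res Y k :=
  hom_ext (by
    rw [Category.assoc, Category.assoc, res_fst, prodHom_fst, prodHom_fst, res_comp_assoc])

lemma prodHom_res {X Y : C} {W U V : Subobject (⊤_ C)} (h : W ≤ V) (k : V ≤ U)
    (f : X ⨯ (U : C) ⟶ Y) : prodHom h (res X k ≫ f) = prodHom (h.trans k) f := by
  unfold prodHom
  rw [res_comp_assoc]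

lemma prodHom_comp {X Y Z : C} {W U : Subobject (⊤_ C)} (h : W ≤ U) (f : X ⨯ (U : C) ⟶ Y)
    (g : Y ⨯ (U : C) ⟶ Z) :
    prodHom h f ≫ prodHom h g = prodHom h (compOn f g le_rfl le_rfl) := by
  refine hom_ext ?_
  rw [Category.assoc, prodHom_fst, prodHom_fst, compOn, ← Category.assoc, ← Category.assoc]
  congr 1
  refine hom_ext ?_
  rw [Category.assoc, Category.assoc, res_fst, prod.lift_fst, prodHom_fst, res_comp_assoc]

variable {Φ} in
/-- The family of the products `X × W`. -/
noncomputable def prodFam (Φ : Order.PFilter (Subobject (⊤_ C))) (X : C) :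
    Fam Φ (𝟭 C) (Idx.top Φ) where
  obj :=
    { obj := fun W => X ⨯ (W.1.1 : C)
      map := fun h => res X (Idx.coe_le_coe h)
      map_id := fun _ => res_refl _ _
      map_comp := fun _ _ => (res_comp _ _ _).symm }
  property _ _ h := ⟨isStronglyCartesian_id _, prod.snd, ⟨resIsLimit X (Idx.coe_le_coe h)⟩⟩

/-- The family of arrows `X × W ⟶ Y × W` given by an arrow `X × U ⟶ Y`. -/
noncomputable def famHom {X Y : C} {U : Idx Φ} (f : X ⨯ (U.1 : C) ⟶ Y) :
    famRes U.le_top (prodFam Φ X) ⟶ famRes U.le_top (prodFam Φ Y) :=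
  ObjectProperty.homMk
    { app := fun W => prodHom (Idx.coe_le W) f
      naturality := fun _ _ h => res_prodHom (Idx.coe_le_coe h) _ f }

lemma homRes_famHom {X Y : C} {U V : Idx Φ} (h : V ≤ U) (f : X ⨯ (U.1 : C) ⟶ Y) :
    homRes h (famHom Φ f) = famHom Φ (res X (V := V.1) (U := U.1) h ≫ f) :=
  fam_hom_ext fun W => (prodHom_res (Idx.coe_le W) (V := V.1) (U := U.1) h f).symm

lemma famHom_comp {X Y Z : C} {U : Idx Φ} (f : X ⨯ (U.1 : C) ⟶ Y) (g : Y ⨯ (U.1 : C) ⟶ Z) :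
    famHom Φ f ≫ famHom Φ g = famHom Φ (compOn f g le_rfl le_rfl) :=
  fam_hom_ext fun _ => prodHom_comp _ _ _

lemma famHom_surjective {X Y : C} {U : Idx Φ}
    (g : famRes U.le_top (prodFam Φ X) ⟶ famRes U.le_top (prodFam Φ Y)) :
    ∃ f, famHom Φ f = g := by
  obtain ⟨g', hg', ng'⟩ : ∃ g' : ∀ W : Set.Iic U, X ⨯ (W.1.1 : C) ⟶ Y ⨯ (W.1.1 : C),
      (∀ W, g' W = g.hom.app W) ∧ ∀ ⦃W V : Set.Iic U⦄ (h : W ⟶ V),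
        res X (Idx.coe_le_coe h) ≫ g' V = g' W ≫ res Y (Idx.coe_le_coe h) :=
    ⟨fun W => g.hom.app W, fun _ => rfl, fun _ _ h => g.hom.naturality h⟩
  refine ⟨g' (Idx.self Φ U) ≫ prod.fst, fam_hom_ext fun W => ?_⟩
  rw [← hg' W]
  have h := congrArg (· ≫ prod.fst) (ng' (homOfLE (show W ≤ Idx.self Φ U from W.2)))
  simp only [Category.assoc, res_fst] at h
  exact hom_ext ((prodHom_fst _ _).trans h)

lemma famHom_injective {X Y : C} {U : Idx Φ} {f g : X ⨯ (U.1 : C) ⟶ Y}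
    (h : famHom Φ f = famHom Φ g) : f = g := by
  have h' : prodHom (le_refl U.1) f = prodHom (le_refl U.1) g :=
    congrArg (fun k => k.hom.app (Idx.self Φ U)) h
  have := congrArg (· ≫ prod.fst) h'
  simp only [prodHom_fst] at this
  rwa [res_refl, Category.id_comp, Category.id_comp] at this

/-- The comparison functor on arrows. -/
noncomputable def toBaseMap {X Y : FilterQuotient Φ} (f : X ⟶ Y) :
    (FCat.ι Φ (𝟭 C) (Idx.top Φ)).obj (prodFam Φ X.as) ⟶
      (FCat.ι Φ (𝟭 C) (Idx.top Φ)).obj (prodFam Φ Y.as) :=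
  Quotient.lift (s := homSetoid Φ X.as Y.as)
    (fun f => FCat.homMk (Idx.le_top f.1) (Idx.le_top f.1) (famHom Φ (U := f.1) f.2)) (by
      rintro ⟨U, f⟩ ⟨V, g⟩ ⟨W, hW, h₁, h₂, h⟩
      refine FCat.homMk_eq_iff.2 ⟨⟨W, hW⟩, h₁, h₂, ?_⟩
      rw [homRes_famHom, homRes_famHom]
      exact congrArg _ h) f

/-- The class of a partial map. -/
def homMk {X Y : FilterQuotient Φ} (U : Idx Φ) (f : X.as ⨯ (U.1 : C) ⟶ Y.as) : X ⟶ Y :=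
  Quotient.mk (homSetoid Φ X.as Y.as) ⟨U, f⟩

variable {Φ} in
lemma exists_homMk {X Y : FilterQuotient Φ} (f : X ⟶ Y) : ∃ U g, f = homMk Φ U g := by
  induction f using Quotient.inductionOn with | _ f
  exact ⟨f.1, f.2, rfl⟩

lemma homMk_res {X Y : FilterQuotient Φ} {U V : Idx Φ} (h : V ≤ U) (f : X.as ⨯ (U.1 : C) ⟶ Y.as) :
    homMk Φ V (res X.as (V := V.1) (U := U.1) h ≫ f) = homMk Φ U f :=
  Quotient.sound ⟨V.1, V.2, le_rfl, h, by rw [res_refl, Category.id_comp]⟩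

lemma homMk_comp {X Y Z : FilterQuotient Φ} (U : Idx Φ) (f : X.as ⨯ (U.1 : C) ⟶ Y.as)
    (g : Y.as ⨯ (U.1 : C) ⟶ Z.as) :
    homMk Φ U f ≫ homMk Φ U g = homMk Φ U (compOn f g le_rfl le_rfl) :=
  Quotient.sound ⟨_, (meet Φ U U).2, le_rfl, meet_le_left Φ U U, by
    rw [res_refl, Category.id_comp, res_compOn]⟩

lemma toBaseMap_homMk {X Y : FilterQuotient Φ} (U : Idx Φ) (f : X.as ⨯ (U.1 : C) ⟶ Y.as) :
    toBaseMap Φ (homMk Φ U f) = FCat.homMk U.le_top U.le_top (famHom Φ f) := rfl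

/-- The comparison functor from the filter quotient to the filtered colimit, given by the families
of the products `X × W`. -/
noncomputable def toBase : FilterQuotient Φ ⥤ BaseCat Φ where
  obj X := (FCat.ι Φ (𝟭 C) (Idx.top Φ)).obj (prodFam Φ X.as)
  map f := toBaseMap Φ f
  map_id X := by
    change toBaseMap Φ (homMk Φ (Idx.top Φ) prod.fst) = _
    rw [toBaseMap_homMk, ← FCat.homMk_id (Idx.top Φ).le_top]
    refine congrArg _ (fam_hom_ext fun W => hom_ext ?_)
    exact (prodHom_fst _ _).trans ((res_fst _ _).trans (Category.id_comp _).symm)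
  map_comp f g := by
    obtain ⟨U, f, rfl⟩ := exists_homMk f
    obtain ⟨V, g, rfl⟩ := exists_homMk g
    obtain ⟨W, hU, hV⟩ := Idx.exists_le U V
    rw [← homMk_res Φ hU f, ← homMk_res Φ hV g, homMk_comp, toBaseMap_homMk, toBaseMap_homMk,
      toBaseMap_homMk, FCat.homMk_comp, famHom_comp]

lemma toBase_map_homMk {X Y : FilterQuotient Φ} (U : Idx Φ) (f : X.as ⨯ (U.1 : C) ⟶ Y.as) :
    (toBase Φ).map (homMk Φ U f) = FCat.homMk U.le_top U.le_top (famHom Φ f) := rfl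

instance : (toBase Φ).Full where
  map_surjective {X Y} m := by
    obtain ⟨W, hU, hV, g, rfl⟩ := FCat.exists_homMk m
    obtain ⟨f, rfl⟩ := famHom_surjective Φ g
    exact ⟨homMk Φ W f, toBase_map_homMk Φ W f⟩

instance : (toBase Φ).Faithful where
  map_injective {X Y f g} h := by
    obtain ⟨U, f, rfl⟩ := exists_homMk f
    obtain ⟨V, g, rfl⟩ := exists_homMk g
    rw [toBase_map_homMk, toBase_map_homMk] at h
    obtain ⟨W, hU, hV, h⟩ := FCat.homMk_eq_iff.1 h
    rw [homRes_famHom, homRes_famHom] at h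
    have := famHom_injective Φ h
    rw [← homMk_res Φ hU f, ← homMk_res Φ hV g, this]

variable {Φ} in
/-- The arrow from a member of a family to the largest member. -/
noncomputable abbrev toSelf {U : Idx Φ} (x : Fam Φ (𝟭 C) U) (W : Set.Iic U) :
    x.obj.obj W ⟶ x.obj.obj (Idx.self Φ U) :=
  x.obj.map (homOfLE (show W ≤ Idx.self Φ U from W.2))

lemma exists_iso_prod {U : Idx Φ} (x : Fam Φ (𝟭 C) U) (W : Set.Iic U) :
    ∃ e : x.obj.obj W ≅ x.obj.obj (Idx.self Φ U) ⨯ (W.1.1 : C), e.hom ≫ prod.fst = toSelf x W := by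
  obtain ⟨-, q, ⟨hq⟩⟩ := x.property (homOfLE (show W ≤ Idx.self Φ U from W.2))
  exact ⟨hq.conePointUniqueUpToIso (limit.isLimit _),
    IsLimit.conePointUniqueUpToIso_hom_comp hq
      (limit.isLimit _) ⟨WalkingPair.left⟩⟩

/-- The isomorphism of a member of a family with a product. -/
noncomputable def isoProd {U : Idx Φ} (x : Fam Φ (𝟭 C) U) (W : Set.Iic U) :
    x.obj.obj W ≅ x.obj.obj (Idx.self Φ U) ⨯ (W.1.1 : C) := (exists_iso_prod Φ x W).choose

lemma isoProd_fst {U : Idx Φ} (x : Fam Φ (𝟭 C) U) (W : Set.Iic U) :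
    (isoProd Φ x W).hom ≫ prod.fst = toSelf x W := (exists_iso_prod Φ x W).choose_spec

lemma isoProd_naturality {U : Idx Φ} (x : Fam Φ (𝟭 C) U) {W V : Set.Iic U} (h : W ⟶ V) :
    x.obj.map h ≫ (isoProd Φ x V).hom = (isoProd Φ x W).hom ≫ res _ (Idx.coe_le_coe h) := by
  refine hom_ext ?_
  rw [Category.assoc, Category.assoc, res_fst, isoProd_fst, isoProd_fst, ← Functor.map_comp]
  rfl

lemma isoProd_prodHom {U : Idx Φ} {x y : Fam Φ (𝟭 C) U} (f : x ⟶ y) (W : Set.Iic U) :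
    f.hom.app W ≫ (isoProd Φ y W).hom = (isoProd Φ x W).hom ≫
      prodHom (Idx.coe_le W) (prod.fst ≫ f.hom.app (Idx.self Φ U)) := by
  refine hom_ext ?_
  rw [Category.assoc, Category.assoc, prodHom_fst, isoProd_fst, ← Category.assoc (res _ _),
    res_fst, ← Category.assoc, isoProd_fst]
  exact (f.hom.naturality _).symm

/-- A family is isomorphic to the family of products with its largest member. -/
noncomputable def famIsoProd {U : Idx Φ} (x : Fam Φ (𝟭 C) U) :
    x ≅ famRes U.le_top (prodFam Φ (x.obj.obj (Idx.self Φ U))) :=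
  ObjectProperty.isoMk _ (NatIso.ofComponents (isoProd Φ x) (fun h => isoProd_naturality Φ x h))

lemma famIsoProd_naturality {U : Idx Φ} {x y : Fam Φ (𝟭 C) U} (f : x ⟶ y) :
    f ≫ (famIsoProd Φ y).hom =
      (famIsoProd Φ x).hom ≫ famHom Φ (prod.fst ≫ f.hom.app (Idx.self Φ U)) :=
  fam_hom_ext fun W => isoProd_prodHom Φ f W

lemma proj_map_eq {X Y : C} (f : X ⟶ Y) (U : Idx Φ) :
    (proj Φ).map f = homMk Φ (X := ⟨X⟩) (Y := ⟨Y⟩) U (prod.fst ≫ f) := by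
  refine Eq.trans (homMk_res Φ (X := ⟨X⟩) (Y := ⟨Y⟩) U.le_top (prod.fst ≫ f)).symm ?_
  refine congrArg (homMk Φ (X := ⟨X⟩) (Y := ⟨Y⟩) U) ?_
  rw [← Category.assoc]
  exact congrArg (· ≫ f) (res_fst X _)

lemma toBase_map_proj_map {X Y : C} (f : X ⟶ Y) (U : Idx Φ) :
    (toBase Φ).map ((proj Φ).map f) = eqToHom (FCat.ι_famRes U.le_top _).symm ≫
      (FCat.ι Φ (𝟭 C) U).map (famHom Φ (prod.fst ≫ f)) ≫ eqToHom (FCat.ι_famRes U.le_top _) := by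
  rw [proj_map_eq Φ f U]
  rfl

lemma ιIso_naturality {U : Idx Φ} {x y : Fam Φ (𝟭 C) U} (f : x ⟶ y) :
    (FCat.ι Φ (𝟭 C) U).map f ≫ (FCat.ι Φ (𝟭 C) U).map (famIsoProd Φ y).hom ≫
        eqToHom (FCat.ι_famRes U.le_top (prodFam Φ (y.obj.obj (Idx.self Φ U)))) =
      ((FCat.ι Φ (𝟭 C) U).map (famIsoProd Φ x).hom ≫
        eqToHom (FCat.ι_famRes U.le_top (prodFam Φ (x.obj.obj (Idx.self Φ U))))) ≫
        (toBase Φ).map ((proj Φ).map (f.hom.app (Idx.self Φ U))) := by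
  refine Eq.trans ?_ (congrArg (_ ≫ ·) (toBase_map_proj_map Φ (f.hom.app (Idx.self Φ U)) U).symm)
  rw [← Functor.map_comp_assoc, famIsoProd_naturality, Functor.map_comp, Category.assoc,
    Category.assoc, eqToHom_trans_assoc, eqToHom_refl, Category.id_comp]

/-- The legs of the filtered colimit are given by the comparison functor. -/
noncomputable def ιIso (U : Idx Φ) : FCat.ι Φ (𝟭 C) U ≅
    (famEval Φ (𝟭 C) U ⋙ ObjectProperty.ι _ ⋙ proj Φ) ⋙ toBase Φ :=
  NatIso.ofComponents
    (fun x => (FCat.ι Φ (𝟭 C) U).mapIso (famIsoProd Φ x) ≪≫ eqToIso (FCat.ι_famRes U.le_top _))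
    (fun f => ιIso_naturality Φ f)

instance : (toBase Φ).EssSurj where
  mem_essImage Z := by
    obtain ⟨U, x, rfl⟩ := FCat.exists_rep Z
    exact ⟨_, ⟨((ιIso Φ U).app x).symm⟩⟩

instance : (toBase Φ).IsEquivalence where

theorem exists_equivalence : ∃ e : FilterQuotient Φ ≌ BaseCat Φ, ∀ U : Idx Φ,
    Nonempty (FCat.ι Φ (𝟭 C) U ⋙ e.inverse ≅
      famEval Φ (𝟭 C) U ⋙ ObjectProperty.ι _ ⋙ FilterQuotient.proj Φ) :=
  ⟨(toBase Φ).asEquivalence, fun U =>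
    ⟨Functor.isoWhiskerRight (ιIso Φ U) _ ≪≫ Functor.associator _ _ _ ≪≫
      Functor.isoWhiskerLeft _ (toBase Φ).asEquivalence.unitIso.symm ≪≫ Functor.rightUnitor _⟩⟩

end FilterQuotient

end Equivalence

section Comprehension

variable {B : Type (max u v)} [Category.{v} B] {T : CompData.{v, u} B}

lemma CompData.depProjections_le_displayMaps : T.depProjections ≤ T.displayMaps :=
  MorphismProperty.monotone_isoClosure T.projections.le_multiplicativeClosure

lemma CompData.IsComprehensionCategory.exists_projection_of_iso (hT : T.IsComprehensionCategory)
    {X Y : B} {f : X ⟶ Y} (hf : T.projections f) {Y' : B} (e : Y' ≅ Y) :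
    ∃ (X' : B) (e' : X' ≅ X) (f' : X' ⟶ Y'), T.projections f' ∧ f' ≫ e.hom = e'.hom ≫ f := by
  obtain ⟨A⟩ := hf
  have := hT.fibered
  obtain ⟨A', φ, hφ⟩ := IsPreFibered.exists_isCartesian T.T.p rfl e.hom
  have : T.T.p.IsStronglyCartesian e.hom φ := inferInstance
  have hdom := IsHomLift.domain_eq T.T.p e.hom φ
  subst hdom
  have he : e.hom = T.T.p.map φ := IsHomLift.eq_of_isHomLift T.T.p e.hom φ
  have : IsIso φ := Functor.IsStronglyCartesian.isIso_of_base_isIso T.T.p e.hom φ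
  refine ⟨_, asIso (T.ext.map φ), T.proj.app A', ⟨A'⟩, ?_⟩
  rw [he]
  exact (T.proj.naturality φ).symm

/-- Composites of dependent projections can be transported along isomorphisms of the codomain. -/
lemma CompData.IsComprehensionCategory.exists_of_iso (hT : T.IsComprehensionCategory) {X Y : B}
    {f : X ⟶ Y} (hf : T.projections.multiplicativeClosure f) {Y' : B} (e : Y' ≅ Y) :
    ∃ (X' : B) (e' : X' ≅ X) (f' : X' ⟶ Y'), T.projections.multiplicativeClosure f' ∧
      f' ≫ e.hom = e'.hom ≫ f := by
  induction hf generalizing Y' with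
  | of f hf =>
    obtain ⟨X', e', f', hf', h⟩ := hT.exists_projection_of_iso hf e
    exact ⟨X', e', f', .of _ hf', h⟩
  | id Y => exact ⟨Y', e, 𝟙 _, .id _, by simp⟩
  | comp_of f g hf hg ih =>
    obtain ⟨Y', e', g', hg', h⟩ := hT.exists_projection_of_iso hg e
    obtain ⟨X', e'', f', hf', h'⟩ := ih e'
    exact ⟨X', e'', f' ≫ g', .comp_of _ _ hf' hg', by
      rw [Category.assoc, h, ← Category.assoc, h', Category.assoc]⟩

lemma CompData.displayMaps_id (X : B) : T.displayMaps (𝟙 X) :=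
  MorphismProperty.le_isoClosure _ _ (.id X)

lemma exists_of_isoClosure {W : MorphismProperty B} {X Y : B} {f : X ⟶ Y} (h : W.isoClosure f) :
    ∃ (X₀ Y₀ : B) (f₀ : X₀ ⟶ Y₀) (_ : W f₀) (i : X₀ ≅ X) (j : Y₀ ≅ Y),
      i.hom ≫ f = f₀ ≫ j.hom := by
  obtain ⟨X₀, Y₀, f₀, h₀, ⟨i⟩⟩ := h
  exact ⟨X₀, Y₀, f₀, h₀, Arrow.leftFunc.mapIso i, Arrow.rightFunc.mapIso i, i.hom.w⟩

lemma CompData.IsComprehensionCategory.displayMaps_comp (hT : T.IsComprehensionCategory)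
    {X Y Z : B} {f : X ⟶ Y} {g : Y ⟶ Z} (hf : T.displayMaps f) (hg : T.displayMaps g) :
    T.displayMaps (f ≫ g) := by
  obtain ⟨X₀, Y₀, f₀, hf₀, i, i', hi⟩ := exists_of_isoClosure hf
  obtain ⟨Y₁, Z₁, g₁, hg₁, j, j', hj⟩ := exists_of_isoClosure hg
  obtain ⟨X₁, e, f₁, hf₁, h⟩ := hT.exists_of_iso hf₀ (j ≪≫ i'.symm)
  refine ⟨X₁, Z₁, f₁ ≫ g₁, MorphismProperty.comp_mem _ _ _ hf₁ hg₁,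
    ⟨Arrow.isoMk (e ≪≫ i) j' ?_⟩⟩
  have h' : f₁ ≫ j.hom = e.hom ≫ i.hom ≫ f := by
    rw [hi, ← Category.assoc, ← h]
    simp
  change (e.hom ≫ i.hom) ≫ f ≫ g = (f₁ ≫ g₁) ≫ j'.hom
  rw [Category.assoc, Category.assoc, ← hj, ← Category.assoc f₁, h']
  simp only [Category.assoc]

instance : T.displayMaps.RespectsIso :=
  inferInstanceAs (MorphismProperty.isoClosure _).RespectsIso

instance : T.depProjections.RespectsIso :=
  inferInstanceAs (MorphismProperty.isoClosure _).RespectsIso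

lemma isHomLift_comp {X Y Z : Type*} [Category X] [Category Y] [Category Z] {G : X ⥤ Y} {p : Y ⥤ Z}
    {R S : Z} {f : R ⟶ S} {a b : X} {φ : a ⟶ b} (h : p.IsHomLift f (G.map φ)) :
    (G ⋙ p).IsHomLift f φ := by
  subst_hom_lift p f (G.map φ)
  exact IsHomLift.map (p := G ⋙ p) φ

lemma ParamScheme.exists_isHomLift (hT : T.T.p.IsFibered) {I : BasedCategory.{v, max u v} B}
    (P : ParamScheme T I) (a : I.obj) {R : B} (f : R ⟶ I.p.obj a) :
    ∃ (b : I.obj) (φ : b ⟶ a), I.p.IsHomLift f φ := by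
  induction P with
  | nil => exact ⟨R, f, IsHomLift.map (p := 𝟭 B) f⟩
  | type P α ih =>
    obtain ⟨b, φ, h⟩ := ih a.inst f
    obtain ⟨A, ψ, hψ⟩ := IsPreFibered.exists_isCartesian T.T.p a.eq (α.dom.map φ)
    have hψ' : T.T.p.IsStronglyCartesian (α.dom.map φ) ψ := inferInstance
    exact ⟨(⟨b, A, IsHomLift.domain_eq T.T.p (α.dom.map φ) ψ⟩ : TypeExt α), ⟨φ, ψ, hψ'⟩,
      isHomLift_comp (G := TypeExt.fst α) h⟩
  | term P α β ih =>
    obtain ⟨b, φ, h⟩ := ih a.inst f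
    obtain ⟨s, hs₁, hs₂⟩ := (β.equifibered φ).exists_lift (α.dom.map φ ≫ a.tm) (𝟙 _) (by
      rw [Category.assoc, a.sec, Category.comp_id, Category.id_comp])
    exact ⟨(⟨b, s, hs₂⟩ : TermExt β), ⟨φ, hs₁.symm⟩, isHomLift_comp (G := TermExt.fst β) h⟩

/-- The instantiation of a parameter scheme is a Grothendieck fibration. -/
lemma ParamScheme.isFibered (hT : T.T.p.IsFibered) {I : BasedCategory.{v, max u v} B}
    (P : ParamScheme T I) : I.p.IsFibered := by
  refine .of_exists_isStronglyCartesian fun a R f => ?_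
  obtain ⟨b, φ, h⟩ := P.exists_isHomLift hT a f
  exact ⟨b, φ, isStronglyCartesian_of_isHomLift f (P.isStronglyCartesian φ) h⟩

end Comprehension

lemma isPullback_eqToHom_conj {D : Type*} [Category D] {a b c d a' b' c' d' : D} {f : a ⟶ b}
    {g : a ⟶ c} {h : b ⟶ d} {k : c ⟶ d} (H : IsPullback f g h k) (ha : a' = a) (hb : b' = b)
    (hc : c' = c) (hd : d' = d) :
    IsPullback (eqToHom ha ≫ f ≫ eqToHom hb.symm) (eqToHom ha ≫ g ≫ eqToHom hc.symm)
      (eqToHom hb ≫ h ≫ eqToHom hd.symm) (eqToHom hc ≫ k ≫ eqToHom hd.symm) := by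
  subst ha hb hc hd
  simpa using H

section Quotient

variable {C : Type (max u v)} [Category.{v} C] [HasFiniteProducts C]
variable {Φ : Order.PFilter (Subobject (⊤_ C))}
variable {F : Type (max u v)} [Category.{v} F] {p : F ⥤ C}
variable {F' : Type (max u v)} [Category.{v} F'] {p' : F' ⥤ C}

lemma FCat.isPullback_natTrans {G H : F ⥤ F'} (hG : PreservesRestrictions p p' G)
    (hH : PreservesRestrictions p p' H) (τ : G ⟶ H) {U : Idx Φ} {x y : Fam Φ p U} (f : x ⟶ y)
    (h : ∀ V, IsPullback (G.map (f.hom.app V)) (τ.app (x.obj.obj V)) (τ.app (y.obj.obj V))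
      (H.map (f.hom.app V))) :
    IsPullback ((map Φ hG).map ((ι Φ p U).map f)) ((natTrans Φ hG hH τ).app ((ι Φ p U).obj x))
      ((natTrans Φ hG hH τ).app ((ι Φ p U).obj y)) ((map Φ hH).map ((ι Φ p U).map f)) := by
  rw [map_ι_map, map_ι_map, natTrans_app, natTrans_app]
  exact isPullback_eqToHom_conj (isPullback_ι (f := (famMap Φ hG U).map f)
    (g := (famNat Φ hG hH τ U).app x) (h := (famNat Φ hG hH τ U).app y)
    (k := (famMap Φ hH U).map f) h) (map_ι hG x) (map_ι hG y) (map_ι hH x) (map_ι hH y)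

lemma FCat.equifibered_natTrans {G H : F ⥤ F'} (hG : PreservesRestrictions p p' G)
    (hH : PreservesRestrictions p p' H) {τ : G ⟶ H} (hτ : NatTrans.Equifibered τ) :
    NatTrans.Equifibered (natTrans Φ hG hH τ) := fun _ _ m =>
  hom_ind (P := fun X Y m => IsPullback ((map Φ hG).map m) ((natTrans Φ hG hH τ).app X)
    ((natTrans Φ hG hH τ).app Y) ((map Φ hH).map m))
    (fun _ _ _ f => isPullback_natTrans hG hH τ f fun _ => hτ _) m

variable {T : CompData.{v, u} C}

lemma CompData.IsComprehensionCategory.filterQuotient (hT : T.IsComprehensionCategory) :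
    (T.filterQuotient Φ hT).IsComprehensionCategory where
  fibered := by
    have := hT.fibered
    exact FCat.base_isFibered
  cartesian _ _ m hm := by
    have := hT.fibered
    refine FCat.cartesian_ind (P := fun X Y m => IsPullback ((FCat.map Φ hT.preserves).map m)
      ((FCat.natTrans Φ hT.preserves (preservesRestrictions_base T.T.p) T.proj).app X)
      ((FCat.natTrans Φ hT.preserves (preservesRestrictions_base T.T.p) T.proj).app Y)
      ((FCat.map Φ (preservesRestrictions_base T.T.p)).map m)) (fun U x y f hf => ?_) m hm
    exact FCat.isPullback_natTrans _ _ _ f fun V => hT.cartesian _ (hf V)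

variable (Φ) in
/-- The functor `C ⥤ C_Φ`, given by the families of products `X × W`. -/
noncomputable def projBase : C ⥤ BaseCat Φ := FilterQuotient.proj Φ ⋙ FilterQuotient.toBase Φ

lemma nonempty_natTrans_iso {G H : F ⥤ C} (hG : PreservesRestrictions p (𝟭 C) G)
    (hH : PreservesRestrictions p (𝟭 C) H) (τ : G ⟶ H) {U : Idx Φ} (x : Fam Φ p U) :
    Nonempty (Arrow.mk ((projBase Φ).map (τ.app (x.obj.obj (Idx.self Φ U)))) ≅
      Arrow.mk ((FCat.natTrans Φ hG hH τ).app ((FCat.ι Φ p U).obj x))) := by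
  refine ⟨Iso.symm ?_ ≪≫ eqToIso (FCat.natTrans_ι Φ hG hH τ U x).symm⟩
  exact Arrow.isoMk ((FilterQuotient.ιIso Φ U).app _) ((FilterQuotient.ιIso Φ U).app _)
    ((FilterQuotient.ιIso Φ U).hom.naturality ((famNat Φ hG hH τ U).app x)).symm

lemma CompData.IsComprehensionCategory.projBase_projections (hT : T.IsComprehensionCategory)
    {X Y : C} {f : X ⟶ Y} (hf : T.projections f) :
    (T.filterQuotient Φ hT).depProjections ((projBase Φ).map f) := by
  obtain ⟨A⟩ := hf
  have := hT.fibered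
  have := famEval_isEquivalence Φ T.T.p (Idx.top Φ)
  let A' : Slice T.T.p (Idx.top Φ).1 :=
    ⟨A, ⟨terminal.from _ ≫ (Subobject.underlyingIso (𝟙 (⊤_ C))).inv⟩⟩
  let x := (famEval Φ T.T.p (Idx.top Φ)).objPreimage A'
  let i : x.obj.obj (Idx.self Φ (Idx.top Φ)) ≅ A :=
    (ObjectProperty.ι _).mapIso ((famEval Φ T.T.p (Idx.top Φ)).objObjPreimageIso A')
  obtain ⟨j⟩ := nonempty_natTrans_iso hT.preserves (preservesRestrictions_base T.T.p) T.proj x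
  refine ⟨_, _, _, ⟨(FCat.ι Φ T.T.p (Idx.top Φ)).obj x⟩, ⟨j.symm ≪≫ ?_⟩⟩
  exact Arrow.isoMk ((projBase Φ).mapIso (T.ext.mapIso i)) ((projBase Φ).mapIso (T.T.p.mapIso i)) (by
    change (projBase Φ).map _ ≫ (projBase Φ).map _ = (projBase Φ).map _ ≫ (projBase Φ).map _
    rw [← Functor.map_comp, ← Functor.map_comp]
    exact congrArg _ (T.proj.naturality i.hom))

lemma CompData.IsComprehensionCategory.projBase_depProjections (hT : T.IsComprehensionCategory)
    {X Y : C} {f : X ⟶ Y} (hf : T.depProjections f) :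
    (T.filterQuotient Φ hT).depProjections ((projBase Φ).map f) := by
  obtain ⟨_, _, g, hg, ⟨i⟩⟩ := hf
  exact (MorphismProperty.arrow_mk_iso_iff _ ((projBase Φ).mapArrow.mapIso i)).1
    (hT.projBase_projections hg)

lemma CompData.IsComprehensionCategory.projBase_displayMaps (hT : T.IsComprehensionCategory)
    {X Y : C} {f : X ⟶ Y} (hf : T.displayMaps f) :
    (T.filterQuotient Φ hT).displayMaps ((projBase Φ).map f) := by
  have key : ∀ {X Y : C} {f : X ⟶ Y}, T.projections.multiplicativeClosure f →
      (T.filterQuotient Φ hT).displayMaps ((projBase Φ).map f) := by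
    intro X Y f hf
    induction hf with
    | of f hf => exact depProjections_le_displayMaps _ (hT.projBase_projections hf)
    | id X =>
      rw [CategoryTheory.Functor.map_id]
      exact displayMaps_id _
    | comp_of f g hf hg ih =>
      rw [Functor.map_comp]
      exact hT.filterQuotient.displayMaps_comp ih
        (depProjections_le_displayMaps _ (hT.projBase_projections hg))
  obtain ⟨_, _, g, hg, ⟨i⟩⟩ := hf
  exact (MorphismProperty.arrow_mk_iso_iff _ ((projBase Φ).mapArrow.mapIso i)).1 (key hg)

lemma CompData.IsComprehensionCategory.displayMaps_natTrans (hT : T.IsComprehensionCategory)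
    {G H : F ⥤ C} (hG : PreservesRestrictions p (𝟭 C) G)
    (hH : PreservesRestrictions p (𝟭 C) H) {τ : G ⟶ H} (h : ∀ x, T.displayMaps (τ.app x))
    (X : FCat Φ p) : (T.filterQuotient Φ hT).displayMaps ((FCat.natTrans Φ hG hH τ).app X) := by
  obtain ⟨U, x, rfl⟩ := FCat.exists_rep X
  obtain ⟨j⟩ := nonempty_natTrans_iso hG hH τ x
  exact (MorphismProperty.arrow_mk_iso_iff _ j).1 (hT.projBase_displayMaps (h _))

lemma CompData.IsComprehensionCategory.depProjections_natTrans (hT : T.IsComprehensionCategory)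
    {G H : F ⥤ C} (hG : PreservesRestrictions p (𝟭 C) G)
    (hH : PreservesRestrictions p (𝟭 C) H) {τ : G ⟶ H} (h : ∀ x, T.depProjections (τ.app x))
    (X : FCat Φ p) : (T.filterQuotient Φ hT).depProjections ((FCat.natTrans Φ hG hH τ).app X) := by
  obtain ⟨U, x, rfl⟩ := FCat.exists_rep X
  obtain ⟨j⟩ := nonempty_natTrans_iso hG hH τ x
  exact (MorphismProperty.arrow_mk_iso_iff _ j).1 (hT.projBase_depProjections (h _))

end Quotient

section Arrows

variable {D : Type*} [Category D] {E : Type*} [Category E]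

lemma arrow_mk_map_eq (K : D ⥤ E) {X Y X' Y' : D} {f : X ⟶ Y} {g : X' ⟶ Y'}
    (h : Arrow.mk f = Arrow.mk g) : Arrow.mk (K.map f) = Arrow.mk (K.map g) :=
  congrArg K.mapArrow.obj h

lemma arrow_mk_eq_left {X Y X' Y' : D} {f : X ⟶ Y} {g : X' ⟶ Y'}
    (h : Arrow.mk f = Arrow.mk g) : X = X' := congrArg (fun a : Arrow D => a.left) h

lemma arrow_mk_eq_right {X Y X' Y' : D} {f : X ⟶ Y} {g : X' ⟶ Y'}
    (h : Arrow.mk f = Arrow.mk g) : Y = Y' := congrArg (fun a : Arrow D => a.right) h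

lemma functor_ext_arrow {G H : D ⥤ E}
    (h : ∀ ⦃X Y : D⦄ (f : X ⟶ Y), Arrow.mk (G.map f) = Arrow.mk (H.map f)) : G = H :=
  CategoryTheory.Functor.ext (fun X => arrow_mk_eq_left (h (𝟙 X)))
    (fun _ _ f => eq_eqToHom_of_arrow_mk_eq (h f) (arrow_mk_eq_left (h f)) (arrow_mk_eq_right (h f)))

/-- Commutativity of a square only depends on its sides as objects of the arrow category. -/
lemma comm_of_arrow_mk_eq {a b c d a' b' c' d' : D} {s : a ⟶ b} {t : b ⟶ d} {k : a ⟶ c} {l : c ⟶ d}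
    {s' : a' ⟶ b'} {t' : b' ⟶ d'} {k' : a' ⟶ c'} {l' : c' ⟶ d'} (w : s ≫ t = k ≫ l)
    (hs : Arrow.mk s = Arrow.mk s') (ht : Arrow.mk t = Arrow.mk t') (hk : Arrow.mk k = Arrow.mk k')
    (hl : Arrow.mk l = Arrow.mk l') : s' ≫ t' = k' ≫ l' := by
  obtain rfl := arrow_mk_eq_left hs
  obtain rfl := arrow_mk_eq_right hs
  obtain rfl := arrow_mk_eq_right hk
  obtain rfl := arrow_mk_eq_right ht
  obtain rfl := Arrow.mk_injective _ _ hs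
  obtain rfl := Arrow.mk_injective _ _ ht
  obtain rfl := Arrow.mk_injective _ _ hk
  obtain rfl := Arrow.mk_injective _ _ hl
  exact w

lemma comp_eq_id_of_arrow_mk_eq {a b a' b' : D} {s : a ⟶ b} {t : b ⟶ a} {s' : a' ⟶ b'} {t' : b' ⟶ a'}
    (w : s ≫ t = 𝟙 a) (hs : Arrow.mk s = Arrow.mk s') (ht : Arrow.mk t = Arrow.mk t') :
    s' ≫ t' = 𝟙 a' := by
  obtain rfl := arrow_mk_eq_left hs
  obtain rfl := arrow_mk_eq_right hs
  obtain rfl := Arrow.mk_injective _ _ hs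
  obtain rfl := Arrow.mk_injective _ _ ht
  exact w

lemma isHomLift_of_arrow_mk_eq {p : D ⥤ E} {X Y : D} {f : X ⟶ Y} {R S : E} {g : R ⟶ S}
    (h : Arrow.mk (p.map f) = Arrow.mk g) : p.IsHomLift g f := by
  obtain rfl := arrow_mk_eq_left h
  obtain rfl := arrow_mk_eq_right h
  obtain rfl := Arrow.mk_injective _ _ h
  exact IsHomLift.map (p := p) f

lemma arrow_mk_eq_of_isHomLift {p : D ⥤ E} {X Y : D} {f : X ⟶ Y} {R S : E} {g : R ⟶ S}
    (h : p.IsHomLift g f) : Arrow.mk (p.map f) = Arrow.mk g := by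
  subst_hom_lift p g f
  rfl

lemma isIsoOfCategories_of_bijective {K : D ⥤ E}
    (inj : ∀ ⦃X Y X' Y' : D⦄ (f : X ⟶ Y) (g : X' ⟶ Y'),
      Arrow.mk (K.map f) = Arrow.mk (K.map g) → Arrow.mk f = Arrow.mk g)
    (surj : ∀ ⦃X Y : E⦄ (f : X ⟶ Y), ∃ (X' Y' : D) (g : X' ⟶ Y'),
      Arrow.mk (K.map g) = Arrow.mk f) : IsIsoOfCategories K := by
  have inj₀ : Function.Injective K.obj := fun X Y h => arrow_mk_eq_left (inj (𝟙 X) (𝟙 Y) (by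
    rw [K.map_id, K.map_id, h]))
  have surj₀ : Function.Surjective K.obj := fun X => by
    obtain ⟨X', _, g, h⟩ := surj (𝟙 X)
    exact ⟨X', arrow_mk_eq_left h⟩
  choose l hl using surj₀
  have : ∀ ⦃X Y : E⦄ (f : X ⟶ Y), ∃ g : l X ⟶ l Y, Arrow.mk (K.map g) = Arrow.mk f := by
    intro X Y f
    obtain ⟨X', Y', g, h⟩ := surj f
    obtain rfl : X' = l X := inj₀ ((arrow_mk_eq_left h).trans (hl X).symm)
    obtain rfl : Y' = l Y := inj₀ ((arrow_mk_eq_right h).trans (hl Y).symm)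
    exact ⟨g, h⟩
  choose m hm using this
  let L : E ⥤ D :=
    { obj := l
      map := fun f => m f
      map_id := fun X => Arrow.mk_injective _ _ (inj _ _ (by
        rw [hm, K.map_id, hl]))
      map_comp := fun f g => Arrow.mk_injective _ _ (inj _ _ (by
        rw [hm, K.map_comp, eq_eqToHom_of_arrow_mk_eq (hm f) (hl _) (hl _),
          eq_eqToHom_of_arrow_mk_eq (hm g) (hl _) (hl _)]
        simp only [Category.assoc, eqToHom_trans_assoc, eqToHom_refl, Category.id_comp]
        rw [← Category.assoc f, arrow_mk_eqToHom_conj])) }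
  exact ⟨L, functor_ext_arrow fun X Y f => inj _ _ (hm _), functor_ext_arrow fun X Y f => hm f⟩

lemma IsIsoOfCategories.arrow_injective {K : D ⥤ E} (hK : IsIsoOfCategories K)
    {X Y X' Y' : D} {f : X ⟶ Y} {g : X' ⟶ Y'} (h : Arrow.mk (K.map f) = Arrow.mk (K.map g)) :
    Arrow.mk f = Arrow.mk g := by
  obtain ⟨L, h₁, -⟩ := hK
  have e : ∀ {X Y : D} (f : X ⟶ Y), Arrow.mk (L.map (K.map f)) = Arrow.mk f := fun f =>
    congrArg (fun H : D ⥤ D => Arrow.mk (H.map f)) h₁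
  rw [← e f, ← e g]
  exact arrow_mk_map_eq L h

lemma IsIsoOfCategories.arrow_surjective {K : D ⥤ E} (hK : IsIsoOfCategories K)
    {X Y : E} (f : X ⟶ Y) : ∃ (X' Y' : D) (g : X' ⟶ Y'), Arrow.mk (K.map g) = Arrow.mk f := by
  obtain ⟨L, -, h₂⟩ := hK
  exact ⟨_, _, L.map f, congrArg (fun H : E ⥤ E => Arrow.mk (H.map f)) h₂⟩

lemma IsIsoOfCategories.faithful {K : D ⥤ E} (hK : IsIsoOfCategories K) : K.Faithful where
  map_injective h := Arrow.mk_injective _ _ (hK.arrow_injective (congrArg Arrow.mk h))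

end Arrows

section Instantiation

variable {B : Type (max u v)} [Category.{v} B] {T : CompData.{v, u} B}
  {I : BasedCategory.{v, max u v} B}

section TypeExtension

variable {α : DisplayFunctor T I}

lemma TypeExt.ext_of {x y : TypeExt α} (h : x.inst = y.inst) (h' : x.ty = y.ty) : x = y := by
  cases x
  cases y
  cases h
  cases h'
  rfl

lemma TypeExt.arrow_ext {x y x' y' : TypeExt α} {f : x ⟶ y} {g : x' ⟶ y'}
    (h : Arrow.mk ((TypeExt.fst α).map f) = Arrow.mk ((TypeExt.fst α).map g))
    (h' : Arrow.mk ((TypeExt.snd α).map f) = Arrow.mk ((TypeExt.snd α).map g)) :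
    Arrow.mk f = Arrow.mk g := by
  obtain rfl := TypeExt.ext_of (arrow_mk_eq_left h) (arrow_mk_eq_left h')
  obtain rfl := TypeExt.ext_of (arrow_mk_eq_right h) (arrow_mk_eq_right h')
  exact congrArg Arrow.mk (TypeExt.Hom.ext (Arrow.mk_injective _ _ h) (Arrow.mk_injective _ _ h'))

lemma TypeExt.functor_ext {D : Type*} [Category D] {G H : D ⥤ TypeExt α}
    (h : G ⋙ TypeExt.fst α = H ⋙ TypeExt.fst α) (h' : G ⋙ TypeExt.snd α = H ⋙ TypeExt.snd α) :
    G = H :=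
  functor_ext_arrow fun _ _ f => TypeExt.arrow_ext
    (congrArg (fun K : D ⥤ _ => Arrow.mk (K.map f)) h)
    (congrArg (fun K : D ⥤ _ => Arrow.mk (K.map f)) h')

lemma isStronglyCartesian_of_comp_eq {D : Type*} [Category D] {G : D ⥤ I.obj} {H : D ⥤ T.T.obj}
    (h : H ⋙ T.T.p = G ⋙ α.dom) {X Y : D} (f : X ⟶ Y)
    (hc : T.T.p.IsStronglyCartesian (T.T.p.map (H.map f)) (H.map f)) :
    T.T.p.IsStronglyCartesian (α.dom.map (G.map f)) (H.map f) :=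
  isStronglyCartesian_of_isHomLift _ hc (isHomLift_of_arrow_mk_eq
    (congrArg (fun K : D ⥤ B => Arrow.mk (K.map f)) h))

/-- The universal property of `TypeExt α`. -/
def TypeExt.lift {D : Type*} [Category D] (α : DisplayFunctor T I) (G : D ⥤ I.obj)
    (H : D ⥤ T.T.obj) (h : H ⋙ T.T.p = G ⋙ α.dom)
    (hc : ∀ ⦃X Y : D⦄ (f : X ⟶ Y),
      T.T.p.IsStronglyCartesian (T.T.p.map (H.map f)) (H.map f)) : D ⥤ TypeExt α where
  obj X := ⟨G.obj X, H.obj X, Functor.congr_obj h X⟩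
  map f := ⟨G.map f, H.map f, isStronglyCartesian_of_comp_eq h f (hc f)⟩
  map_id X := TypeExt.Hom.ext (G.map_id X) (H.map_id X)
  map_comp f g := TypeExt.Hom.ext (G.map_comp f g) (H.map_comp f g)

lemma TypeExt.snd_comp (α : DisplayFunctor T I) :
    TypeExt.snd α ⋙ T.T.p = TypeExt.fst α ⋙ α.dom :=
  functor_ext_arrow fun _ _ f =>
    arrow_mk_eq_of_isHomLift (p := T.T.p) (TypeExt.Hom.cartesian f).toIsHomLift

end TypeExtension

section TermExtension

variable {α : DisplayFunctor T I} {β : DepProjFunctor α}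

lemma TermExt.ext_of {x y : TermExt β} (h : x.inst = y.inst) (h' : Arrow.mk x.tm = Arrow.mk y.tm) :
    x = y := by
  cases x
  cases y
  cases h
  cases Arrow.mk_injective _ _ h'
  rfl

lemma TermExt.arrow_ext {x y x' y' : TermExt β} {f : x ⟶ y} {g : x' ⟶ y'}
    (h : Arrow.mk ((TermExt.fst β).map f) = Arrow.mk ((TermExt.fst β).map g))
    (hx : Arrow.mk x.tm = Arrow.mk x'.tm) (hy : Arrow.mk y.tm = Arrow.mk y'.tm) :
    Arrow.mk f = Arrow.mk g := by
  obtain rfl := TermExt.ext_of (arrow_mk_eq_left h) hx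
  obtain rfl := TermExt.ext_of (arrow_mk_eq_right h) hy
  exact congrArg Arrow.mk (TermExt.Hom.ext (Arrow.mk_injective _ _ h))

lemma TermExt.functor_ext {D : Type*} [Category D] {G H : D ⥤ TermExt β}
    (h : G ⋙ TermExt.fst β = H ⋙ TermExt.fst β)
    (h' : ∀ d, Arrow.mk (G.obj d).tm = Arrow.mk (H.obj d).tm) : G = H :=
  functor_ext_arrow fun _ _ f => TermExt.arrow_ext
    (congrArg (fun K : D ⥤ _ => Arrow.mk (K.map f)) h) (h' _) (h' _)

/-- The universal property of `TermExt β`. -/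
def TermExt.lift {D : Type*} [Category D] (β : DepProjFunctor α) (G : D ⥤ I.obj)
    (σ : G ⋙ α.dom ⟶ G ⋙ β.dom) (h : ∀ d, σ.app d ≫ β.π.app (G.obj d) = 𝟙 _) : D ⥤ TermExt β where
  obj X := ⟨G.obj X, σ.app X, h X⟩
  map f := ⟨G.map f, σ.naturality f⟩
  map_id X := TermExt.Hom.ext (G.map_id X)
  map_comp f g := TermExt.Hom.ext (G.map_comp f g)

end TermExtension

end Instantiation

section FCat

variable {C : Type (max u v)} [Category.{v} C] [HasFiniteProducts C]
variable {Φ : Order.PFilter (Subobject (⊤_ C))}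
variable {F : Type (max u v)} [Category.{v} F] {p : F ⥤ C}
variable {F' : Type (max u v)} [Category.{v} F'] {p' : F' ⥤ C}

lemma fam_arrow_ext {U : Idx Φ} {x y x' y' : Fam Φ p U} {f : x ⟶ y} {g : x' ⟶ y'} (hx : x = x')
    (hy : y = y') (h : ∀ V, Arrow.mk (f.hom.app V) = Arrow.mk (g.hom.app V)) :
    Arrow.mk f = Arrow.mk g := by
  subst hx hy
  exact congrArg Arrow.mk (fam_hom_ext fun V => Arrow.mk_injective _ _ (h V))

namespace FCat

lemma arrow_ι_restrict {U V : Idx Φ} (h : V ≤ U) {x y : Fam Φ p U} (f : x ⟶ y) :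
    Arrow.mk ((ι Φ p V).map ((famRestrict Φ p h).map f)) = Arrow.mk ((ι Φ p U).map f) :=
  congrArg (fun K : Fam Φ p U ⥤ _ => Arrow.mk (K.map f)) (restrict_ι Φ p h)

lemma arrow_map_ι {G : F ⥤ F'} (hG : PreservesRestrictions p p' G) {U : Idx Φ} {x y : Fam Φ p U}
    (f : x ⟶ y) : Arrow.mk ((map Φ hG).map ((ι Φ p U).map f)) =
      Arrow.mk ((ι Φ p' U).map ((famMap Φ hG U).map f)) :=
  congrArg (fun K : Fam Φ p U ⥤ _ => Arrow.mk (K.map f)) (ι_map Φ hG U)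

lemma arrow_homMk {U V W : Idx Φ} {x : Fam Φ p U} {y : Fam Φ p V} (hU : W ≤ U) (hV : W ≤ V)
    (f : famRes hU x ⟶ famRes hV y) : Arrow.mk (homMk hU hV f) = Arrow.mk ((ι Φ p W).map f) :=
  arrow_mk_eqToHom_conj _ _ _

lemma exists_arrow_le {X Y : FCat Φ p} (m : X ⟶ Y) (N : Idx Φ) :
    ∃ (U : Idx Φ) (_ : U ≤ N) (x y : Fam Φ p U) (f : x ⟶ y),
      Arrow.mk ((ι Φ p U).map f) = Arrow.mk m := by
  obtain ⟨U, x, rfl⟩ := exists_rep X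
  obtain ⟨V, y, rfl⟩ := exists_rep Y
  obtain ⟨W, hU, hV, hN, f, rfl⟩ := exists_homMk_le m N
  exact ⟨W, hN, _, _, f, (arrow_homMk _ _ _).symm⟩

lemma exists_isCartesianFam_arrow [p.IsFibered] {X Y : FCat Φ p} (m : X ⟶ Y)
    (hm : (base Φ p).IsStronglyCartesian ((base Φ p).map m) m) :
    ∃ (U : Idx Φ) (x y : Fam Φ p U) (f : x ⟶ y), IsCartesianFam f ∧
      Arrow.mk ((ι Φ p U).map f) = Arrow.mk m :=
  cartesian_ind (P := fun _ _ m => ∃ (U : Idx Φ) (x y : Fam Φ p U) (f : x ⟶ y),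
      IsCartesianFam f ∧ Arrow.mk ((ι Φ p U).map f) = Arrow.mk m)
    (fun U x y f hf => ⟨U, x, y, f, hf, rfl⟩) m hm

/-- Two arrows of families have the same class if and only if they agree eventually. -/
lemma arrow_ι_eq {U V : Idx Φ} {x y : Fam Φ p U} {x' y' : Fam Φ p V} {f : x ⟶ y}
    {g : x' ⟶ y'} (h : Arrow.mk ((ι Φ p U).map f) = Arrow.mk ((ι Φ p V).map g)) :
    ∃ (W : Idx Φ) (hU : W ≤ U) (hV : W ≤ V),
      Arrow.mk ((famRestrict Φ p hU).map f) = Arrow.mk ((famRestrict Φ p hV).map g) := by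
  obtain ⟨W, hU, hV, e⟩ := ι_obj_eq_iff.1 (arrow_mk_eq_left h)
  obtain ⟨W', hU', hV', e'⟩ := ι_obj_eq_iff.1 (arrow_mk_eq_right h)
  obtain ⟨N, k, k'⟩ := Idx.exists_le W W'
  have key : ∀ {a b a' b' : Fam Φ p N} (f' : a ⟶ b) (g' : a' ⟶ b') (_ : a = a') (_ : b = b')
      (_ : Arrow.mk ((ι Φ p N).map f') = Arrow.mk ((ι Φ p N).map g')),
      ∃ (M : Idx Φ) (hM : M ≤ N),
        Arrow.mk ((famRestrict Φ p hM).map f') = Arrow.mk ((famRestrict Φ p hM).map g') := by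
    intro a b a' b' f' g' ha hb e
    subst ha hb
    have e := Arrow.mk_injective _ _ e
    rw [← homMk_refl f', ← homMk_refl g'] at e
    obtain ⟨M, hM, e⟩ := homMk_inj e
    exact ⟨M, hM, congrArg Arrow.mk e⟩
  obtain ⟨M, hM, e''⟩ := key ((famRestrict Φ p (k.trans hU)).map f)
    ((famRestrict Φ p (k.trans hV)).map g) (congrArg (famRestrict Φ p k).obj e)
    (congrArg (famRestrict Φ p k').obj e')
    ((arrow_ι_restrict _ f).trans (h.trans (arrow_ι_restrict _ g).symm))
  exact ⟨M, hM.trans (k.trans hU), hM.trans (k.trans hV), e''⟩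

lemma arrow_ι_eq_of_restrict {U V W : Idx Φ} (hU : W ≤ U) (hV : W ≤ V) {x y : Fam Φ p U}
    {x' y' : Fam Φ p V} {f : x ⟶ y} {g : x' ⟶ y'}
    (h : Arrow.mk ((famRestrict Φ p hU).map f) = Arrow.mk ((famRestrict Φ p hV).map g)) :
    Arrow.mk ((ι Φ p U).map f) = Arrow.mk ((ι Φ p V).map g) :=
  (arrow_ι_restrict hU f).symm.trans ((arrow_mk_map_eq _ h).trans (arrow_ι_restrict hV g))

end FCat

end FCat

section Families

variable {C : Type (max u v)} [Category.{v} C] [HasFiniteProducts C]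
variable {Φ : Order.PFilter (Subobject (⊤_ C))}
variable {T : CompData.{v, u} C} {I : BasedCategory.{v, max u v} C}

lemma ParamScheme.famType_arrow_ext (P : ParamScheme T I) {α : DisplayFunctor T I} {U : Idx Φ}
    {x y x' y' : Fam Φ (TypeExt.fst α ⋙ I.p) U} {f : x ⟶ y} {g : x' ⟶ y'}
    (h : Arrow.mk ((famMap Φ (P.preserves rfl) U).map f) =
      Arrow.mk ((famMap Φ (P.preserves rfl) U).map g))
    (h' : Arrow.mk ((famMap Φ (TypeExt.snd_preserves P α) U).map f) =
      Arrow.mk ((famMap Φ (TypeExt.snd_preserves P α) U).map g)) : Arrow.mk f = Arrow.mk g :=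
  fam_arrow_ext
    (fam_ext (TypeExt.functor_ext (congrArg (fun a => a.obj) (arrow_mk_eq_left h))
      (congrArg (fun a => a.obj) (arrow_mk_eq_left h'))))
    (fam_ext (TypeExt.functor_ext (congrArg (fun a => a.obj) (arrow_mk_eq_right h))
      (congrArg (fun a => a.obj) (arrow_mk_eq_right h'))))
    (fun V => TypeExt.arrow_ext
      (congrArg (fun a : Arrow (Fam Φ I.p U) => Arrow.mk (a.hom.hom.app V)) h)
      (congrArg (fun a : Arrow (Fam Φ T.T.p U) => Arrow.mk (a.hom.hom.app V)) h'))

lemma ParamScheme.exists_famType_arrow (P : ParamScheme T I) {α : DisplayFunctor T I} {U : Idx Φ}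
    {x y : Fam Φ I.p U} {f : x ⟶ y} {s t : Fam Φ T.T.p U} {g : s ⟶ t} (hg : IsCartesianFam g)
    (h : Arrow.mk ((famBase Φ T.T.p U).map g) = Arrow.mk ((famMap Φ α.preserves U).map f)) :
    ∃ (z z' : Fam Φ (TypeExt.fst α ⋙ I.p) U) (m : z ⟶ z'),
      Arrow.mk ((famMap Φ (P.preserves rfl) U).map m) = Arrow.mk f ∧
      Arrow.mk ((famMap Φ (TypeExt.snd_preserves P α) U).map m) = Arrow.mk g := by
  have hs : s.obj ⋙ T.T.p = x.obj ⋙ α.dom := congrArg (fun a => a.obj) (arrow_mk_eq_left h)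
  have ht : t.obj ⋙ T.T.p = y.obj ⋙ α.dom := congrArg (fun a => a.obj) (arrow_mk_eq_right h)
  have fam : ∀ {x : Fam Φ I.p U} {s : Fam Φ T.T.p U} (hs : s.obj ⋙ T.T.p = x.obj ⋙ α.dom),
      IsFam Φ (TypeExt.fst α ⋙ I.p) U
        (TypeExt.lift α x.obj s.obj hs fun _ _ e => (s.property e).1) :=
    fun {x s} hs W V e => ⟨TypeExt.isStronglyCartesian α P.isStronglyCartesian _, (x.property e).2⟩
  refine ⟨⟨_, fam hs⟩, ⟨_, fam ht⟩, ObjectProperty.homMk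
    { app := fun V => ⟨f.hom.app V, g.hom.app V, ?_⟩
      naturality := fun V W e => TypeExt.Hom.ext (f.hom.naturality e) (g.hom.naturality e) },
      rfl, rfl⟩
  exact isStronglyCartesian_of_isHomLift _ (hg V) (isHomLift_of_arrow_mk_eq
    (congrArg (fun a : Arrow (Fam Φ (𝟭 C) U) => Arrow.mk (a.hom.hom.app V)) h))

variable (Φ) in
/-- The family of the universal sections of a family of terms. -/
noncomputable abbrev ParamScheme.famSection (P : ParamScheme T I) {α : DisplayFunctor T I}
    (β : DepProjFunctor α) {U : Idx Φ} (x : Fam Φ (TermExt.fst β ⋙ I.p) U) :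
    (famMap Φ α.preserves U).obj ((famMap Φ (P.preserves rfl) U).obj x) ⟶
      (famMap Φ β.preserves U).obj ((famMap Φ (P.preserves rfl) U).obj x) :=
  (famNat Φ (p := TermExt.fst β ⋙ I.p) (p' := 𝟭 C) ((P.preserves rfl).comp α.preserves)
    ((P.preserves rfl).comp β.preserves) (TermExt.section_ β) U).app x

lemma ParamScheme.famTerm_arrow_ext (P : ParamScheme T I) {α : DisplayFunctor T I}
    {β : DepProjFunctor α} {U : Idx Φ}
    {x y x' y' : Fam Φ (TermExt.fst β ⋙ I.p) U} {f : x ⟶ y} {g : x' ⟶ y'}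
    (h : Arrow.mk ((famMap Φ (P.preserves rfl) U).map f) =
      Arrow.mk ((famMap Φ (P.preserves rfl) U).map g))
    (hx : Arrow.mk (P.famSection Φ β x) = Arrow.mk (P.famSection Φ β x'))
    (hy : Arrow.mk (P.famSection Φ β y) = Arrow.mk (P.famSection Φ β y')) :
    Arrow.mk f = Arrow.mk g := by
  have hx' : ∀ V, Arrow.mk (x.obj.obj V).tm = Arrow.mk (x'.obj.obj V).tm := fun V =>
    congrArg (fun a : Arrow (Fam Φ (𝟭 C) U) => Arrow.mk (a.hom.hom.app V)) hx
  have hy' : ∀ V, Arrow.mk (y.obj.obj V).tm = Arrow.mk (y'.obj.obj V).tm := fun V =>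
    congrArg (fun a : Arrow (Fam Φ (𝟭 C) U) => Arrow.mk (a.hom.hom.app V)) hy
  exact fam_arrow_ext
    (fam_ext (TermExt.functor_ext (congrArg (fun a => a.obj) (arrow_mk_eq_left h)) hx'))
    (fam_ext (TermExt.functor_ext (congrArg (fun a => a.obj) (arrow_mk_eq_right h)) hy'))
    (fun V => TermExt.arrow_ext
      (congrArg (fun a : Arrow (Fam Φ I.p U) => Arrow.mk (a.hom.hom.app V)) h) (hx' V) (hy' V))

lemma ParamScheme.exists_famTerm_arrow (P : ParamScheme T I) {α : DisplayFunctor T I}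
    {β : DepProjFunctor α} {U : Idx Φ} {x y : Fam Φ I.p U} {f : x ⟶ y}
    {s : (famMap Φ α.preserves U).obj x ⟶ (famMap Φ β.preserves U).obj x}
    {t : (famMap Φ α.preserves U).obj y ⟶ (famMap Φ β.preserves U).obj y}
    (hs : s ≫ (famNat Φ β.preserves α.preserves β.π U).app x = 𝟙 _)
    (ht : t ≫ (famNat Φ β.preserves α.preserves β.π U).app y = 𝟙 _)
    (h : (famMap Φ α.preserves U).map f ≫ t = s ≫ (famMap Φ β.preserves U).map f) :
    ∃ (z z' : Fam Φ (TermExt.fst β ⋙ I.p) U) (m : z ⟶ z'),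
      Arrow.mk ((famMap Φ (P.preserves rfl) U).map m) = Arrow.mk f ∧
      Arrow.mk (P.famSection Φ β z) = Arrow.mk s ∧ Arrow.mk (P.famSection Φ β z') = Arrow.mk t := by
  have fam : ∀ {x : Fam Φ I.p U}
      {s : (famMap Φ α.preserves U).obj x ⟶ (famMap Φ β.preserves U).obj x}
      (hs : s ≫ (famNat Φ β.preserves α.preserves β.π U).app x = 𝟙 _),
      IsFam Φ (TermExt.fst β ⋙ I.p) U
        (TermExt.lift β x.obj s.hom fun V => congrArg (fun k => k.hom.app V) hs) :=
    fun {x s} hs W V e => ⟨TermExt.isStronglyCartesian β P.isStronglyCartesian _, (x.property e).2⟩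
  exact ⟨⟨_, fam hs⟩, ⟨_, fam ht⟩, ObjectProperty.homMk
    { app := fun V => ⟨f.hom.app V, congrArg (fun k => k.hom.app V) h⟩
      naturality := fun V W e => TermExt.Hom.ext (f.hom.naturality e) }, rfl, rfl, rfl⟩

end Families

section Induced

variable {C : Type (max u v)} [Category.{v} C] [HasFiniteProducts C]
variable {Φ : Order.PFilter (Subobject (⊤_ C))}
variable {T : CompData.{v, u} C} {I : BasedCategory.{v, max u v} C}
variable {J : BasedCategory.{max u v, max u v} (BaseCat Φ)}

/-- The functor to display maps of the filter quotient induced by a functor `I ⥤ D(T)`. -/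
noncomputable def DisplayFunctor.induced (hT : T.IsComprehensionCategory) (α : DisplayFunctor T I)
    (L : J.obj ⥤ FCat Φ I.p) (hL : L ⋙ FCat.base Φ I.p = J.p) :
    DisplayFunctor (T.filterQuotient Φ hT) J where
  dom := L ⋙ FCat.map Φ α.preserves
  π := Functor.whiskerLeft L (FCat.natTrans Φ α.preserves (preservesRestrictions_base I.p) α.π) ≫
    eqToHom hL
  isDisplay θ := by
    have h := hT.displayMaps_natTrans α.preserves (preservesRestrictions_base I.p) α.isDisplay
      (L.obj θ)
    have : IsIso ((eqToHom hL).app θ) := inferInstance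
    exact MorphismProperty.RespectsIso.postcomp _ ((eqToHom hL).app θ) _ h
  equifibered := by
    refine NatTrans.Equifibered.comp (fun _ _ f => ?_) (NatTrans.Equifibered.of_isIso (eqToHom hL))
    exact FCat.equifibered_natTrans α.preserves (preservesRestrictions_base I.p) α.equifibered
      (L.map f)

lemma DisplayFunctor.induced_π (hT : T.IsComprehensionCategory) (α : DisplayFunctor T I)
    (L : J.obj ⥤ FCat Φ I.p) (hL : L ⋙ FCat.base Φ I.p = J.p) (θ : J.obj) :
    Arrow.mk ((α.induced hT L hL).π.app θ) = Arrow.mk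
      ((FCat.natTrans Φ α.preserves (preservesRestrictions_base I.p) α.π).app (L.obj θ)) := by
  have h : (α.induced hT L hL).π.app θ = 𝟙 _ ≫
      (FCat.natTrans Φ α.preserves (preservesRestrictions_base I.p) α.π).app (L.obj θ) ≫
        eqToHom (Functor.congr_obj hL θ) :=
    (congrArg (_ ≫ ·) (eqToHom_app hL θ)).trans (Category.id_comp _).symm
  rw [h]
  exact arrow_mk_eqToHom_conj rfl _ _

/-- The functor to dependent projections of the filter quotient induced by a functor
`I ⥤ D₁(T)`. -/
noncomputable def DepProjFunctor.induced (hT : T.IsComprehensionCategory) {α : DisplayFunctor T I}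
    (β : DepProjFunctor α) (L : J.obj ⥤ FCat Φ I.p) (hL : L ⋙ FCat.base Φ I.p = J.p) :
    DepProjFunctor (α.induced hT L hL) where
  dom := L ⋙ FCat.map Φ β.preserves
  π := Functor.whiskerLeft L (FCat.natTrans Φ β.preserves α.preserves β.π)
  isDepProjection _ := hT.depProjections_natTrans _ _ β.isDepProjection _
  equifibered _ _ f :=
    FCat.equifibered_natTrans β.preserves α.preserves β.equifibered (L.map f)

variable {hT : T.IsComprehensionCategory} {K : FCat Φ I.p ⥤ J.obj}

lemma TypeExt.isStronglyCartesian_map_snd (P : ParamScheme T I) (α : DisplayFunctor T I)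
    {X Y : FCat Φ (TypeExt.fst α ⋙ I.p)} (m : X ⟶ Y) :
    (FCat.base Φ T.T.p).IsStronglyCartesian
      ((FCat.base Φ T.T.p).map ((FCat.map Φ (TypeExt.snd_preserves P α)).map m))
      ((FCat.map Φ (TypeExt.snd_preserves P α)).map m) :=
  FCat.hom_ind (P := fun _ _ m => (FCat.base Φ T.T.p).IsStronglyCartesian
      ((FCat.base Φ T.T.p).map ((FCat.map Φ (TypeExt.snd_preserves P α)).map m))
      ((FCat.map Φ (TypeExt.snd_preserves P α)).map m)) (fun U x y f => by
    rw [FCat.map_ι_map]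
    refine isStronglyCartesian_comp (isStronglyCartesian_of_iso _)
      (isStronglyCartesian_comp (FCat.isStronglyCartesian_ι fun V => ?_)
        (isStronglyCartesian_of_iso _))
    exact isStronglyCartesian_map (TypeExt.Hom.cartesian (f.hom.app V))) m

/-- The comparison functor for an extension by a type parameter. -/
noncomputable def ParamScheme.compareType (P : ParamScheme T I) (α : DisplayFunctor T I)
    (α' : DisplayFunctor (T.filterQuotient Φ hT) J)
    (α_dom : K ⋙ α'.dom = FCat.map Φ α.preserves) :
    FCat Φ (TypeExt.fst α ⋙ I.p) ⥤ TypeExt α' :=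
  TypeExt.lift α' (FCat.map Φ (P.preserves rfl) ⋙ K) (FCat.map Φ (TypeExt.snd_preserves P α))
    (by
      rw [Functor.assoc, α_dom, ← FCat.map_comp]
      refine (FCat.map_comp Φ (TypeExt.snd_preserves P α) (preservesRestrictions_base T.T.p)).symm.trans ?_
      exact FCat.map_congr (TypeExt.snd_comp α) _ _)
    (fun _ _ m => TypeExt.isStronglyCartesian_map_snd P α m)

lemma ParamScheme.compareType_isIso (P : ParamScheme T I) (α : DisplayFunctor T I)
    (α' : DisplayFunctor (T.filterQuotient Φ hT) J)
    (α_dom : K ⋙ α'.dom = FCat.map Φ α.preserves) (hK : IsIsoOfCategories K) :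
    IsIsoOfCategories (P.compareType α α' α_dom) := by
  have := hT.fibered
  refine isIsoOfCategories_of_bijective (fun X Y X' Y' m m' h => ?_) (fun X Y m => ?_)
  · obtain ⟨U, -, x, y, f, hf⟩ := FCat.exists_arrow_le m (Idx.top Φ)
    obtain ⟨V, -, x', y', f', hf'⟩ := FCat.exists_arrow_le m' (Idx.top Φ)
    have h₁ := hK.arrow_injective (arrow_mk_map_eq (TypeExt.fst α') h)
    have h₂ := arrow_mk_map_eq (TypeExt.snd α') h
    have h₁' := (FCat.arrow_map_ι (P.preserves rfl) f).symm.trans ((arrow_mk_map_eq _ hf).trans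
      (h₁.trans ((arrow_mk_map_eq _ hf'.symm).trans (FCat.arrow_map_ι (P.preserves rfl) f'))))
    have h₂' := (FCat.arrow_map_ι (TypeExt.snd_preserves P α) f).symm.trans
      ((arrow_mk_map_eq _ hf).trans (h₂.trans ((arrow_mk_map_eq _ hf'.symm).trans
        (FCat.arrow_map_ι (TypeExt.snd_preserves P α) f'))))
    obtain ⟨W, a, b, h₁'⟩ := FCat.arrow_ι_eq h₁'
    obtain ⟨W', a', b', h₂'⟩ := FCat.arrow_ι_eq h₂'
    obtain ⟨N, c, c'⟩ := Idx.exists_le W W'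
    refine hf.symm.trans (Eq.trans ?_ hf')
    exact FCat.arrow_ι_eq_of_restrict (c.trans a) (c.trans b) (P.famType_arrow_ext
      (arrow_mk_map_eq (famRestrict Φ I.p c) h₁') (arrow_mk_map_eq (famRestrict Φ T.T.p c') h₂'))
  · obtain ⟨X₁, Y₁, a, ha⟩ := hK.arrow_surjective ((TypeExt.fst α').map m)
    have hb := isStronglyCartesian_map (p := FCat.base Φ T.T.p) (TypeExt.Hom.cartesian m)
    obtain ⟨V, s, t, g, hg, hg'⟩ := FCat.exists_isCartesianFam_arrow (TypeExt.Hom.ty m) hb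
    obtain ⟨U, hU, x, y, f, hf⟩ := FCat.exists_arrow_le a V
    have e : Arrow.mk ((FCat.base Φ T.T.p).map ((FCat.ι Φ T.T.p V).map g)) =
        Arrow.mk ((FCat.map Φ α.preserves).map ((FCat.ι Φ I.p U).map f)) := by
      refine (arrow_mk_map_eq _ hg').trans ((arrow_mk_eq_of_isHomLift (p := FCat.base Φ T.T.p)
        (TypeExt.Hom.cartesian m).toIsHomLift).trans ?_)
      refine (arrow_mk_map_eq α'.dom ha).symm.trans ?_
      refine Eq.trans (congrArg (fun H : FCat Φ I.p ⥤ _ => Arrow.mk (H.map a)) α_dom) ?_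
      exact (arrow_mk_map_eq _ hf).symm
    obtain ⟨W, h₁, h₂, e⟩ := FCat.arrow_ι_eq ((FCat.arrow_map_ι _ g).symm.trans
      (e.trans (FCat.arrow_map_ι _ f)))
    obtain ⟨z, z', n, hn₁, hn₂⟩ := P.exists_famType_arrow (hg.restrict h₁)
      (f := (famRestrict Φ I.p h₂).map f) e
    refine ⟨_, _, (FCat.ι Φ _ W).map n, TypeExt.arrow_ext ?_ ?_⟩
    · refine Eq.trans (arrow_mk_map_eq K ((FCat.arrow_map_ι (P.preserves rfl) n).trans
        ((arrow_mk_map_eq _ hn₁).trans ((FCat.arrow_ι_restrict h₂ f).trans hf)))) ha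
    · exact (FCat.arrow_map_ι (TypeExt.snd_preserves P α) n).trans
        ((arrow_mk_map_eq _ hn₂).trans ((FCat.arrow_ι_restrict h₁ g).trans hg'))

/-- The universal section over the comparison functor for an extension by a term parameter. -/
noncomputable def ParamScheme.compareSection (P : ParamScheme T I) {α : DisplayFunctor T I}
    (β : DepProjFunctor α) {α' : DisplayFunctor (T.filterQuotient Φ hT) J}
    (β' : DepProjFunctor α') (α_dom : K ⋙ α'.dom = FCat.map Φ α.preserves)
    (β_dom : K ⋙ β'.dom = FCat.map Φ β.preserves) :
    (FCat.map Φ (p := TermExt.fst β ⋙ I.p) (P.preserves rfl) ⋙ K) ⋙ α'.dom ⟶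
      (FCat.map Φ (p := TermExt.fst β ⋙ I.p) (P.preserves rfl) ⋙ K) ⋙ β'.dom :=
  eqToHom (by rw [Functor.assoc, α_dom, ← FCat.map_comp]) ≫
    FCat.natTrans Φ (p := TermExt.fst β ⋙ I.p) (p' := 𝟭 C) ((P.preserves rfl).comp α.preserves)
      ((P.preserves rfl).comp β.preserves) (TermExt.section_ β) ≫
    eqToHom (by rw [Functor.assoc, β_dom, ← FCat.map_comp])

lemma ParamScheme.compareSection_app (P : ParamScheme T I) {α : DisplayFunctor T I}
    (β : DepProjFunctor α) {α' : DisplayFunctor (T.filterQuotient Φ hT) J}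
    (β' : DepProjFunctor α') (α_dom : K ⋙ α'.dom = FCat.map Φ α.preserves)
    (β_dom : K ⋙ β'.dom = FCat.map Φ β.preserves) (X : FCat Φ (TermExt.fst β ⋙ I.p)) :
    Arrow.mk ((P.compareSection β β' α_dom β_dom).app X) = Arrow.mk
      ((FCat.natTrans Φ (p := TermExt.fst β ⋙ I.p) (p' := 𝟭 C) ((P.preserves rfl).comp α.preserves)
        ((P.preserves rfl).comp β.preserves) (TermExt.section_ β)).app X) := by
  rw [compareSection, NatTrans.comp_app, NatTrans.comp_app, eqToHom_app, eqToHom_app]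
  exact arrow_mk_eqToHom_conj _ _ _

lemma ParamScheme.compareSection_ι (P : ParamScheme T I) {α : DisplayFunctor T I}
    (β : DepProjFunctor α) {α' : DisplayFunctor (T.filterQuotient Φ hT) J}
    (β' : DepProjFunctor α') (α_dom : K ⋙ α'.dom = FCat.map Φ α.preserves)
    (β_dom : K ⋙ β'.dom = FCat.map Φ β.preserves) {U : Idx Φ}
    (x : Fam Φ (TermExt.fst β ⋙ I.p) U) :
    Arrow.mk ((P.compareSection β β' α_dom β_dom).app ((FCat.ι Φ _ U).obj x)) =
      Arrow.mk ((FCat.ι Φ (𝟭 C) U).map (P.famSection Φ β x)) :=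
  (P.compareSection_app β β' α_dom β_dom _).trans (FCat.natTrans_ι Φ _ _ (TermExt.section_ β) U x)

/-- The comparison functor for an extension by a term parameter. -/
noncomputable def ParamScheme.compareTerm (P : ParamScheme T I) {α : DisplayFunctor T I}
    (β : DepProjFunctor α) {α' : DisplayFunctor (T.filterQuotient Φ hT) J}
    (β' : DepProjFunctor α') (α_dom : K ⋙ α'.dom = FCat.map Φ α.preserves)
    (β_dom : K ⋙ β'.dom = FCat.map Φ β.preserves)
    (β_π : ∀ θ : FCat Φ I.p, Arrow.mk (β'.π.app (K.obj θ)) = Arrow.mk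
        ((FCat.natTrans Φ β.preserves α.preserves β.π).app θ)) :
    FCat Φ (TermExt.fst β ⋙ I.p) ⥤ TermExt β' :=
  TermExt.lift β' (FCat.map Φ (P.preserves rfl) ⋙ K) (P.compareSection β β' α_dom β_dom)
    (fun X => by
      obtain ⟨U, x, rfl⟩ := FCat.exists_rep X
      have e : P.famSection Φ β x ≫ (famNat Φ β.preserves α.preserves β.π U).app
          ((famMap Φ (P.preserves rfl) U).obj x) = 𝟙 _ := fam_hom_ext fun V => (x.obj.obj V).sec
      refine comp_eq_id_of_arrow_mk_eq ((Functor.map_comp _ _ _).symm.trans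
        ((congrArg (FCat.ι Φ (𝟭 C) U).map e).trans (CategoryTheory.Functor.map_id _ _)))
        (P.compareSection_ι β β' α_dom β_dom x).symm ?_
      refine (FCat.natTrans_ι Φ β.preserves α.preserves β.π U _).symm.trans ?_
      refine Eq.trans ?_ (β_π _).symm
      exact congrArg (fun Y => Arrow.mk ((FCat.natTrans Φ β.preserves α.preserves β.π).app Y))
        (FCat.map_ι (P.preserves rfl) x).symm)

lemma ParamScheme.compareTerm_isIso (P : ParamScheme T I) {α : DisplayFunctor T I}
    (β : DepProjFunctor α) {α' : DisplayFunctor (T.filterQuotient Φ hT) J}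
    (β' : DepProjFunctor α') (α_dom : K ⋙ α'.dom = FCat.map Φ α.preserves)
    (β_dom : K ⋙ β'.dom = FCat.map Φ β.preserves)
    (β_π : ∀ θ : FCat Φ I.p, Arrow.mk (β'.π.app (K.obj θ)) = Arrow.mk
        ((FCat.natTrans Φ β.preserves α.preserves β.π).app θ)) (hK : IsIsoOfCategories K) :
    IsIsoOfCategories (P.compareTerm β β' α_dom β_dom β_π) := by
  refine isIsoOfCategories_of_bijective (fun X Y X' Y' m m' h => ?_) (fun X Y m => ?_)
  · obtain ⟨U, -, x, y, f, hf⟩ := FCat.exists_arrow_le m (Idx.top Φ)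
    obtain ⟨V, -, x', y', f', hf'⟩ := FCat.exists_arrow_le m' (Idx.top Φ)
    have h₁ := hK.arrow_injective (arrow_mk_map_eq (TermExt.fst β') h)
    have h₁' := (FCat.arrow_map_ι (P.preserves rfl) f).symm.trans ((arrow_mk_map_eq _ hf).trans
      (h₁.trans ((arrow_mk_map_eq _ hf'.symm).trans (FCat.arrow_map_ι (P.preserves rfl) f'))))
    have hs : ∀ {Z Z' : FCat Φ (TermExt.fst β ⋙ I.p)} {U V : Idx Φ}
        {x : Fam Φ (TermExt.fst β ⋙ I.p) U} {x' : Fam Φ (TermExt.fst β ⋙ I.p) V}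
        (_ : (FCat.ι Φ _ U).obj x = Z) (_ : (FCat.ι Φ _ V).obj x' = Z')
        (_ : (P.compareTerm β β' α_dom β_dom β_π).obj Z =
          (P.compareTerm β β' α_dom β_dom β_π).obj Z'),
        Arrow.mk ((FCat.ι Φ (𝟭 C) U).map (P.famSection Φ β x)) =
          Arrow.mk ((FCat.ι Φ (𝟭 C) V).map (P.famSection Φ β x')) := by
      intro Z Z' U V x x' hx hx' e
      subst hx hx'
      refine (P.compareSection_ι β β' α_dom β_dom x).symm.trans (Eq.trans ?_
        (P.compareSection_ι β β' α_dom β_dom x'))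
      exact congrArg (fun z : TermExt β' => Arrow.mk z.tm) e
    obtain ⟨W, a, b, h₁'⟩ := FCat.arrow_ι_eq h₁'
    obtain ⟨W', a', b', h₂⟩ := FCat.arrow_ι_eq
      (hs (arrow_mk_eq_left hf) (arrow_mk_eq_left hf') (arrow_mk_eq_left h))
    obtain ⟨W'', a'', b'', h₃⟩ := FCat.arrow_ι_eq
      (hs (arrow_mk_eq_right hf) (arrow_mk_eq_right hf') (arrow_mk_eq_right h))
    obtain ⟨N', c, c'⟩ := Idx.exists_le W W'
    obtain ⟨N, d, d'⟩ := Idx.exists_le N' W''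
    refine hf.symm.trans (Eq.trans ?_ hf')
    exact FCat.arrow_ι_eq_of_restrict (d'.trans a'') (d'.trans b'') (P.famTerm_arrow_ext
      (arrow_mk_map_eq (famRestrict Φ I.p (d.trans c)) h₁')
      (arrow_mk_map_eq (famRestrict Φ (𝟭 C) (d.trans c')) h₂)
      (arrow_mk_map_eq (famRestrict Φ (𝟭 C) d') h₃))
  · obtain ⟨X₁, Y₁, a, ha⟩ := hK.arrow_surjective ((TermExt.fst β').map m)
    obtain ⟨U, -, x, y, f, hf⟩ := FCat.exists_arrow_le a (Idx.top Φ)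
    have hm := (arrow_mk_map_eq K hf).trans ha
    have hα : ∀ {X Y : FCat Φ I.p} (k : X ⟶ Y), Arrow.mk (α'.dom.map (K.map k)) =
        Arrow.mk ((FCat.map Φ α.preserves).map k) := fun k =>
      congrArg (fun H : FCat Φ I.p ⥤ _ => Arrow.mk (H.map k)) α_dom
    have hβ : ∀ {X Y : FCat Φ I.p} (k : X ⟶ Y), Arrow.mk (β'.dom.map (K.map k)) =
        Arrow.mk ((FCat.map Φ β.preserves).map k) := fun k =>
      congrArg (fun H : FCat Φ I.p ⥤ _ => Arrow.mk (H.map k)) β_dom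
    have hsec : ∀ (Z : TermExt β') (x : Fam Φ I.p U) (_ : K.obj ((FCat.ι Φ I.p U).obj x) = Z.inst),
        ∃ t : (FCat.ι Φ (𝟭 C) U).obj ((famMap Φ α.preserves U).obj x) ⟶
            (FCat.ι Φ (𝟭 C) U).obj ((famMap Φ β.preserves U).obj x),
          Arrow.mk t = Arrow.mk Z.tm ∧
          t ≫ (FCat.ι Φ (𝟭 C) U).map ((famNat Φ β.preserves α.preserves β.π U).app x) = 𝟙 _ := by
      rintro ⟨θ, t, ht⟩ x hx
      have hx : K.obj ((FCat.ι Φ I.p U).obj x) = θ := hx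
      subst hx
      have e₁ := (Functor.congr_obj α_dom ((FCat.ι Φ I.p U).obj x)).trans (FCat.map_ι α.preserves x)
      have e₂ := (Functor.congr_obj β_dom ((FCat.ι Φ I.p U).obj x)).trans (FCat.map_ι β.preserves x)
      refine ⟨eqToHom e₁.symm ≫ t ≫ eqToHom e₂, arrow_mk_eqToHom_conj _ _ _, ?_⟩
      exact comp_eq_id_of_arrow_mk_eq ht (arrow_mk_eqToHom_conj _ _ _).symm
        ((β_π _).trans (FCat.natTrans_ι Φ β.preserves α.preserves β.π U x))
    obtain ⟨s, hs, hs'⟩ := hsec X x (arrow_mk_eq_left hm)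
    obtain ⟨t, ht, ht'⟩ := hsec Y y (arrow_mk_eq_right hm)
    have hst : (FCat.ι Φ (𝟭 C) U).map ((famMap Φ α.preserves U).map f) ≫ t =
        s ≫ (FCat.ι Φ (𝟭 C) U).map ((famMap Φ β.preserves U).map f) := by
      refine comm_of_arrow_mk_eq (TermExt.Hom.comm m) ?_ ht.symm hs.symm ?_
      · exact (arrow_mk_map_eq α'.dom hm).symm.trans ((hα _).trans (FCat.arrow_map_ι _ f))
      · exact (arrow_mk_map_eq β'.dom hm).symm.trans ((hβ _).trans (FCat.arrow_map_ι _ f))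
    obtain ⟨W, _, hU, _, _, _, s₀, t₀, rfl, rfl⟩ := FCat.exists_homMk₂ s t U
    rw [← FCat.homMk_famRestrict hU, FCat.homMk_comp, ← FCat.homMk_id hU] at hs' ht'
    rw [← FCat.homMk_famRestrict hU, ← FCat.homMk_famRestrict hU, FCat.homMk_comp,
      FCat.homMk_comp] at hst
    obtain ⟨N₁, a₁, hs'⟩ := FCat.homMk_inj hs'
    obtain ⟨N₂, a₂, ht'⟩ := FCat.homMk_inj ht'
    obtain ⟨N₃, a₃, hst⟩ := FCat.homMk_inj hst
    obtain ⟨N₄, b₁, b₂⟩ := Idx.exists_le N₁ N₂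
    obtain ⟨N, b₄, b₃⟩ := Idx.exists_le N₄ N₃
    have c : N ≤ W := b₃.trans a₃
    obtain ⟨z, z', n, hn, hz, hz'⟩ := P.exists_famTerm_arrow (β := β) (x := famRes (c.trans hU) x)
      (y := famRes (c.trans hU) y) (f := (famRestrict Φ I.p (c.trans hU)).map f)
      (s := homRes c s₀) (t := homRes c t₀) (congrArg (homRes (b₄.trans b₁)) hs')
      (congrArg (homRes (b₄.trans b₂)) ht') (congrArg (homRes b₃) hst)
    have key : ∀ {x : Fam Φ I.p U} (s : famRes hU ((famMap Φ α.preserves U).obj x) ⟶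
        famRes hU ((famMap Φ β.preserves U).obj x)) (z : Fam Φ (TermExt.fst β ⋙ I.p) N)
        (_ : Arrow.mk (P.famSection Φ β z) = Arrow.mk (homRes c s)),
        Arrow.mk ((P.compareTerm β β' α_dom β_dom β_π).obj ((FCat.ι Φ _ N).obj z)).tm =
          Arrow.mk (FCat.homMk hU hU s) := fun s z h => by
      refine (P.compareSection_ι β β' α_dom β_dom z).trans ((arrow_mk_map_eq _ h).trans ?_)
      refine (FCat.arrow_homMk (c.trans hU) (c.trans hU) (homRes c s)).symm.trans ?_
      exact congrArg Arrow.mk (FCat.homMk_homRes c s)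
    refine ⟨_, _, (FCat.ι Φ _ N).map n, TermExt.arrow_ext ?_ ((key _ z hz).trans hs)
      ((key _ z' hz').trans ht)⟩
    exact Eq.trans (arrow_mk_map_eq K ((FCat.arrow_map_ι (P.preserves rfl) n).trans
      ((arrow_mk_map_eq _ hn).trans (FCat.arrow_ι_restrict (c.trans hU) f)))) hm

end Induced

section Scheme

variable {C : Type (max u v)} [Category.{v} C] [HasFiniteProducts C]
variable (Φ : Order.PFilter (Subobject (⊤_ C)))
variable {T : CompData.{v, u} C} {I : BasedCategory.{v, max u v} C}

/-- A parameter scheme induces one over the filter quotient, whose instantiation is isomorphic to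
the filtered colimit of the instantiation. -/
lemma ParamScheme.exists_induces (hT : T.IsComprehensionCategory) (P : ParamScheme T I) :
    ∃ (J : BasedCategory.{max u v, max u v} (BaseCat Φ))
      (Q : ParamScheme (T.filterQuotient Φ hT) J) (K : FCat Φ I.p ⥤ J.obj)
      (_ : K ⋙ J.p = FCat.base Φ I.p), P.Induces Φ hT Q K ∧ IsIsoOfCategories K := by
  induction P with
  | nil => exact ⟨_, .nil, 𝟭 _, (FCat.map_id (preservesRestrictions_base (𝟭 C))).symm, .nil,
      𝟭 _, rfl, rfl⟩
  | @type I P α ih =>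
    obtain ⟨J, Q, K, hK, h, hK'⟩ := ih
    obtain ⟨L, h₁, h₂⟩ := id hK'
    have hL : L ⋙ FCat.base Φ I.p = J.p := by
      rw [← hK, ← Functor.assoc, h₂, Functor.id_comp]
    have α_dom : K ⋙ (α.induced hT L hL).dom = FCat.map Φ α.preserves := by
      change K ⋙ L ⋙ _ = _
      rw [← Functor.assoc, h₁, Functor.id_comp]
    have hLK : ∀ θ, L.obj (K.obj θ) = θ := Functor.congr_obj h₁
    have α_π : ∀ θ : FCat Φ I.p, Arrow.mk ((α.induced hT L hL).π.app (K.obj θ)) = Arrow.mk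
        ((FCat.natTrans Φ α.preserves (preservesRestrictions_base I.p) α.π).app θ) := fun θ =>
      (α.induced_π hT L hL _).trans (congrArg (fun θ => Arrow.mk
        ((FCat.natTrans Φ α.preserves (preservesRestrictions_base I.p) α.π).app θ)) (hLK θ))
    refine ⟨_, Q.type (α.induced hT L hL), P.compareType α _ α_dom, ?_,
      .type P Q K h α _ α_dom α_π _ rfl rfl, P.compareType_isIso α _ α_dom hK'⟩
    change FCat.map Φ (P.preserves rfl) ⋙ K ⋙ J.p = _
    rw [hK]
    exact (FCat.map_comp Φ (P.preserves rfl) (preservesRestrictions_base I.p)).symm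
  | @term I P α β ih =>
    obtain ⟨J, Q, K, hK, h, hK'⟩ := ih
    obtain ⟨L, h₁, h₂⟩ := id hK'
    have hL : L ⋙ FCat.base Φ I.p = J.p := by
      rw [← hK, ← Functor.assoc, h₂, Functor.id_comp]
    have α_dom : K ⋙ (α.induced hT L hL).dom = FCat.map Φ α.preserves := by
      change K ⋙ L ⋙ _ = _
      rw [← Functor.assoc, h₁, Functor.id_comp]
    have β_dom : K ⋙ (β.induced hT L hL).dom = FCat.map Φ β.preserves := by
      change K ⋙ L ⋙ _ = _
      rw [← Functor.assoc, h₁, Functor.id_comp]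
    have hLK : ∀ θ, L.obj (K.obj θ) = θ := Functor.congr_obj h₁
    have α_π : ∀ θ : FCat Φ I.p, Arrow.mk ((α.induced hT L hL).π.app (K.obj θ)) = Arrow.mk
        ((FCat.natTrans Φ α.preserves (preservesRestrictions_base I.p) α.π).app θ) := fun θ =>
      (α.induced_π hT L hL _).trans (congrArg (fun θ => Arrow.mk
        ((FCat.natTrans Φ α.preserves (preservesRestrictions_base I.p) α.π).app θ)) (hLK θ))
    have β_π : ∀ θ : FCat Φ I.p, Arrow.mk ((β.induced hT L hL).π.app (K.obj θ)) = Arrow.mk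
        ((FCat.natTrans Φ β.preserves α.preserves β.π).app θ) := fun θ =>
      congrArg (fun θ => Arrow.mk
        ((FCat.natTrans Φ β.preserves α.preserves β.π).app θ)) (hLK θ)
    refine ⟨_, Q.term (α.induced hT L hL) (β.induced hT L hL),
      P.compareTerm β _ α_dom β_dom β_π, ?_,
      .term P Q K h α _ α_dom α_π β _ β_dom β_π _ rfl (P.compareSection_app β _ α_dom β_dom),
      P.compareTerm_isIso β _ α_dom β_dom β_π hK'⟩
    change FCat.map Φ (P.preserves rfl) ⋙ K ⋙ J.p = _
    rw [hK]
    exact (FCat.map_comp Φ (P.preserves rfl) (preservesRestrictions_base I.p)).symm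

end Scheme

section Arrows

variable {D : Type*} [Category D] {E : Type*} [Category E]

lemma isIso_of_arrow_mk_eq {X Y X' Y' : D} {f : X ⟶ Y} {g : X' ⟶ Y'}
    (h : Arrow.mk f = Arrow.mk g) (hf : IsIso f) : IsIso g := by
  obtain rfl := arrow_mk_eq_left h
  obtain rfl := arrow_mk_eq_right h
  obtain rfl := Arrow.mk_injective _ _ h
  infer_instance

lemma IsIsoOfCategories.isIso_of_map {K : D ⥤ E} (hK : IsIsoOfCategories K) {X Y : D} (f : X ⟶ Y)
    (hf : IsIso (K.map f)) : IsIso f := by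
  obtain ⟨L, h₁, -⟩ := hK
  exact isIso_of_arrow_mk_eq (f := L.map (K.map f))
    (congrArg (fun H : D ⥤ D => Arrow.mk (H.map f)) h₁) inferInstance

lemma arrow_mk_eqToHom_eq {X Y : D} (h : X = Y) : Arrow.mk (eqToHom h) = Arrow.mk (𝟙 X) := by
  subst h
  rfl

lemma functor_eq_of_arrow_mk_app_eq {G G' H : D ⥤ E} (σ : G ⟶ G') (τ : G ⟶ H)
    [∀ d, IsIso (σ.app d)] (h : ∀ d, Arrow.mk (σ.app d) = Arrow.mk (τ.app d)) : G' = H := by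
  have hobj : ∀ d, G'.obj d = H.obj d := fun d => arrow_mk_eq_right (h d)
  have e : ∀ d, τ.app d = eqToHom rfl ≫ σ.app d ≫ eqToHom (hobj d) := fun d =>
    eq_eqToHom_of_arrow_mk_eq (h d).symm rfl (hobj d).symm
  clear h
  refine CategoryTheory.Functor.ext hobj fun d d' f => ?_
  rw [← cancel_epi (σ.app d), ← σ.naturality]
  have n := τ.naturality f
  rw [e, e] at n
  simp only [eqToHom_refl, Category.id_comp, Category.assoc] at n
  rw [← reassoc_of% n, eqToHom_trans, eqToHom_refl, Category.comp_id]

lemma comma_arrow_ext {A : Type*} [Category A] {L : D ⥤ E} {R : A ⥤ E} {c c' d d' : Comma L R}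
    (hc : c = c') {f : c ⟶ d} {g : c' ⟶ d'} [IsIso f] (h : Arrow.mk f.left = Arrow.mk g.left)
    (h' : Arrow.mk f.right = Arrow.mk g.right) : Arrow.mk f = Arrow.mk g := by
  subst hc
  obtain ⟨X, Y, k⟩ := d
  obtain ⟨X', Y', k'⟩ := d'
  obtain rfl : X = X' := arrow_mk_eq_right h
  obtain rfl : Y = Y' := arrow_mk_eq_right h'
  have h := Arrow.mk_injective _ _ h
  have h' := Arrow.mk_injective _ _ h'
  have : IsIso f.left := inferInstanceAs (IsIso ((Comma.fst L R).map f))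
  have hf := f.w
  have hg := g.w
  rw [← h, ← h', ← hf, cancel_epi] at hg
  obtain rfl : k' = k := hg
  exact congrArg Arrow.mk (CommaMorphism.ext h h')

lemma isPullback_comp_eqToHom {G H H' : D ⥤ E} {τ : G ⟶ H} (e : H = H') {a b : D} {f : a ⟶ b}
    (h : IsPullback (G.map f) (τ.app a) (τ.app b) (H.map f)) :
    IsPullback (G.map f) ((τ ≫ eqToHom e).app a) ((τ ≫ eqToHom e).app b) (H'.map f) := by
  subst e
  simpa using h

end Arrows

section Families

variable {C : Type (max u v)} [Category.{v} C] [HasFiniteProducts C]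
variable {Φ : Order.PFilter (Subobject (⊤_ C))}
variable {F : Type (max u v)} [Category.{v} F] {p : F ⥤ C}
variable {F' : Type (max u v)} [Category.{v} F'] {p' : F' ⥤ C}

lemma IsRestriction.of_iso {W : Subobject (⊤_ C)} {x y x' y' : F} {r : y ⟶ x}
    (h : IsRestriction p W r) (i : y' ≅ y) (j : x ≅ x') :
    IsRestriction p W (i.hom ≫ r ≫ j.hom) := by
  obtain ⟨h₁, q, ⟨hq⟩⟩ := h
  refine ⟨isStronglyCartesian_comp (isStronglyCartesian_of_iso _)
    (isStronglyCartesian_comp h₁ (isStronglyCartesian_of_iso _)), p.map i.hom ≫ q, ⟨?_⟩⟩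
  have key : ∀ {Z : C} (f : Z ⟶ p.obj x') (g : Z ⟶ (W : C)),
      ∃ l : Z ⟶ p.obj y', l ≫ p.map (i.hom ≫ r ≫ j.hom) = f := fun f g => by
    obtain ⟨l, hl, -⟩ := BinaryFan.IsLimit.lift' hq (f ≫ p.map j.inv) g
    have hl : l ≫ p.map r = f ≫ p.map j.inv := hl
    refine ⟨l ≫ p.map i.inv, ?_⟩
    rw [Category.assoc, ← p.map_comp, i.inv_hom_id_assoc, p.map_comp, ← Category.assoc, hl,
      Category.assoc, ← p.map_comp, j.inv_hom_id, p.map_id, Category.comp_id]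
  have mono : ∀ {Z : C} (f g : Z ⟶ p.obj y'),
      f ≫ p.map (i.hom ≫ r ≫ j.hom) = g ≫ p.map (i.hom ≫ r ≫ j.hom) → f = g := fun f g e => by
    rw [p.map_comp, p.map_comp, ← Category.assoc, ← Category.assoc, ← Category.assoc,
      ← Category.assoc, cancel_mono] at e
    rw [← cancel_mono (p.map i.hom)]
    exact BinaryFan.IsLimit.hom_ext hq e (FilterQuotient.hom_eq _ _)
  exact BinaryFan.isLimitMk (fun c => (key c.fst c.snd).choose)
    (fun c => (key c.fst c.snd).choose_spec) (fun c => FilterQuotient.hom_eq _ _)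
    (fun c m e _ => mono _ _ (e.trans (key c.fst c.snd).choose_spec.symm))

/-- A family of objects can be transported along isomorphisms of its members. -/
lemma exists_fam_of_iso {U : Idx Φ} (x : Fam Φ p U) {y : Set.Iic U → F}
    (e : ∀ V, x.obj.obj V ≅ y V) :
    ∃ (x' : Fam Φ p U) (i : x ≅ x'), ∀ V, Arrow.mk (i.hom.hom.app V) = Arrow.mk (e V).hom := by
  let X : Set.Iic U ⥤ F :=
    { obj := y
      map := fun {V W} h => (e V).inv ≫ x.obj.map h ≫ (e W).hom
      map_id := fun V => by simp
      map_comp := fun h k => by simp }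
  exact ⟨⟨X, fun _ _ h => (x.property h).of_iso (e _).symm (e _)⟩,
    ObjectProperty.isoMk _ (NatIso.ofComponents e fun {V W} h =>
      ((e V).hom_inv_id_assoc (x.obj.map h ≫ (e W).hom)).symm), fun _ => rfl⟩

lemma fam_arrow_eq_of_app {U : Idx Φ} {x y y' : Fam Φ p U} (f : x ⟶ y) (g : x ⟶ y')
    (hf : ∀ V, IsIso (f.hom.app V)) (h : ∀ V, Arrow.mk (f.hom.app V) = Arrow.mk (g.hom.app V)) :
    Arrow.mk f = Arrow.mk g :=
  fam_arrow_ext rfl (fam_ext (functor_eq_of_arrow_mk_app_eq f.hom g.hom h)) h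

lemma fam_isIso_app {U : Idx Φ} {x y : Fam Φ p U} (f : x ⟶ y) [IsIso f] (V : Set.Iic U) :
    IsIso (f.hom.app V) :=
  inferInstanceAs (IsIso (((IsFam Φ p U).ι ⋙ (evaluation _ _).obj V).map f))

lemma FCat.map_homMk_inj {G : F ⥤ F'} (hG : PreservesRestrictions p p' G) {U V W : Idx Φ}
    {x : Fam Φ p U} {y : Fam Φ p V} {hU : W ≤ U} {hV : W ≤ V} {f g : famRes hU x ⟶ famRes hV y}
    (h : (map Φ hG).map (homMk hU hV f) = (map Φ hG).map (homMk hU hV g)) :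
    ∃ (N : Idx Φ) (h : N ≤ W), homRes h (mapRes hG f) = homRes h (mapRes hG g) := by
  rw [map_homMk, map_homMk, cancel_epi, cancel_mono] at h
  exact homMk_inj h

lemma FCat.exists_arrow_from {U : Idx Φ} {x : Fam Φ p U} {X Y : FCat Φ p}
    (hX : (ι Φ p U).obj x = X) (m : X ⟶ Y) (N : Idx Φ) :
    ∃ (W : Idx Φ) (hU : W ≤ U) (_ : W ≤ N) (y : Fam Φ p W) (f : famRes hU x ⟶ y),
      Arrow.mk ((ι Φ p W).map f) = Arrow.mk m := by
  subst hX
  obtain ⟨V, y, rfl⟩ := exists_rep Y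
  obtain ⟨W, hU, hV, hN, f, rfl⟩ := exists_homMk_le m N
  exact ⟨W, hU, hN, _, f, (arrow_homMk hU hV f).symm⟩

lemma FCat.arrow_id_ι {U : Idx Φ} {x : Fam Φ p U} {X : FCat Φ p} (hX : (ι Φ p U).obj x = X) :
    Arrow.mk ((ι Φ p U).map (𝟙 x)) = Arrow.mk (𝟙 X) := by
  subst hX
  rw [CategoryTheory.Functor.map_id]

end Families

namespace FCoSwPData

lemma exists_iso_of_carrier_of_toInst {C : Type (max u v)} [Category.{v} C]
    {E : FCoSwPData.{v, u} C} (hE : E.IsFCoSwP) (s : E.S.obj) {X : C} {θ : E.I.obj}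
    (l : E.carrier.obj s ⟶ X) (r : E.toInst.obj s ⟶ θ) (hl : IsIso l) (hr : IsIso r) :
    ∃ (s' : E.S.obj) (i : s ≅ s'), Arrow.mk (E.carrier.map i.hom) = Arrow.mk l ∧
      Arrow.mk (E.toInst.map i.hom) = Arrow.mk r := by
  let b : Comma (𝟭 C) E.I.p :=
    { left := X, right := θ, hom := inv l ≫ (E.U.obj s).hom ≫ E.I.p.map r }
  let i : E.U.obj s ≅ b := Comma.isoMk (asIso l) (asIso r) (by
    change l ≫ inv l ≫ (E.U.obj s).hom ≫ E.I.p.map r = _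
    rw [IsIso.hom_inv_id_assoc]
    rfl)
  obtain ⟨s', j, hj⟩ := hE.isofibration i
  have hj := arrow_mk_eq_of_isHomLift hj
  exact ⟨s', j, arrow_mk_map_eq (Comma.fst _ _) hj, arrow_mk_map_eq (Comma.snd _ _) hj⟩

variable {C : Type (max u v)} [Category.{v} C] [HasFiniteProducts C]
variable {Φ : Order.PFilter (Subobject (⊤_ C))}
variable {E : FCoSwPData.{v, u} C} (hE : E.IsFCoSwP)
variable {J : BasedCategory.{max u v, max u v} (BaseCat Φ)}
variable (Q : ParamScheme (E.T.filterQuotient Φ hE.comprehension) J) {K : FCat Φ E.I.p ⥤ J.obj}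
variable (hK : K ⋙ J.p = FCat.base Φ E.I.p)

lemma faithful_filterQuotient (hK' : IsIsoOfCategories K) :
    (E.filterQuotient Φ hE Q K hK).U.Faithful where
  map_injective {X Y m m'} h := by
    obtain ⟨U, x, rfl⟩ := FCat.exists_rep X
    obtain ⟨V, y, rfl⟩ := FCat.exists_rep Y
    obtain ⟨W, _, hU, hV, _, _, f, f', rfl, rfl⟩ := FCat.exists_homMk₂ m m' (Idx.top Φ)
    have := hK'.faithful
    have h₁ : (FCat.map Φ hE.carrier_preserves).map _ = (FCat.map Φ hE.carrier_preserves).map _ :=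
      congrArg CommaMorphism.left h
    have h₂ : (FCat.map Φ hE.toInst_preserves).map _ = (FCat.map Φ hE.toInst_preserves).map _ :=
      K.map_injective (congrArg CommaMorphism.right h)
    obtain ⟨N₁, a, h₁⟩ := FCat.map_homMk_inj hE.carrier_preserves h₁
    obtain ⟨N₂, b, h₂⟩ := FCat.map_homMk_inj hE.toInst_preserves h₂
    obtain ⟨N, c, d⟩ := Idx.exists_le N₁ N₂
    have := hE.faithful
    exact FCat.homMk_eq_iff.2 ⟨N, c.trans a, c.trans a, fam_hom_ext fun M => E.U.map_injective
      (CommaMorphism.ext (congrArg (fun k => (homRes c k).hom.app M) h₁)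
        (congrArg (fun k => (homRes d k).hom.app M) h₂))⟩

lemma isIsofibration_filterQuotient (hK' : IsIsoOfCategories K) :
    IsIsofibration (E.filterQuotient Φ hE Q K hK).U := by
  intro s b e
  obtain ⟨U, x, rfl⟩ := FCat.exists_rep s
  have hl : IsIso (CommaMorphism.left e.hom) := inferInstanceAs (IsIso ((Comma.fst _ _).map e.hom))
  have hr : IsIso (CommaMorphism.right e.hom) := inferInstanceAs (IsIso ((Comma.snd _ _).map e.hom))
  obtain ⟨Y, ρ, hρ⟩ : ∃ (Y : FCat Φ E.I.p)
      (ρ : (FCat.map Φ hE.toInst_preserves).obj ((FCat.ι Φ E.S.p U).obj x) ⟶ Y),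
      Arrow.mk (K.map ρ) = Arrow.mk e.hom.right := by
    obtain ⟨X', Y, ρ, h⟩ := hK'.arrow_surjective e.hom.right
    obtain ⟨L, h₁, -⟩ := hK'
    have h₁ : ∀ Z, L.obj (K.obj Z) = Z := Functor.congr_obj h₁
    obtain rfl : X' = (FCat.map Φ hE.toInst_preserves).obj ((FCat.ι Φ E.S.p U).obj x) :=
      (h₁ _).symm.trans ((congrArg L.obj (arrow_mk_eq_left h)).trans (h₁ _))
    exact ⟨Y, ρ, h⟩
  have hρ' : IsIso ρ := hK'.isIso_of_map ρ (isIso_of_arrow_mk_eq hρ.symm hr)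
  obtain ⟨W₁, hW₁, -, t, r, hr'⟩ := FCat.exists_arrow_from
    (FCat.map_ι hE.toInst_preserves x).symm ρ (Idx.top Φ)
  obtain ⟨W₂, hW₂, h₂₁, a, l, hl'⟩ := FCat.exists_arrow_from
    (FCat.map_ι hE.carrier_preserves x).symm e.hom.left W₁
  have := isIso_of_arrow_mk_eq hr'.symm hρ'
  have := isIso_of_arrow_mk_eq hl'.symm hl
  obtain ⟨N₁, hN₁, hri⟩ := FCat.exists_isIso_of_isIso_ι r
  obtain ⟨N₂, hN₂, hli⟩ := FCat.exists_isIso_of_isIso_ι l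
  obtain ⟨N, c, d⟩ := Idx.exists_le N₁ N₂
  have hri' : ∀ V, IsIso (((famRestrict Φ E.I.p (c.trans hN₁)).map r).hom.app V) := fun V =>
    fam_isIso_app ((famRestrict Φ E.I.p hN₁).map r) ((incl Φ c).obj V)
  have hli' : ∀ V, IsIso (((famRestrict Φ (𝟭 C) (d.trans hN₂)).map l).hom.app V) := fun V =>
    fam_isIso_app ((famRestrict Φ (𝟭 C) hN₂).map l) ((incl Φ d).obj V)
  have hNU : N ≤ U := (c.trans hN₁).trans hW₁
  choose y j hj₁ hj₂ using fun V : Set.Iic N => exists_iso_of_carrier_of_toInst hE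
    ((famRes hNU x).obj.obj V) (((famRestrict Φ (𝟭 C) (d.trans hN₂)).map l).hom.app V)
    (((famRestrict Φ E.I.p (c.trans hN₁)).map r).hom.app V) (hli' V) (hri' V)
  obtain ⟨x', i, hi⟩ := exists_fam_of_iso (famRes hNU x) j
  have e₁ : Arrow.mk ((famMap Φ hE.carrier_preserves N).map i.hom) =
      Arrow.mk ((famRestrict Φ (𝟭 C) (d.trans hN₂)).map l) :=
    fam_arrow_eq_of_app _ _ (fun V => fam_isIso_app _ V)
      (fun V => (arrow_mk_map_eq E.carrier (hi V)).trans (hj₁ V))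
  have e₂ : Arrow.mk ((famMap Φ hE.toInst_preserves N).map i.hom) =
      Arrow.mk ((famRestrict Φ E.I.p (c.trans hN₁)).map r) :=
    fam_arrow_eq_of_app _ _ (fun V => fam_isIso_app _ V)
      (fun V => (arrow_mk_map_eq E.toInst (hi V)).trans (hj₂ V))
  let j' : (FCat.ι Φ E.S.p U).obj x ≅ (FCat.ι Φ E.S.p N).obj x' :=
    eqToIso (FCat.ι_famRes hNU x).symm ≪≫ (FCat.ι Φ E.S.p N).mapIso i
  have hj' : Arrow.mk j'.hom = Arrow.mk ((FCat.ι Φ E.S.p N).map i.hom) := by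
    have := arrow_mk_eqToHom_conj (FCat.ι_famRes hNU x).symm ((FCat.ι Φ E.S.p N).map i.hom) rfl
    rwa [eqToHom_refl, Category.comp_id] at this
  refine ⟨(FCat.ι Φ E.S.p N).obj x', j', isHomLift_of_arrow_mk_eq ?_⟩
  have : IsIso ((E.filterQuotient Φ hE Q K hK).U.map j'.hom) :=
    Iso.isIso_hom ((E.filterQuotient Φ hE Q K hK).U.mapIso j')
  refine comma_arrow_ext rfl ?_ ?_
  · exact (arrow_mk_map_eq (FCat.map Φ hE.carrier_preserves) hj').trans
      ((FCat.arrow_map_ι hE.carrier_preserves i.hom).trans ((arrow_mk_map_eq _ e₁).trans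
        ((FCat.arrow_ι_restrict _ l).trans hl')))
  · exact Eq.trans (arrow_mk_map_eq K ((arrow_mk_map_eq (FCat.map Φ hE.toInst_preserves) hj').trans
      ((FCat.arrow_map_ι hE.toInst_preserves i.hom).trans ((arrow_mk_map_eq _ e₂).trans
        ((FCat.arrow_ι_restrict _ r).trans hr'))))) hρ

lemma isAmnestic_filterQuotient (hK' : IsIsoOfCategories K) :
    IsAmnestic (E.filterQuotient Φ hE Q K hK).U := by
  intro s s' e he
  have he := arrow_mk_eq_of_isHomLift he
  obtain ⟨U, -, x, y, f, hf⟩ := FCat.exists_arrow_le e.hom (Idx.top Φ)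
  have h1 := FCat.arrow_id_ι (arrow_mk_eq_left hf)
  suffices h : Arrow.mk (𝟙 s) = Arrow.mk e.hom by
    obtain rfl := arrow_mk_eq_right h
    exact ⟨rfl, (Arrow.mk_injective _ _ h).symm⟩
  have hU : Arrow.mk ((E.filterQuotient Φ hE Q K hK).U.map e.hom) =
      Arrow.mk ((E.filterQuotient Φ hE Q K hK).U.map (𝟙 s)) :=
    he.trans (congrArg Arrow.mk (CategoryTheory.Functor.map_id _ _).symm)
  have h₁ : Arrow.mk ((FCat.map Φ hE.carrier_preserves).map e.hom) =
      Arrow.mk ((FCat.map Φ hE.carrier_preserves).map (𝟙 s)) :=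
    arrow_mk_map_eq (Comma.fst _ _) hU
  have h₂ : Arrow.mk ((FCat.map Φ hE.toInst_preserves).map e.hom) =
      Arrow.mk ((FCat.map Φ hE.toInst_preserves).map (𝟙 s)) :=
    hK'.arrow_injective (arrow_mk_map_eq (Comma.snd _ _) hU)
  have h₁ := (FCat.arrow_map_ι hE.carrier_preserves f).symm.trans ((arrow_mk_map_eq _ hf).trans
    (h₁.trans ((arrow_mk_map_eq _ h1.symm).trans (FCat.arrow_map_ι hE.carrier_preserves (𝟙 x)))))
  have h₂ := (FCat.arrow_map_ι hE.toInst_preserves f).symm.trans ((arrow_mk_map_eq _ hf).trans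
    (h₂.trans ((arrow_mk_map_eq _ h1.symm).trans (FCat.arrow_map_ι hE.toInst_preserves (𝟙 x)))))
  obtain ⟨W₁, a₁, _, h₁⟩ := FCat.arrow_ι_eq h₁
  obtain ⟨W₂, a₂, _, h₂⟩ := FCat.arrow_ι_eq h₂
  have := isIso_of_arrow_mk_eq hf.symm (Iso.isIso_hom e)
  obtain ⟨W₃, a₃, hi⟩ := FCat.exists_isIso_of_isIso_ι f
  obtain ⟨W₄, b₁, b₂⟩ := Idx.exists_le W₁ W₂
  obtain ⟨N, b₄, b₃⟩ := Idx.exists_le W₄ W₃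
  have hN : N ≤ U := b₃.trans a₃
  have key : Arrow.mk ((famRestrict Φ E.S.p hN).map (𝟙 x)) =
      Arrow.mk ((famRestrict Φ E.S.p hN).map f) := by
    refine fam_arrow_eq_of_app _ _ (fun V => fam_isIso_app _ V) fun V => ?_
    have hV : IsIso (((famRestrict Φ E.S.p hN).map f).hom.app V) :=
      fam_isIso_app ((famRestrict Φ E.S.p a₃).map f) ((incl Φ b₃).obj V)
    have h₁V : Arrow.mk (E.carrier.map (((famRestrict Φ E.S.p hN).map f).hom.app V)) =
        Arrow.mk (E.carrier.map (𝟙 ((famRes hN x).obj.obj V))) :=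
      congrArg (fun k : Arrow (Fam Φ (𝟭 C) W₁) =>
        Arrow.mk (k.hom.hom.app ((incl Φ (b₄.trans b₁)).obj V))) h₁
    have h₂V : Arrow.mk (E.toInst.map (((famRestrict Φ E.S.p hN).map f).hom.app V)) =
        Arrow.mk (E.toInst.map (𝟙 ((famRes hN x).obj.obj V))) :=
      congrArg (fun k : Arrow (Fam Φ E.I.p W₂) =>
        Arrow.mk (k.hom.hom.app ((incl Φ (b₄.trans b₂)).obj V))) h₂
    have hUV : Arrow.mk (E.U.map (((famRestrict Φ E.S.p hN).map f).hom.app V)) =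
        Arrow.mk (E.U.map (𝟙 ((famRes hN x).obj.obj V))) := comma_arrow_ext rfl h₁V h₂V
    rw [CategoryTheory.Functor.map_id] at hUV
    obtain ⟨h, h'⟩ := hE.amnestic (asIso (((famRestrict Φ E.S.p hN).map f).hom.app V))
      (isHomLift_of_arrow_mk_eq hUV)
    have h' : ((famRestrict Φ E.S.p hN).map f).hom.app V = eqToHom h := h'
    rw [h']
    exact (arrow_mk_eqToHom_eq h).symm
  exact h1.symm.trans ((FCat.arrow_ι_eq_of_restrict hN hN key).trans hf)

/-- The filter quotient of a fibred category of structures with parameters is one. -/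
lemma IsFCoSwP.filterQuotient (hK' : IsIsoOfCategories K) :
    (E.filterQuotient Φ hE Q K hK).IsFCoSwP where
  comprehension := hE.comprehension.filterQuotient
  fibered := by
    have := hE.fibered
    exact FCat.base_isFibered
  over_base := by
    change (FCat.map Φ hE.toInst_preserves ⋙ K) ⋙ J.p = _
    rw [Functor.assoc, hK]
    refine (FCat.map_comp Φ hE.toInst_preserves (preservesRestrictions_base E.I.p)).symm.trans ?_
    exact FCat.map_congr hE.over_base _ _
  cartesian_inst _ _ _ _ := Q.isStronglyCartesian _
  cartesian_arrow a b φ hφ := by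
    have := hE.fibered
    refine isPullback_comp_eqToHom (G := FCat.map Φ hE.carrier_preserves)
      (τ := FCat.natTrans Φ hE.carrier_preserves
        (hE.toInst_preserves.comp (preservesRestrictions_base E.I.p)) E.structureMap) _ ?_
    refine FCat.cartesian_ind (P := fun X Y m => IsPullback
      ((FCat.map Φ hE.carrier_preserves).map m)
      ((FCat.natTrans Φ hE.carrier_preserves
        (hE.toInst_preserves.comp (preservesRestrictions_base E.I.p)) E.structureMap).app X)
      ((FCat.natTrans Φ hE.carrier_preserves
        (hE.toInst_preserves.comp (preservesRestrictions_base E.I.p)) E.structureMap).app Y)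
      ((FCat.map Φ (hE.toInst_preserves.comp (preservesRestrictions_base E.I.p))).map m))
      (fun U x y f hf => ?_) φ hφ
    exact FCat.isPullback_natTrans _ _ _ f fun V => hE.cartesian_arrow _ (hf V)
  faithful := faithful_filterQuotient hE Q hK hK'
  isofibration := isIsofibration_filterQuotient hE Q hK hK'
  amnestic := isAmnestic_filterQuotient hE Q hK hK'

end FCoSwPData

end FilterQuotients


theorem proposition3p13 {C : Type (max u v)} [Category.{v} C] [HasFiniteProducts C]
    (Φ : Order.PFilter (Subobject (⊤_ C))) (E : FCoSwPData.{v, u} C) (hE : E.IsFCoSwP)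
    (hT : HasTerminal E.T.T.obj) (hS : HasTerminal E.S.obj) :
    -- the base category is the filter quotient of `C`, compatibly with the maps from the `C_U`
    (∃ e : FilterQuotient Φ ≌ BaseCat Φ, ∀ U : Idx Φ,
      Nonempty (FCat.ι Φ (𝟭 C) U ⋙ e.inverse ≅
        famEval Φ (𝟭 C) U ⋙ ObjectProperty.ι _ ⋙ FilterQuotient.proj Φ)) ∧
    -- the parameter scheme `P` induces one over `(C_Φ, T_Φ)`, with instantiation `Inst(P)_Φ`,
    -- and the filter quotient data form a fibred category of structures with parameters
    ∃ (J : BasedCategory.{max u v, max u v} (BaseCat Φ))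
      (Q : ParamScheme (E.T.filterQuotient Φ hE.comprehension) J)
      (K : FCat Φ E.I.p ⥤ J.obj) (hK : K ⋙ J.p = FCat.base Φ E.I.p),
      E.P.Induces Φ hE.comprehension Q K ∧ IsIsoOfCategories K ∧ J.p.IsFibered ∧
        (E.filterQuotient Φ hE Q K hK).IsFCoSwP := by
  obtain ⟨J, Q, K, hK, h, hK'⟩ := E.P.exists_induces Φ hE.comprehension
  exact ⟨FilterQuotient.exists_equivalence Φ, J, Q, K, hK, h, hK',
    Q.isFibered hE.comprehension.filterQuotient.fibered,
    FCoSwPData.IsFCoSwP.filterQuotient hE Q hK hK'⟩
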